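/- **Setting.** Let $\mathcal S_\star$ be a compact smooth surface without boundary (in the application $\mathcal S_\star\approx\mathbb S^2$), $\mathcal N_\star=\{u=0,\ v\ge 0\}$ and $\mathcal N_\star'=\{v=0,\ u\ge 0\}$ the two null hypersurfaces through $\mathcal S_\star=\{u=v=0\}$, with local coordinates $(v,u,x^{\mathcal A})$, $\mathcal A=2,3$. The unknowns are the coefficients of the Newman–Penrose (NP) frame $l=\partial_v+C^{\mathcal A}\partial_{\mathcal A}$, $n=Q\,\partial_u$, $m=P^{\mathcal A}\partial_{\mathcal A}$ ($C^{\mathcal A}$ and $Q>0$ real, $m,\bar m$ linearly independent), the spin connection coefficients $\epsilon,\pi,\beta,\mu,\alpha,\lambda,\tau,\sigma,\rho$ and the Weyl components $\Psi_0,\dots,\Psi_4$. Stewart's gauge means $\kappa=\nu=\gamma=0$, $\rho=\bar\rho$, $\mu=\bar\mu$, $\pi=\alpha+\bar\beta$, together with $C^{\mathcal A}=0$ and $\epsilon=\bar\epsilon$ on $\mathcal N_\star$ and $Q=1$ on $\mathcal N_\star'$. With $D=\partial_v+C^{\mathcal A}\partial_{\mathcal A}$, $\Delta=Q\partial_u$,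 $\delta=P^{\mathcal A}\partial_{\mathcal A}$, $\bar\delta=\bar P^{\mathcal A}\partial_{\mathcal A}$, the vacuum Einstein equations in this gauge are the following NP equations. (a) Equations with $D$: $DP^{\mathcal A}-\delta C^{\mathcal A}=(\rho+\epsilon-\bar\epsilon)P^{\mathcal A}+\sigma\bar P^{\mathcal A}$; $DQ=-(\epsilon+\bar\epsilon)Q$; $D\tau=\Psi_1+\bar\pi\rho+\pi\sigma+(\epsilon-\bar\epsilon)\tau+\rho\tau+\sigma\bar\tau$; $\delta\epsilon-D\beta=-\Psi_1+\bar\alpha\epsilon+\beta\bar\epsilon-\epsilon\bar\pi-\beta\bar\rho-\alpha\sigma-\pi\sigma$; $D\sigma=\Psi_0+3\epsilon\sigma-\bar\epsilon\sigma+\rho\sigma+\bar\rho\sigma$; $\delta\pi-D\mu=-\Psi_2+\epsilon\mu+\bar\epsilon\mu+\bar\alpha\pi-\beta\pi-\pi\bar\pi-\mu\bar\rho-\lambda\sigma$; $\bar\delta\epsilon-D\alpha=2\alpha\epsilon+\bar\beta\epsilon-\alpha\bar\epsilon-\epsilon\pi-\alpha\rho-\pi\rho-\beta\bar\sigma$;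 $D\rho=(\epsilon+\bar\epsilon)\rho+\rho^2+\sigma\bar\sigma$; $\bar\delta\pi-D\lambda=3\epsilon\lambda-\bar\epsilon\lambda-\alpha\pi+\bar\beta\pi-\pi^2-\lambda\rho-\mu\bar\sigma$; $\bar\delta\Psi_0-D\Psi_1=(4\alpha-\pi)\Psi_0-2(2\rho+\epsilon)\Psi_1$; $D\Psi_2-\bar\delta\Psi_1=-\lambda\Psi_0+2(\pi-\alpha)\Psi_1+3\rho\Psi_2$; $D\Psi_3-\bar\delta\Psi_2=2(\rho-\epsilon)\Psi_3+3\pi\Psi_2-2\lambda\Psi_1$; $\bar\delta\Psi_3-D\Psi_4=(4\epsilon-\rho)\Psi_4-2(2\pi+\alpha)\Psi_3+3\lambda\Psi_2$. (b) Equations with $\Delta$: $\Delta C^{\mathcal A}=-(\bar\tau+\pi)P^{\mathcal A}-(\tau+\bar\pi)\bar P^{\mathcal A}$; $\Delta P^{\mathcal A}=-\mu P^{\mathcal A}-\bar\lambda\bar P^{\mathcal A}$; $\Delta\epsilon=-\Psi_2-\beta\pi-\alpha\bar\pi-\alpha\tau-\pi\tau-\beta\bar\tau$; $\Delta\pi=-\Psi_3-\mu\pi-\lambda\bar\pi-\lambda\tau-\mu\bar\tau$;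 $-\Delta\beta=\alpha\bar\lambda+\beta\mu+\mu\tau$; $-\Delta\mu=\lambda\bar\lambda+\mu^2$; $\delta\tau-\Delta\sigma=\bar\lambda\rho+\mu\sigma-\bar\alpha\tau+\beta\tau+\tau^2$; $-\Delta\alpha=\Psi_3+\beta\lambda+\alpha\bar\mu+\lambda\tau$; $-\Delta\lambda=\Psi_4+\lambda\mu+\lambda\bar\mu$; $\bar\delta\tau-\Delta\rho=\Psi_2+\bar\mu\rho+\lambda\sigma+\alpha\tau-\bar\beta\tau+\tau\bar\tau$; $\Delta\Psi_0-\delta\Psi_1=-\mu\Psi_0-2(2\tau+\beta)\Psi_1+3\sigma\Psi_2$; $\Delta\Psi_1-\delta\Psi_2=-2\mu\Psi_1-3\tau\Psi_2+2\sigma\Psi_3$; $\Delta\Psi_2-\delta\Psi_3=\sigma\Psi_4+2(\beta-\tau)\Psi_3-3\mu\Psi_2$; $\Delta\Psi_3-\delta\Psi_4=(4\beta-\tau)\Psi_4-4\mu\Psi_3$. (c) Constraints on the spheres: $\bar\delta P^{\mathcal A}-\delta\bar P^{\mathcal A}=(\alpha-\bar\beta)P^{\mathcal A}-(\bar\alpha-\beta)\bar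 P^{\mathcal A}$; $\delta Q=(\tau-\bar\pi)Q$; $\bar\delta\beta-\delta\alpha=\Psi_2-\alpha\bar\alpha+2\alpha\beta-\beta\bar\beta-\epsilon\mu+\epsilon\bar\mu-\mu\rho+\lambda\sigma$; $\bar\delta\mu-\delta\lambda=\Psi_3-\bar\alpha\lambda+3\beta\lambda-\alpha\mu-\bar\beta\mu-\mu\pi+\bar\mu\pi$; $\bar\delta\sigma-\delta\rho=\Psi_1-\bar\alpha\rho-\beta\rho+3\alpha\sigma-\bar\beta\sigma-\rho\tau+\bar\rho\tau$. A *full initial data set* on $\{0\le v<v_1\}\subset\mathcal N_\star$ and $\{0\le u<u_1\}\subset\mathcal N_\star'$ consists of all the unknowns on the union of these two sets, smooth on each of them, in Stewart's gauge, satisfying the equations intrinsic to them: the transport equations (a) and the constraints (c) on $\mathcal N_\star$, the transport equations (b) and the constraints (c) on $\mathcal N_\star'$. A *reduced data set* $\mathbf r_\star$ consists of smooth $\Psi_0$ and (real) $\epsilon+\bar\epsilon$ on $\{0\le v<v_\bullet\}\subset\mathcal N_\star$, smooth $\Psi_4$ on $\{0\le u<u_\bullet\}\subset\mathcal N_\star'$,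 and smooth $\lambda,\sigma,\pi$, real $\mu,\rho$, and $P^{\mathcal A}$ (with $m,\bar m$ linearly independent) on $\mathcal S_\star$, where $v_\bullet,u_\bullet>0$. As coordinates $x^{\mathcal A}$ and frames $m$ exist only locally on $\mathcal S_\star$, data are given on each patch of a family of coordinate patches covering $\mathcal S_\star$; on overlaps they are related by the change of the coordinates $x^{\mathcal A}$, under which $C^{\mathcal A}$ and $P^{\mathcal A}$ are components of vectors and the other quantities are scalars, and by a spin $m\mapsto zm$ with $z$ a smooth function of $x$ and $|z|=1$, under which $C^{\mathcal A},Q,\mu,\rho$ are invariant, $P^{\mathcal A}\mapsto zP^{\mathcal A}$, $\sigma\mapsto z^2\sigma$, $\lambda\mapsto\bar z^2\lambda$, $\pi\mapsto\bar z\pi$, $\tau\mapsto z\tau$, $\beta\mapsto z\beta+\frac12\delta z$, $\alpha\mapsto\bar z\alpha-\frac12\bar\delta\bar z$, $\epsilon\mapsto\epsilon+\frac12\bar z\,C^{\mathcal A}\partial_{\mathcal A}z$, $\Psi_k\mapsto z^{2-k}\Psi_k$. **Lemma (freely specifiable data for the characteristic initial value problem).** Let $\mathbf r_\star$ be a reduced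 data set. 1. On every patch, and for all $0<v_1\le v_\bullet$ and $0<u_1\le u_\bullet$, any two full initial data sets on $\{0\le v<v_1\}$, $\{0\le u<u_1\}$ which take the values $\mathbf r_\star$ coincide. 2. There are $0<v_1\le v_\bullet$ and $0<u_1\le u_\bullet$, uniform over $\mathcal S_\star$, and a full initial data set on $\{0\le v<v_1\}\subset\mathcal N_\star$, $\{0\le u<u_1\}\subset\mathcal N_\star'$ which takes the values $\mathbf r_\star$, given on each patch and related on overlaps as described above. Moreover, if on a patch and for some $0<v_2\le v_1$, $0<u_2\le u_1$ a smooth solution of all the equations (a), (b), (c) in Stewart's gauge on $\{0\le v<v_2,\ 0\le u<u_2\}$ takes the values $\mathbf r_\star$, then its restriction to $\mathcal N_\star\cup\mathcal N_\star'$ is this full initial data set. -/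

import Mathlib

open scoped ComplexConjugate ContDiff Manifold

noncomputable section

namespace StewartGauge

/-- The space of the angular coordinates `(x^2, x^3)`; the index `𝒜` ranges over `Fin 2`. -/
abbrev E2 := EuclideanSpace ℝ (Fin 2)

/-- The unknowns of the Newman-Penrose (NP) system in Stewart's gauge: the coefficients of the frame
`l = ∂_v + C^𝒜 ∂_𝒜`, `n = Q ∂_u`, `m = P^𝒜 ∂_𝒜`, the spin connection coefficients which are not
set to zero by the gauge (`κ = ν = γ = 0`), and the components `Ψ₀, …, Ψ₄` of the Weyl tensor. -/
inductive Comp where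
  | C (A : Fin 2)
  | P (A : Fin 2)
  | Q
  | eps
  | pi
  | beta
  | mu
  | alpha
  | lam
  | tau
  | sigma
  | rho
  | Psi (k : Fin 5)

/-- A collection of fields on one coordinate patch: `F c v u x` is the value of the component `c` at
the point with coordinates `(v, u, x)`. The hypersurface `𝒩⋆` is `{u = 0, v ≥ 0}`, the hypersurface
`𝒩⋆'` is `{v = 0, u ≥ 0}`, and `𝒮⋆` is `{u = v = 0}`. A characteristic data set only involves the
values on `𝒩⋆ ∪ 𝒩⋆'`. -/
abbrev Fields := Comp → ℝ → ℝ → E2 → ℂ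

/-- The partial derivative `∂_𝒜` of a function of the angular coordinates. -/
def pd (A : Fin 2) (f : E2 → ℂ) (x : E2) : ℂ :=
  fderiv ℝ f x (EuclideanSpace.single A 1)

/-- `∂_v`, one-sided at `v = 0`. -/
def dv (F : Fields) (v u : ℝ) (x : E2) (c : Comp) : ℂ :=
  derivWithin (fun s => F c s u x) (Set.Ici 0) v

/-- `∂_u`, one-sided at `u = 0`. -/
def du (F : Fields) (v u : ℝ) (x : E2) (c : Comp) : ℂ :=
  derivWithin (fun s => F c v s x) (Set.Ici 0) u

/-- The values of all the components at a point. -/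
def val (F : Fields) (v u : ℝ) (x : E2) (c : Comp) : ℂ := F c v u x

/-- `D = ∂_v + C^𝒜 ∂_𝒜`. -/
def opD (F : Fields) (v u : ℝ) (x : E2) (c : Comp) : ℂ :=
  dv F v u x c + ∑ A, F (.C A) v u x * pd A (F c v u) x

/-- `Δ = Q ∂_u`. -/
def opDelta (F : Fields) (v u : ℝ) (x : E2) (c : Comp) : ℂ :=
  F .Q v u x * du F v u x c

/-- `δ = P^𝒜 ∂_𝒜`. -/
def opd (F : Fields) (v u : ℝ) (x : E2) (c : Comp) : ℂ :=
  ∑ A, F (.P A) v u x * pd A (F c v u) x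

/-- `δ̄ = P̄^𝒜 ∂_𝒜`. -/
def opdb (F : Fields) (v u : ℝ) (x : E2) (c : Comp) : ℂ :=
  ∑ A, conj (F (.P A) v u x) * pd A (F c v u) x

/-! ### The vacuum NP equations in Stewart's gauge

The commutators applied to the coordinates, the NP Ricci identities and the Bianchi identities, with
`κ = ν = γ = 0` and vanishing Ricci curvature. Every equation contains derivatives along `D`, `δ`,
`δ̄` only, along `Δ`, `δ`, `δ̄` only, or along `δ`, `δ̄` only, and the equations are grouped
accordingly. The arguments are the values at a point of the components (`f`), and of their
derivatives along `D` (`Df`), `Δ` (`Lf`), `δ` (`df`) and `δ̄` (`ef`). -/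

/-- The equations which contain `D`; they are intrinsic to `𝒩⋆`. -/
structure OutgoingEqs (f Df df ef : Comp → ℂ) : Prop where
  frame_P : ∀ A, Df (.P A) - df (.C A) =
    (f .rho + f .eps - conj (f .eps)) * f (.P A) + f .sigma * conj (f (.P A))
  frame_Q : Df .Q = -(f .eps + conj (f .eps)) * f .Q
  ricci_tau : -Df .tau = -f (.Psi 1) - conj (f .pi) * f .rho - f .pi * f .sigma
    - f .eps * f .tau + conj (f .eps) * f .tau - f .rho * f .tau - f .sigma * conj (f .tau)
  ricci_beta : df .eps - Df .beta = -f (.Psi 1) + conj (f .alpha) * f .eps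
    + f .beta * conj (f .eps) - f .eps * conj (f .pi) - f .beta * conj (f .rho)
    - f .alpha * f .sigma - f .pi * f .sigma
  ricci_sigma : -Df .sigma = -f (.Psi 0) - 3 * f .eps * f .sigma + conj (f .eps) * f .sigma
    - f .rho * f .sigma - conj (f .rho) * f .sigma
  ricci_mu : df .pi - Df .mu = -f (.Psi 2) + f .eps * f .mu + conj (f .eps) * f .mu
    + conj (f .alpha) * f .pi - f .beta * f .pi - f .pi * conj (f .pi) - f .mu * conj (f .rho)
    - f .lam * f .sigma
  ricci_alpha : ef .eps - Df .alpha = 2 * f .alpha * f .eps + conj (f .beta) * f .eps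
    - f .alpha * conj (f .eps) - f .eps * f .pi - f .alpha * f .rho - f .pi * f .rho
    - f .beta * conj (f .sigma)
  ricci_rho : -Df .rho = -f .eps * f .rho - conj (f .eps) * f .rho - f .rho ^ 2
    - f .sigma * conj (f .sigma)
  ricci_lam : ef .pi - Df .lam = 3 * f .eps * f .lam - conj (f .eps) * f .lam
    - f .alpha * f .pi + conj (f .beta) * f .pi - f .pi ^ 2 - f .lam * f .rho
    - f .mu * conj (f .sigma)
  bianchi_Psi1 : ef (.Psi 0) - Df (.Psi 1) = (4 * f .alpha - f .pi) * f (.Psi 0)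
    - 2 * (2 * f .rho + f .eps) * f (.Psi 1)
  bianchi_Psi2 : Df (.Psi 2) - ef (.Psi 1) = -f .lam * f (.Psi 0)
    + 2 * (f .pi - f .alpha) * f (.Psi 1) + 3 * f .rho * f (.Psi 2)
  bianchi_Psi3 : Df (.Psi 3) - ef (.Psi 2) = 2 * (f .rho - f .eps) * f (.Psi 3)
    + 3 * f .pi * f (.Psi 2) - 2 * f .lam * f (.Psi 1)
  bianchi_Psi4 : ef (.Psi 3) - Df (.Psi 4) = (4 * f .eps - f .rho) * f (.Psi 4)
    - 2 * (2 * f .pi + f .alpha) * f (.Psi 3) + 3 * f .lam * f (.Psi 2)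

/-- The equations which contain `Δ`; they are intrinsic to `𝒩⋆'`. -/
structure IncomingEqs (f Lf df ef : Comp → ℂ) : Prop where
  frame_C : ∀ A, Lf (.C A) = -(conj (f .tau) + f .pi) * f (.P A)
    - (f .tau + conj (f .pi)) * conj (f (.P A))
  frame_P : ∀ A, Lf (.P A) = -f .mu * f (.P A) - conj (f .lam) * conj (f (.P A))
  ricci_eps : Lf .eps = -f (.Psi 2) - f .beta * f .pi - f .alpha * conj (f .pi)
    - f .alpha * f .tau - f .pi * f .tau - f .beta * conj (f .tau)
  ricci_pi : Lf .pi = -f (.Psi 3) - f .mu * f .pi - f .lam * conj (f .pi)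
    - f .lam * f .tau - f .mu * conj (f .tau)
  ricci_beta : -Lf .beta = f .alpha * conj (f .lam) + f .beta * f .mu + f .mu * f .tau
  ricci_mu : -Lf .mu = f .lam * conj (f .lam) + f .mu ^ 2
  ricci_sigma : df .tau - Lf .sigma = conj (f .lam) * f .rho + f .mu * f .sigma
    - conj (f .alpha) * f .tau + f .beta * f .tau + f .tau ^ 2
  ricci_alpha : -Lf .alpha = f (.Psi 3) + f .beta * f .lam + f .alpha * conj (f .mu)
    + f .lam * f .tau
  ricci_lam : -Lf .lam = f (.Psi 4) + f .lam * f .mu + f .lam * conj (f .mu)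
  ricci_rho : ef .tau - Lf .rho = f (.Psi 2) + conj (f .mu) * f .rho + f .lam * f .sigma
    + f .alpha * f .tau - conj (f .beta) * f .tau + f .tau * conj (f .tau)
  bianchi_Psi0 : Lf (.Psi 0) - df (.Psi 1) = -f .mu * f (.Psi 0)
    - 2 * (2 * f .tau + f .beta) * f (.Psi 1) + 3 * f .sigma * f (.Psi 2)
  bianchi_Psi1 : Lf (.Psi 1) - df (.Psi 2) = -2 * f .mu * f (.Psi 1)
    - 3 * f .tau * f (.Psi 2) + 2 * f .sigma * f (.Psi 3)
  bianchi_Psi2 : Lf (.Psi 2) - df (.Psi 3) = f .sigma * f (.Psi 4)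
    + 2 * (f .beta - f .tau) * f (.Psi 3) - 3 * f .mu * f (.Psi 2)
  bianchi_Psi3 : Lf (.Psi 3) - df (.Psi 4) = (4 * f .beta - f .tau) * f (.Psi 4)
    - 4 * f .mu * f (.Psi 3)

/-- The equations which only contain `δ` and `δ̄`; they are constraints on each of the spheres of
constant `u` and `v`. In `frame_P` one has `δ P̄^𝒜 = conj (δ̄ P^𝒜)`. -/
structure SphereEqs (f df ef : Comp → ℂ) : Prop where
  frame_P : ∀ A, ef (.P A) - conj (ef (.P A)) = (f .alpha - conj (f .beta)) * f (.P A)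
    - (conj (f .alpha) - f .beta) * conj (f (.P A))
  frame_Q : df .Q = (f .tau - conj (f .pi)) * f .Q
  ricci_Psi2 : ef .beta - df .alpha = f (.Psi 2) - f .alpha * conj (f .alpha)
    + 2 * f .alpha * f .beta - f .beta * conj (f .beta) - f .eps * f .mu + f .eps * conj (f .mu)
    - f .mu * f .rho + f .lam * f .sigma
  ricci_Psi3 : ef .mu - df .lam = f (.Psi 3) - conj (f .alpha) * f .lam + 3 * f .beta * f .lam
    - f .alpha * f .mu - conj (f .beta) * f .mu - f .mu * f .pi + conj (f .mu) * f .pi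
  ricci_Psi1 : ef .sigma - df .rho = f (.Psi 1) - conj (f .alpha) * f .rho - f .beta * f .rho
    + 3 * f .alpha * f .sigma - conj (f .beta) * f .sigma - f .rho * f .tau + conj (f .rho) * f .tau

/-- The pointwise conditions of Stewart's gauge: `C^𝒜` and `Q` are real, the frame is
non-degenerate, `ρ` and `μ` are real and `π = α + β̄`. -/
structure PointGauge (f : Comp → ℂ) : Prop where
  C_real : ∀ A, conj (f (.C A)) = f (.C A)
  Q_real : conj (f .Q) = f .Q
  Q_pos : 0 < (f .Q).re
  P_indep : f (.P 0) * conj (f (.P 1)) - f (.P 1) * conj (f (.P 0)) ≠ 0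
  rho_real : conj (f .rho) = f .rho
  mu_real : conj (f .mu) = f .mu
  pi_eq : f .pi = f .alpha + conj (f .beta)

/-- The additional gauge conditions `C^𝒜 = 0` and `ε = ε̄` on the part `0 ≤ v < v₁` of `𝒩⋆`, and
`Q = 1` on the part `0 ≤ u < u₁` of `𝒩⋆'`, over the coordinate patch `U`. -/
structure BoundaryGauge (U : Set E2) (v₁ u₁ : ℝ) (F : Fields) : Prop where
  C_zero : ∀ v ∈ Set.Ico 0 v₁, ∀ x ∈ U, ∀ A, F (.C A) v 0 x = 0
  eps_real : ∀ v ∈ Set.Ico 0 v₁, ∀ x ∈ U, conj (F .eps v 0 x) = F .eps v 0 x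
  Q_one : ∀ u ∈ Set.Ico 0 u₁, ∀ x ∈ U, F .Q 0 u x = 1

/-- `F` is a smooth initial data set for the vacuum Einstein equations in Stewart's gauge on the
parts `0 ≤ v < v₁` of `𝒩⋆` and `0 ≤ u < u₁` of `𝒩⋆'`, over the coordinate patch `U`: the gauge
conditions hold, and so do all the vacuum NP equations which are intrinsic to `𝒩⋆` or to `𝒩⋆'`. -/
structure IsCharacteristicData (U : Set E2) (v₁ u₁ : ℝ) (F : Fields) : Prop where
  smooth_out : ∀ c, ContDiffOn ℝ ∞ (fun p : ℝ × E2 => F c p.1 0 p.2) (Set.Ico 0 v₁ ×ˢ U)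
  smooth_in : ∀ c, ContDiffOn ℝ ∞ (fun p : ℝ × E2 => F c 0 p.1 p.2) (Set.Ico 0 u₁ ×ˢ U)
  boundary_gauge : BoundaryGauge U v₁ u₁ F
  gauge_out : ∀ v ∈ Set.Ico 0 v₁, ∀ x ∈ U, PointGauge (val F v 0 x)
  gauge_in : ∀ u ∈ Set.Ico 0 u₁, ∀ x ∈ U, PointGauge (val F 0 u x)
  eqs_out : ∀ v ∈ Set.Ico 0 v₁, ∀ x ∈ U,
    OutgoingEqs (val F v 0 x) (opD F v 0 x) (opd F v 0 x) (opdb F v 0 x)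
  eqs_in : ∀ u ∈ Set.Ico 0 u₁, ∀ x ∈ U,
    IncomingEqs (val F 0 u x) (opDelta F 0 u x) (opd F 0 u x) (opdb F 0 u x)
  constraints_out : ∀ v ∈ Set.Ico 0 v₁, ∀ x ∈ U,
    SphereEqs (val F v 0 x) (opd F v 0 x) (opdb F v 0 x)
  constraints_in : ∀ u ∈ Set.Ico 0 u₁, ∀ x ∈ U,
    SphereEqs (val F 0 u x) (opd F 0 u x) (opdb F 0 u x)

/-- `F` is a smooth solution of the vacuum Einstein equations, in the form of the full vacuum NP
system in Stewart's gauge, for `0 ≤ v < v₁`, `0 ≤ u < u₁` over the coordinate patch `U`. -/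
structure IsVacuumSolution (U : Set E2) (v₁ u₁ : ℝ) (F : Fields) : Prop where
  smooth : ∀ c, ContDiffOn ℝ ∞ (fun p : ℝ × ℝ × E2 => F c p.1 p.2.1 p.2.2)
    (Set.Ico 0 v₁ ×ˢ Set.Ico 0 u₁ ×ˢ U)
  boundary_gauge : BoundaryGauge U v₁ u₁ F
  gauge : ∀ v ∈ Set.Ico 0 v₁, ∀ u ∈ Set.Ico 0 u₁, ∀ x ∈ U, PointGauge (val F v u x)
  eqs_D : ∀ v ∈ Set.Ico 0 v₁, ∀ u ∈ Set.Ico 0 u₁, ∀ x ∈ U,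
    OutgoingEqs (val F v u x) (opD F v u x) (opd F v u x) (opdb F v u x)
  eqs_Delta : ∀ v ∈ Set.Ico 0 v₁, ∀ u ∈ Set.Ico 0 u₁, ∀ x ∈ U,
    IncomingEqs (val F v u x) (opDelta F v u x) (opd F v u x) (opdb F v u x)
  constraints : ∀ v ∈ Set.Ico 0 v₁, ∀ u ∈ Set.Ico 0 u₁, ∀ x ∈ U,
    SphereEqs (val F v u x) (opd F v u x) (opdb F v u x)

/-! ### Reduced data -/

/-- The reduced data set on one coordinate patch: `Ψ₀` and `ε + ε̄` on `𝒩⋆` (functions of `(v, x)`),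
`Ψ₄` on `𝒩⋆'` (a function of `(u, x)`), and `λ, σ, μ, ρ, π, P^𝒜` on `𝒮⋆` (`μ` and `ρ` real). -/
structure ReducedData where
  Psi0 : ℝ → E2 → ℂ
  epsSum : ℝ → E2 → ℝ
  Psi4 : ℝ → E2 → ℂ
  lam : E2 → ℂ
  sigma : E2 → ℂ
  mu : E2 → ℝ
  rho : E2 → ℝ
  pi : E2 → ℂ
  P : Fin 2 → E2 → ℂ

/-- The reduced data are smooth for `0 ≤ v < vmax`, `0 ≤ u < umax` over the coordinate patch `U`,
and `m = P^𝒜 ∂_𝒜` and `m̄` are linearly independent. -/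
structure ReducedData.IsAdmissible (r : ReducedData) (U : Set E2) (vmax umax : ℝ) : Prop where
  Psi0 : ContDiffOn ℝ ∞ (fun p : ℝ × E2 => r.Psi0 p.1 p.2) (Set.Ico 0 vmax ×ˢ U)
  epsSum : ContDiffOn ℝ ∞ (fun p : ℝ × E2 => r.epsSum p.1 p.2) (Set.Ico 0 vmax ×ˢ U)
  Psi4 : ContDiffOn ℝ ∞ (fun p : ℝ × E2 => r.Psi4 p.1 p.2) (Set.Ico 0 umax ×ˢ U)
  lam : ContDiffOn ℝ ∞ r.lam U
  sigma : ContDiffOn ℝ ∞ r.sigma U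
  mu : ContDiffOn ℝ ∞ r.mu U
  rho : ContDiffOn ℝ ∞ r.rho U
  pi : ContDiffOn ℝ ∞ r.pi U
  P : ∀ A, ContDiffOn ℝ ∞ (r.P A) U
  P_indep : ∀ x ∈ U, r.P 0 x * conj (r.P 1 x) - r.P 1 x * conj (r.P 0 x) ≠ 0

/-- The fields `F` take the values prescribed by the reduced data `r`. -/
structure Induces (U : Set E2) (v₁ u₁ : ℝ) (F : Fields) (r : ReducedData) : Prop where
  Psi0 : ∀ v ∈ Set.Ico 0 v₁, ∀ x ∈ U, F (.Psi 0) v 0 x = r.Psi0 v x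
  epsSum : ∀ v ∈ Set.Ico 0 v₁, ∀ x ∈ U, F .eps v 0 x + conj (F .eps v 0 x) = (r.epsSum v x : ℂ)
  Psi4 : ∀ u ∈ Set.Ico 0 u₁, ∀ x ∈ U, F (.Psi 4) 0 u x = r.Psi4 u x
  lam : ∀ x ∈ U, F .lam 0 0 x = r.lam x
  sigma : ∀ x ∈ U, F .sigma 0 0 x = r.sigma x
  mu : ∀ x ∈ U, F .mu 0 0 x = (r.mu x : ℂ)
  rho : ∀ x ∈ U, F .rho 0 0 x = (r.rho x : ℂ)
  pi : ∀ x ∈ U, F .pi 0 0 x = r.pi x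
  P : ∀ A, ∀ x ∈ U, F (.P A) 0 0 x = r.P A x

/-! ### Change of patch

No coordinate system and no frame `m` is defined on the whole of a sphere. Fields on two overlapping
patches are related by a change `t` of the angular coordinates and a spin `m ↦ z m`, `|z| = 1`. -/

/-- The components of the image under the coordinate change `t` of the vector `w^𝒜 ∂_𝒜` at `x`. -/
def push (t : E2 → E2) (x : E2) (w : Fin 2 → ℂ) (A : Fin 2) : ℂ :=
  ∑ B, ((fderiv ℝ t x (EuclideanSpace.single B 1) A : ℝ) : ℂ) * w B

/-- The reduced data `r` and `r'` describe the same reduced data over the overlap `W` (in the first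
coordinates), with respect to the coordinates `x` and `t x` and the frames `m` and `m' = z m`. -/
structure ReducedData.Compatible (r r' : ReducedData) (t : E2 → E2) (z : E2 → ℂ) (W : Set E2)
    (vmax umax : ℝ) : Prop where
  z_smooth : ContDiffOn ℝ ∞ z W
  z_norm : ∀ x ∈ W, ‖z x‖ = 1
  P : ∀ x ∈ W, ∀ A, r'.P A (t x) = z x * push t x (fun B => r.P B x) A
  lam : ∀ x ∈ W, r'.lam (t x) = conj (z x) ^ 2 * r.lam x
  sigma : ∀ x ∈ W, r'.sigma (t x) = z x ^ 2 * r.sigma x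
  mu : ∀ x ∈ W, r'.mu (t x) = r.mu x
  rho : ∀ x ∈ W, r'.rho (t x) = r.rho x
  pi : ∀ x ∈ W, r'.pi (t x) = conj (z x) * r.pi x
  Psi0 : ∀ v ∈ Set.Ico 0 vmax, ∀ x ∈ W, r'.Psi0 v (t x) = z x ^ 2 * r.Psi0 v x
  epsSum : ∀ v ∈ Set.Ico 0 vmax, ∀ x ∈ W, r'.epsSum v (t x) = r.epsSum v x
  Psi4 : ∀ u ∈ Set.Ico 0 umax, ∀ x ∈ W, r'.Psi4 u (t x) = conj (z x) ^ 2 * r.Psi4 u x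

/-- The values of the fields `F` and `F'` at the point with coordinates `(v, u, x)` respectively
`(v, u, t x)` are related by the coordinate change `t` and the spin `m' = z m`, where `z` only
depends on `x`. -/
structure Related (F F' : Fields) (t : E2 → E2) (z : E2 → ℂ) (v u : ℝ) (x : E2) : Prop where
  C : ∀ A, F' (.C A) v u (t x) = push t x (fun B => F (.C B) v u x) A
  P : ∀ A, F' (.P A) v u (t x) = z x * push t x (fun B => F (.P B) v u x) A
  Q : F' .Q v u (t x) = F .Q v u x
  eps : F' .eps v u (t x) =
    F .eps v u x + (1 / 2) * conj (z x) * ∑ A, F (.C A) v u x * pd A z x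
  pi : F' .pi v u (t x) = conj (z x) * F .pi v u x
  beta : F' .beta v u (t x) =
    z x * F .beta v u x + (1 / 2) * ∑ A, F (.P A) v u x * pd A z x
  mu : F' .mu v u (t x) = F .mu v u x
  alpha : F' .alpha v u (t x) =
    conj (z x) * F .alpha v u x - (1 / 2) * conj (∑ A, F (.P A) v u x * pd A z x)
  lam : F' .lam v u (t x) = conj (z x) ^ 2 * F .lam v u x
  tau : F' .tau v u (t x) = z x * F .tau v u x
  sigma : F' .sigma v u (t x) = z x ^ 2 * F .sigma v u x
  rho : F' .rho v u (t x) = F .rho v u x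
  Psi0 : F' (.Psi 0) v u (t x) = z x ^ 2 * F (.Psi 0) v u x
  Psi1 : F' (.Psi 1) v u (t x) = z x * F (.Psi 1) v u x
  Psi2 : F' (.Psi 2) v u (t x) = F (.Psi 2) v u x
  Psi3 : F' (.Psi 3) v u (t x) = conj (z x) * F (.Psi 3) v u x
  Psi4 : F' (.Psi 4) v u (t x) = conj (z x) ^ 2 * F (.Psi 4) v u x

/-- `F` and `F'` describe the same fields on `𝒩⋆` (`0 ≤ v < v₁`) and on `𝒩⋆'` (`0 ≤ u < u₁`) over
the overlap `W`. -/
def CompatibleOn (F F' : Fields) (t : E2 → E2) (z : E2 → ℂ) (W : Set E2) (v₁ u₁ : ℝ) : Prop :=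
  (∀ v ∈ Set.Ico 0 v₁, ∀ x ∈ W, Related F F' t z v 0 x) ∧
    ∀ u ∈ Set.Ico 0 u₁, ∀ x ∈ W, Related F F' t z 0 u x

/-- All the components of `F` and `G` agree on `𝒩⋆` (`0 ≤ v < v₁`) and on `𝒩⋆'` (`0 ≤ u < u₁`) over
the coordinate patch `U`. -/
def AgreeOn (U : Set E2) (v₁ u₁ : ℝ) (F G : Fields) : Prop :=
  ∀ c, (∀ v ∈ Set.Ico 0 v₁, ∀ x ∈ U, F c v 0 x = G c v 0 x) ∧
    ∀ u ∈ Set.Ico 0 u₁, ∀ x ∈ U, F c 0 u x = G c 0 u x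

end StewartGauge

end

open StewartGauge

/-! On a null hypersurface the equations are a triangular hierarchy of ordinary differential
equations along the generators. On `𝒩⋆`, where `D = ∂_v`, the functions `ε` and `Ψ₀` are given. Then
`(ρ, σ)` solves a Riccati system, and `P`, `(α, β, Ψ₁)`, `(μ, λ, Ψ₂)`, `Ψ₃`, `Ψ₄` solve linear
systems in this order, whose sources contain angular derivatives only of quantities already found.
Finally `Q` has its own linear equation and `τ` is read off from `δQ = (τ - π̄)Q`. On `𝒮⋆` the frame
constraint gives `α - β̄` from `P`, the gauge gives `α + β̄ = π`, and the remaining constraints give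
`Ψ₁, Ψ₂, Ψ₃`; so the reduced data contain all initial values. The exchange of the null directions
(`Core.prime`) turns `𝒩⋆'` into the same problem with `ε` replaced by zero, and there `C` and `ε`
follow by quadrature.

The constraints hold off `𝒮⋆` because each defect, modulo the constraints treated before it,
satisfies a homogeneous linear transport equation (`Core.Transport.sphere`).

The only nonlinear step is linearised. The matrix `M` with rows `(ρ, σ)` and `(σ̄, ρ)` satisfies `DM
= M² + 2εM + N`, where `N` has off-diagonal entries `Ψ₀` and `Ψ̄₀`. With `M = -(DY)Y⁻¹` this becomes
a linear second order equation for `Y`, which has rows `(a, b)` and `(b̄, ā)`. The full data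
therefore exist as long as `det Y = aā - bb̄` has no zero.

The transport equations and the constraints are covariant under changes of coordinates and spins, so
uniqueness for the hierarchy shows that data on two patches with related reduced data are related
(`compatibleOn_of_compatible`). Uniqueness on one patch is the case of the identity map and the
trivial spin. The determinants are invariant too: on overlaps they are the same function, equal to
one on `𝒮⋆`, and compactness gives a neighbourhood, uniform over all patches, on which they do not
vanish (`exists_uniform_ne_zero`).

All of this is algebra in a ring with derivations (`TransportRing`). The analysis is the theory of
linear equations with parameters (`exists_isLinearSolution`, `IsLinearSolution.contDiffOn`), which
makes the smooth functions on a slab such a ring. -/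

set_option linter.unusedSimpArgs false

open scoped ComplexConjugate ContDiff Manifold
noncomputable section
namespace StewartGauge

/-! ### Linear ordinary differential equations with parameters -/

section LinearODE

open Set Filter Topology

variable {E : Type*} [NormedAddCommGroup E] [NormedSpace ℝ E]

/-- The terms of the Picard series of the linear equation `y' = A y` with inhomogeneity `e`. -/
def picardTerm {X : Type*} (A : ℝ → X → E →L[ℝ] E) (e : ℝ → X → E) : ℕ → ℝ → X → E
  | 0 => e
  | n + 1 => fun t x => ∫ s in (0 : ℝ)..t, A s x (picardTerm A e n s x)

theorem continuous_picardTerm {X : Type*} [TopologicalSpace X] {A : ℝ → X → E →L[ℝ] E}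
    {e : ℝ → X → E} (hA : Continuous fun p : ℝ × X => A p.1 p.2)
    (he : Continuous fun p : ℝ × X => e p.1 p.2) (n : ℕ) :
    Continuous fun p : ℝ × X => picardTerm A e n p.1 p.2 := by
  induction n with
  | zero => exact he
  | succ n ih =>
    have h : Continuous fun q : (ℝ × X) × ℝ => A q.2 q.1.2 (picardTerm A e n q.2 q.1.2) :=
      (hA.comp (by fun_prop : Continuous fun q : (ℝ × X) × ℝ => (q.2, q.1.2))).clm_apply
        (ih.comp (by fun_prop : Continuous fun q : (ℝ × X) × ℝ => (q.2, q.1.2)))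
    exact intervalIntegral.continuous_parametric_intervalIntegral_of_continuous
      (f := fun (p : ℝ × X) s => A s p.2 (picardTerm A e n s p.2)) h continuous_fst

/-- Each integration of the bound yields the next term of an exponential series, which later serves
as a majorant. -/
theorem norm_picardTerm_le {X : Type*} {A : ℝ → X → E →L[ℝ] E} {e : ℝ → X → E} {x : X}
    {a K C : ℝ} (hK : 0 ≤ K) (hA : ∀ t ∈ Icc 0 a, ‖A t x‖ ≤ K) (he : ∀ t ∈ Icc 0 a, ‖e t x‖ ≤ C)
    (n : ℕ) : ∀ t ∈ Icc 0 a, ‖picardTerm A e n t x‖ ≤ C * ((K * t) ^ n / n.factorial) := by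
  induction n with
  | zero => simpa [picardTerm] using he
  | succ n ih =>
    intro t ht
    have hi : ∀ s ∈ Ioc 0 t, ‖A s x (picardTerm A e n s x)‖
        ≤ K * (C * ((K * s) ^ n / n.factorial)) := by
      intro s hs
      have hs' : s ∈ Icc 0 a := ⟨hs.1.le, hs.2.trans ht.2⟩
      exact ((A s x).le_opNorm _).trans
        (mul_le_mul (hA s hs') (ih s hs') (norm_nonneg _) hK)
    have hintegral : ∫ s in (0 : ℝ)..t, K * (C * ((K * s) ^ n / n.factorial))
        = C * ((K * t) ^ (n + 1) / (n + 1).factorial) := by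
      have : ∀ s : ℝ, K * (C * ((K * s) ^ n / n.factorial))
          = (C * K ^ (n + 1) / n.factorial) * s ^ n := by
        intro s; rw [mul_pow, pow_succ]; ring
      simp_rw [this]
      rw [intervalIntegral.integral_const_mul, integral_pow, Nat.factorial_succ]
      push_cast
      have h1 : (n : ℝ) + 1 ≠ 0 := by positivity
      have h2 : (n.factorial : ℝ) ≠ 0 := by positivity
      field_simp
      ring
    calc ‖picardTerm A e (n + 1) t x‖
        ≤ ∫ s in (0 : ℝ)..t, K * (C * ((K * s) ^ n / n.factorial)) := by
          refine intervalIntegral.norm_integral_le_of_norm_le ht.1 ?_ ?_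
          · exact MeasureTheory.ae_of_all _ hi
          · exact Continuous.intervalIntegrable (by fun_prop) _ _
      _ = _ := hintegral

/-- The Picard series converges locally uniformly in the parameter, so the sum is jointly
continuous. The parameter space carries a topology only; differentiability in the parameter is a
separate matter. -/
theorem exists_linear_ode_of_continuous [CompleteSpace E] {X : Type*} [TopologicalSpace X]
    {A : ℝ → X → E →L[ℝ] E} {b : ℝ → X → E} {y₀ : X → E} {a : ℝ}
    (hA : Continuous fun p : ℝ × X => A p.1 p.2) (hb : Continuous fun p : ℝ × X => b p.1 p.2)
    (hy₀ : Continuous y₀) :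
    ∃ y : ℝ → X → E, ContinuousOn (fun p : ℝ × X => y p.1 p.2) (Icc 0 a ×ˢ univ) ∧
      (∀ x, y 0 x = y₀ x) ∧ ∀ x, ∀ t ∈ Icc 0 a,
        HasDerivWithinAt (fun s => y s x) (A t x (y t x) + b t x) (Icc 0 a) t := by
  classical
  rcases lt_or_ge a 0 with ha | ha
  · exact ⟨fun _ x => y₀ x, by simp [Icc_eq_empty (not_le.2 ha)], fun x => rfl,
      fun x t ht => absurd (ht.1.trans ht.2) (not_le.2 ha)⟩
  -- Volterra form: the equation becomes `y = e + ∫ A y`, with initial value and source both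
  -- absorbed in `e`.
  set e : ℝ → X → E := fun t x => y₀ x + ∫ s in (0 : ℝ)..t, b s x with he_def
  have he : Continuous fun p : ℝ × X => e p.1 p.2 := by
    have h : Continuous fun q : (ℝ × X) × ℝ => b q.2 q.1.2 :=
      hb.comp (by fun_prop : Continuous fun q : (ℝ × X) × ℝ => (q.2, q.1.2))
    exact (hy₀.comp continuous_snd).add
      (intervalIntegral.continuous_parametric_intervalIntegral_of_continuous
        (f := fun (p : ℝ × X) s => b s p.2) h continuous_fst)
  have hcont := continuous_picardTerm hA he
  -- One unit above the bounds at `x₀` leaves room for strict inequalities, which persist nearby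
  -- uniformly in `t` by compactness of the interval.
  have hbound : ∀ x₀ : X, ∃ K C : ℝ, 0 ≤ K ∧ 0 ≤ C ∧ ∀ᶠ x in 𝓝 x₀, ∀ t ∈ Icc (0 : ℝ) a,
      ‖A t x‖ ≤ K ∧ ‖e t x‖ ≤ C := by
    intro x₀
    have hA' : Continuous fun t : ℝ => ‖A t x₀‖ := (hA.comp (by fun_prop :
      Continuous fun t : ℝ => (t, x₀))).norm
    have he' : Continuous fun t : ℝ => ‖e t x₀‖ := (he.comp (by fun_prop :
      Continuous fun t : ℝ => (t, x₀))).norm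
    obtain ⟨K, hK⟩ := isCompact_Icc.bddAbove_image (f := fun t : ℝ => ‖A t x₀‖)
      (hA'.continuousOn (s := Icc 0 a))
    obtain ⟨C, hC⟩ := isCompact_Icc.bddAbove_image (f := fun t : ℝ => ‖e t x₀‖)
      (he'.continuousOn (s := Icc 0 a))
    have hK' : ∀ t ∈ Icc 0 a, ‖A t x₀‖ ≤ K := fun t ht => hK (mem_image_of_mem _ ht)
    have hC' : ∀ t ∈ Icc 0 a, ‖e t x₀‖ ≤ C := fun t ht => hC (mem_image_of_mem _ ht)
    have h0 : (0 : ℝ) ∈ Icc 0 a := ⟨le_rfl, ha⟩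
    refine ⟨K + 1, C + 1, by linarith [norm_nonneg (A 0 x₀), hK' 0 h0],
      by linarith [norm_nonneg (e 0 x₀), hC' 0 h0], ?_⟩
    refine isCompact_Icc.eventually_forall_of_forall_eventually fun t ht => ?_
    have hsw : Continuous fun z : X × ℝ => (z.2, z.1) := by fun_prop
    have c1 : ∀ᶠ z : X × ℝ in 𝓝 (x₀, t), ‖A z.2 z.1‖ < K + 1 :=
      ((hA.comp hsw).norm.continuousAt).eventually_lt continuousAt_const
        (by simpa using lt_of_le_of_lt (hK' t ht) (lt_add_one K))
    have c2 : ∀ᶠ z : X × ℝ in 𝓝 (x₀, t), ‖e z.2 z.1‖ < C + 1 :=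
      ((he.comp hsw).norm.continuousAt).eventually_lt continuousAt_const
        (by simpa using lt_of_le_of_lt (hC' t ht) (lt_add_one C))
    filter_upwards [c1, c2] with z h1 h2 using ⟨h1.le, h2.le⟩
  have hmaj : ∀ K C : ℝ, 0 ≤ K → 0 ≤ C → ∀ x, (∀ t ∈ Icc (0 : ℝ) a, ‖A t x‖ ≤ K ∧ ‖e t x‖ ≤ C) →
      ∀ n, ∀ t ∈ Icc 0 a, ‖picardTerm A e n t x‖ ≤ C * ((K * a) ^ n / n.factorial) := by
    intro K C hK hC x hx n t ht
    refine (norm_picardTerm_le hK (fun t ht => (hx t ht).1) (fun t ht => (hx t ht).2) n t ht).trans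
      ?_
    have := ht.1
    have := ht.2
    gcongr
  have hsum : ∀ K C : ℝ, Summable fun n : ℕ => C * ((K * a) ^ n / n.factorial) := fun K C =>
    (Real.summable_pow_div_factorial _).mul_left C
  set y : ℝ → X → E := fun t x => ∑' n, picardTerm A e n t x with hy_def
  have hycont : ContinuousOn (fun p : ℝ × X => y p.1 p.2) (Icc 0 a ×ˢ univ) := by
    rintro ⟨t, x₀⟩ ⟨ht, -⟩
    obtain ⟨K, C, hK, hC, hx⟩ := hbound x₀
    obtain ⟨N, hN, hNo, hxN⟩ := eventually_nhds_iff.1 hx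
    have : ContinuousOn (fun p : ℝ × X => y p.1 p.2) (Icc 0 a ×ˢ N) :=
      continuousOn_tsum (fun n => (hcont n).continuousOn) (hsum K C)
        (fun n p hp => hmaj K C hK hC p.2 (hN p.2 hp.2) n p.1 hp.1)
    refine (this (t, x₀) ⟨ht, hxN⟩).mono_of_mem_nhdsWithin ?_
    have : (univ : Set ℝ) ×ˢ N ∈ 𝓝 (t, x₀) := (isOpen_univ.prod hNo).mem_nhds ⟨mem_univ _, hxN⟩
    filter_upwards [self_mem_nhdsWithin, mem_nhdsWithin_of_mem_nhds this] with p hp hp'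
    exact ⟨hp.1, hp'.2⟩
  have hyx : ∀ x, ContinuousOn (fun t => y t x) (Icc 0 a) := fun x =>
    hycont.comp (by fun_prop : ContinuousOn (fun t : ℝ => (t, x)) (Icc 0 a))
      (fun t ht => ⟨ht, mem_univ _⟩)
  have hAx : ∀ x, Continuous fun t => A t x := fun x =>
    hA.comp (by fun_prop : Continuous fun t : ℝ => (t, x))
  have hbx : ∀ x, Continuous fun t => b t x := fun x =>
    hb.comp (by fun_prop : Continuous fun t : ℝ => (t, x))
  have hintegral : ∀ x, ∀ t ∈ Icc 0 a, y t x = y₀ x + ∫ s in (0 : ℝ)..t, (A s x (y s x) + b s x) := by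
    intro x t ht
    obtain ⟨K, C, hK, hC, hx⟩ := hbound x
    have hm := hmaj K C hK hC x hx.self_of_nhds
    have hsm : ∀ s ∈ Icc 0 a, Summable fun n => picardTerm A e n s x := fun s hs =>
      Summable.of_norm_bounded (hsum K C) (fun n => hm n s hs)
    have hsub : ∀ s ∈ uIoc 0 t, s ∈ Icc 0 a := fun s hs => by
      rw [uIoc_of_le ht.1] at hs; exact ⟨hs.1.le, hs.2.trans ht.2⟩
    -- Applying the integral operator to the series shifts the index by one; only the zeroth term
    -- `e` is missing.
    have key : HasSum (fun n => picardTerm A e (n + 1) t x) (∫ s in (0 : ℝ)..t, A s x (y s x)) := by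
      refine intervalIntegral.hasSum_integral_of_dominated_convergence
        (fun n _ => K * (C * ((K * a) ^ n / n.factorial))) ?_ ?_ ?_ ?_ ?_
      · intro n
        exact ((hAx x).clm_apply ((hcont n).comp (by fun_prop :
          Continuous fun t : ℝ => (t, x)))).aestronglyMeasurable
      · intro n
        refine MeasureTheory.ae_of_all _ fun s hs => ?_
        exact ((A s x).le_opNorm _).trans (mul_le_mul (hx.self_of_nhds s (hsub s hs)).1
          (hm n s (hsub s hs)) (norm_nonneg _) hK)
      · exact MeasureTheory.ae_of_all _ fun s hs => (hsum K C).mul_left K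
      · exact intervalIntegrable_const
      · exact MeasureTheory.ae_of_all _ fun s hs =>
          ((hsm s (hsub s hs)).hasSum).mapL (A s x)
    have h1 : y t x = e t x + ∫ s in (0 : ℝ)..t, A s x (y s x) := by
      rw [← key.tsum_eq, hy_def]
      exact (hsm t ht).tsum_eq_zero_add
    rw [h1, he_def, intervalIntegral.integral_add]
    · simp only []; abel
    · refine ContinuousOn.intervalIntegrable ?_
      rw [uIcc_of_le ht.1]
      exact ((hAx x).continuousOn.clm_apply (hyx x)).mono (Icc_subset_Icc le_rfl ht.2)
    · exact (hbx x).intervalIntegrable _ _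
  refine ⟨y, hycont, fun x => by simpa using hintegral x 0 ⟨le_rfl, ha⟩, fun x t ht => ?_⟩
  set g : ℝ → E := fun s => A s x (y s x) + b s x with hg
  have hgc : ContinuousOn g (Icc 0 a) :=
    ((hAx x).continuousOn.clm_apply (hyx x)).add (hbx x).continuousOn
  have hd := ODE.hasDerivWithinAt_picard_Icc (f := fun s _ => g s) (u := univ)
    (α := fun _ => (0 : E)) (x₀ := y₀ x) (t₀ := 0) (tmin := 0) (tmax := a) ⟨le_rfl, ha⟩
    (by exact hgc.comp continuousOn_fst fun p hp => hp.1)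
    continuousOn_const (fun _ _ => mem_univ _) ht
  refine hd.congr (fun s hs => ?_) ?_
  · rw [hintegral x s hs]; rfl
  · rw [hintegral x t ht]; rfl

end LinearODE
end StewartGauge

namespace StewartGauge

/-! ### Uniqueness and smooth dependence on parameters for linear equations -/

section SmoothLinearODE

open Set Filter Topology

variable {E : Type*} [NormedAddCommGroup E] [NormedSpace ℝ E]
  {V : Type*} [NormedAddCommGroup V] [NormedSpace ℝ V]

theorem exists_norm_le_of_continuousOn_Icc {F : Type*} [NormedAddCommGroup F] {A : ℝ → F} {a : ℝ}
    (hA : ContinuousOn A (Icc 0 a)) : ∃ K : ℝ, ∀ t ∈ Icc 0 a, ‖A t‖ ≤ K :=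
  (isCompact_Icc.bddAbove_image hA.norm).imp fun _ hK _ ht => hK (mem_image_of_mem _ ht)

/-- Gronwall's inequality. It serves with `g = 0` for uniqueness, and with `g` a linearisation error
for differentiability in the parameter. -/
theorem norm_le_gronwallBound_of_linear {A : ℝ → E →L[ℝ] E} {y g : ℝ → E} {a K ε : ℝ}
    (hK : ∀ t ∈ Icc 0 a, ‖A t‖ ≤ K) (hg : ∀ t ∈ Icc 0 a, ‖g t‖ ≤ ε)
    (hy : ∀ t ∈ Icc 0 a, HasDerivWithinAt y (A t (y t) + g t) (Icc 0 a) t)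
    {δ : ℝ} (h0 : ‖y 0‖ ≤ δ) : ∀ t ∈ Icc 0 a, ‖y t‖ ≤ gronwallBound δ K ε t := by
  intro t ht
  have := norm_le_gronwallBound_of_norm_deriv_right_le (f := y) (f' := fun t => A t (y t) + g t)
    (a := 0) (b := a) (K := K) (ε := ε) (δ := δ)
    (fun s hs => (hy s hs).continuousWithinAt)
    (fun s hs => (hy s ⟨hs.1, hs.2.le⟩).mono_of_mem_nhdsWithin (Icc_mem_nhdsGE_of_mem hs))
    h0 (fun s hs => ?_) t ht
  · simpa using this
  · have hs' : s ∈ Icc 0 a := ⟨hs.1, hs.2.le⟩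
    exact (norm_add_le _ _).trans (add_le_add (((A s).le_opNorm _).trans
      (mul_le_mul_of_nonneg_right (hK s hs') (norm_nonneg _))) (hg s hs'))

/-- Uniqueness for homogeneous linear equations. -/
theorem eq_zero_of_linear_ode {A : ℝ → E →L[ℝ] E} {y : ℝ → E} {a : ℝ}
    (hA : ContinuousOn A (Icc 0 a))
    (hy : ∀ t ∈ Icc 0 a, HasDerivWithinAt y (A t (y t)) (Icc 0 a) t)
    (h0 : y 0 = 0) : ∀ t ∈ Icc 0 a, y t = 0 := by
  obtain ⟨K, hK⟩ := exists_norm_le_of_continuousOn_Icc hA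
  intro t ht
  have := norm_le_gronwallBound_of_linear (g := fun _ => 0) (ε := 0) (δ := 0) hK (by simp)
    (by simpa using hy) (by simp [h0]) t ht
  rw [gronwallBound_ε0_δ0] at this
  exact norm_le_zero_iff.1 this

/-- The pointwise meaning of being a solution on `[0, a] × U` of the linear equation
`∂ₜ y = A y + b` with initial values `y₀`. -/
structure IsLinearSolution (a : ℝ) (U : Set V) (A : ℝ × V → E →L[ℝ] E) (b : ℝ × V → E)
    (y₀ : V → E) (y : ℝ × V → E) : Prop where
  initial : ∀ x ∈ U, y (0, x) = y₀ x
  deriv : ∀ x ∈ U, ∀ t ∈ Icc 0 a,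
    HasDerivWithinAt (fun s => y (s, x)) (A (t, x) (y (t, x)) + b (t, x)) (Icc 0 a) t

variable {a : ℝ} {U : Set V} {A : ℝ × V → E →L[ℝ] E} {b : ℝ × V → E} {y₀ : V → E}
  {y y' : ℝ × V → E}

theorem continuousOn_slice {F : Type*} [TopologicalSpace F] {f : ℝ × V → F}
    (hf : ContinuousOn f (Icc 0 a ×ˢ U)) {x : V} (hx : x ∈ U) :
    ContinuousOn (fun t => f (t, x)) (Icc 0 a) :=
  hf.comp (by fun_prop : ContinuousOn (fun t : ℝ => (t, x)) (Icc 0 a)) fun _ ht => ⟨ht, hx⟩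

theorem IsLinearSolution.eqOn (h : IsLinearSolution a U A b y₀ y)
    (h' : IsLinearSolution a U A b y₀ y') (hA : ContinuousOn A (Icc 0 a ×ˢ U)) :
    EqOn y y' (Icc 0 a ×ˢ U) := by
  rintro ⟨t, x⟩ ⟨ht, hx⟩
  refine sub_eq_zero.1 (eq_zero_of_linear_ode (A := fun t => A (t, x))
    (y := fun t => y (t, x) - y' (t, x)) (continuousOn_slice hA hx) (fun t ht => ?_) ?_ t ht)
  · refine ((h.deriv x hx t ht).sub (h'.deriv x hx t ht)).congr_deriv ?_
    rw [map_sub]; abel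
  · simp [h.initial x hx, h'.initial x hx]

/-- The set `U` itself is taken as parameter space, and the coefficients are continued beyond `[0,
a]` by their values at the end points. -/
theorem exists_isLinearSolution [CompleteSpace E] (hA : ContinuousOn A (Icc 0 a ×ˢ U))
    (hb : ContinuousOn b (Icc 0 a ×ˢ U)) (hy₀ : ContinuousOn y₀ U) :
    ∃ y, IsLinearSolution a U A b y₀ y ∧ ContinuousOn y (Icc 0 a ×ˢ U) := by
  classical
  rcases lt_or_ge a 0 with ha | ha
  · exact ⟨fun p => y₀ p.2, ⟨fun x _ => rfl, fun x _ t ht => absurd (ht.1.trans ht.2) (not_le.2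
      ha)⟩,
      by simp [Icc_eq_empty (not_le.2 ha)]⟩
  have hc : Continuous fun p : ℝ × U => ((projIcc 0 a ha p.1 : ℝ), (p.2 : V)) := by fun_prop
  have hm : ∀ p : ℝ × U, ((projIcc 0 a ha p.1 : ℝ), (p.2 : V)) ∈ Icc 0 a ×ˢ U :=
    fun p => ⟨(projIcc 0 a ha p.1).2, p.2.2⟩
  obtain ⟨w, hw, hw0, hwd⟩ := exists_linear_ode_of_continuous (X := U) (a := a)
    (A := fun t x => A (projIcc 0 a ha t, x)) (b := fun t x => b (projIcc 0 a ha t, x))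
    (y₀ := fun x => y₀ x) (hA.comp_continuous hc hm) (hb.comp_continuous hc hm)
    (hy₀.comp_continuous continuous_subtype_val fun x => x.2)
  refine ⟨fun p => if h : p.2 ∈ U then w p.1 ⟨p.2, h⟩ else 0, ⟨fun x hx => ?_,
    fun x hx t ht => ?_⟩, ?_⟩
  · simp [hx, hw0]
  · have := hwd ⟨x, hx⟩ t ht
    simpa [hx, projIcc_of_mem ha ht] using this
  · rw [continuousOn_iff_continuous_domRestrict] at hw ⊢
    have : Continuous fun p : (Icc 0 a ×ˢ U : Set (ℝ × V)) =>
        (⟨(p.1.1, ⟨p.1.2, p.2.2⟩), ⟨p.2.1, mem_univ _⟩⟩ : (Icc 0 a ×ˢ univ : Set (ℝ × U))) := by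
      fun_prop
    refine (hw.comp this).congr fun p => ?_
    have hp : p.1.2 ∈ U := p.2.2
    simp [hp]

/-- By uniqueness the given solution is the continuous one constructed above. -/
theorem IsLinearSolution.continuousOn [CompleteSpace E] (h : IsLinearSolution a U A b y₀ y)
    (hA : ContinuousOn A (Icc 0 a ×ˢ U))
    (hb : ContinuousOn b (Icc 0 a ×ˢ U)) (hy₀ : ContinuousOn y₀ U) :
    ContinuousOn y (Icc 0 a ×ˢ U) := by
  obtain ⟨y', h', hc⟩ := exists_isLinearSolution hA hb hy₀
  exact hc.congr (h.eqOn h' hA)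

/-- A function with a partial derivative in the parameter which is continuous in all variables is
differentiable in the parameter uniformly in `t ∈ [0, a]`. -/
theorem eventually_norm_sub_sub_le {F : Type*} [NormedAddCommGroup F] [NormedSpace ℝ F]
    {f : ℝ × V → F} {f' : ℝ × V → V →L[ℝ] F} (hU : IsOpen U)
    (hf : ∀ t ∈ Icc 0 a, ∀ x ∈ U, HasFDerivAt (fun x => f (t, x)) (f' (t, x)) x)
    (hf' : ContinuousOn f' (Icc 0 a ×ˢ U)) {x₀ : V} (hx₀ : x₀ ∈ U) {ε : ℝ} (hε : 0 < ε) :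
    ∀ᶠ x in 𝓝 x₀, ∀ t ∈ Icc 0 a,
      ‖f (t, x) - f (t, x₀) - f' (t, x₀) (x - x₀)‖ ≤ ε * ‖x - x₀‖ := by
  -- The condition on `t` is repeated inside because the compactness argument tests a full
  -- neighbourhood of `(x₀, t)`, in which the time may leave `[0, a]`.
  have key : ∀ᶠ x in 𝓝 x₀, ∀ t ∈ Icc (0 : ℝ) a, x ∈ U ∧
      (t ∈ Icc 0 a → ‖f' (t, x) - f' (t, x₀)‖ ≤ ε) := by
    refine isCompact_Icc.eventually_forall_of_forall_eventually fun t ht => ?_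
    have h1 := hf' (t, x₀) ⟨ht, hx₀⟩
    have h2 := continuousOn_slice hf' hx₀ t ht
    rw [Metric.continuousWithinAt_iff'] at h1 h2
    have h1' := eventually_nhdsWithin_iff.1 (h1 (ε / 2) (half_pos hε))
    have h2' := eventually_nhdsWithin_iff.1 (h2 (ε / 2) (half_pos hε))
    have hsw : Tendsto (fun z : V × ℝ => (z.2, z.1)) (𝓝 (x₀, t)) (𝓝 (t, x₀)) :=
      (continuous_snd.prodMk continuous_fst).tendsto' _ _ rfl
    have hUe : ∀ᶠ z : V × ℝ in 𝓝 (x₀, t), z.1 ∈ U :=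
      (continuous_fst.tendsto' (x₀, t) x₀ rfl).eventually (hU.mem_nhds hx₀)
    have h2e := (continuous_snd.tendsto' (x₀, t) t rfl).eventually h2'
    filter_upwards [hsw.eventually h1', h2e, hUe] with z hz1 hz2 hz3
    refine ⟨hz3, fun hz => ?_⟩
    have e1 := hz1 ⟨hz, hz3⟩
    have e2 := hz2 hz
    rw [← dist_eq_norm]
    calc _ ≤ _ := dist_triangle_right _ _ (f' (t, x₀))
      _ ≤ ε / 2 + ε / 2 := add_le_add e1.le e2.le
      _ = ε := add_halves ε
  obtain ⟨r, hr, hball⟩ := Metric.eventually_nhds_iff_ball.1 key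
  filter_upwards [Metric.ball_mem_nhds x₀ hr] with x hx t ht
  refine (convex_ball x₀ r).norm_image_sub_le_of_norm_hasFDerivWithin_le' (f := fun x => f (t, x))
    (f' := fun x => f' (t, x))
    (fun z hz => (hf t ht z (hball z hz t ht).1).hasFDerivWithinAt)
    (fun z hz => (hball z hz t ht).2 ht) (Metric.mem_ball_self hr) hx

/-- Differentiability of the solution of a linear equation in the parameter. -/
theorem IsLinearSolution.hasFDerivAt [CompleteSpace E] (h : IsLinearSolution a U A b y₀ y)
    (hU : IsOpen U) {A' : ℝ × V → V →L[ℝ] E →L[ℝ] E} {b' : ℝ × V → V →L[ℝ] E}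
    {y₀' : V → V →L[ℝ] E} {w : ℝ × V → V →L[ℝ] E}
    (hA : ContinuousOn A (Icc 0 a ×ˢ U)) (hyc : ContinuousOn y (Icc 0 a ×ˢ U))
    (hA' : ∀ t ∈ Icc 0 a, ∀ x ∈ U, HasFDerivAt (fun x => A (t, x)) (A' (t, x)) x)
    (hA'c : ContinuousOn A' (Icc 0 a ×ˢ U))
    (hb' : ∀ t ∈ Icc 0 a, ∀ x ∈ U, HasFDerivAt (fun x => b (t, x)) (b' (t, x)) x)
    (hb'c : ContinuousOn b' (Icc 0 a ×ˢ U))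
    (hy₀' : ∀ x ∈ U, HasFDerivAt y₀ (y₀' x) x)
    (hw : IsLinearSolution a U (fun p => ContinuousLinearMap.compL ℝ V E E (A p))
      (fun p => (A' p).flip (y p) + b' p) y₀' w)
    (hwc : ContinuousOn w (Icc 0 a ×ˢ U)) :
    ∀ t ∈ Icc 0 a, ∀ x ∈ U, HasFDerivAt (fun x => y (t, x)) (w (t, x)) x := by
  intro t ht x₀ hx₀
  have ha : 0 ≤ a := ht.1.trans ht.2
  obtain ⟨K, hK⟩ := exists_norm_le_of_continuousOn_Icc (continuousOn_slice hA hx₀)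
  obtain ⟨K', hK'⟩ := exists_norm_le_of_continuousOn_Icc
    (A := fun t => A' (t, x₀)) (continuousOn_slice hA'c hx₀)
  obtain ⟨M, hM⟩ := exists_norm_le_of_continuousOn_Icc (continuousOn_slice hyc hx₀)
  obtain ⟨L, hL⟩ := exists_norm_le_of_continuousOn_Icc
    (A := fun t => w (t, x₀)) (continuousOn_slice hwc hx₀)
  have h0m : (0 : ℝ) ∈ Icc 0 a := ⟨le_rfl, ha⟩
  have hK0 : 0 ≤ K := (norm_nonneg _).trans (hK 0 h0m)
  have hK'0 : 0 ≤ K' := (norm_nonneg (A' (0, x₀))).trans (hK' 0 h0m)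
  have hM0 : 0 ≤ M := (norm_nonneg _).trans (hM 0 h0m)
  have hL0 : 0 ≤ L := (norm_nonneg (w (0, x₀))).trans (hL 0 h0m)
  rw [hasFDerivAt_iff_isLittleO, Asymptotics.isLittleO_iff]
  intro c hc
  -- the Gronwall factor
  set B : ℝ := gronwallBound 1 (K + K' + 1) (M + L + 1) t with hB
  have hBpos : 0 < B := lt_of_lt_of_le one_pos (by
    have := gronwallBound_mono (δ := 1) (K := K + K' + 1) (ε := M + L + 1) (by norm_num)
      (by positivity) (by positivity) ht.1
    simpa [gronwallBound_x0] using this)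
  -- With initial error at most `η‖x - x₀‖` and source at most `(M + L + 1) η‖x - x₀‖`, Gronwall
  -- returns `B η‖x - x₀‖ = c‖x - x₀‖`.
  set η : ℝ := c / B with hη
  have hη0 : 0 < η := div_pos hc hBpos
  have eA := eventually_norm_sub_sub_le hU hA' hA'c hx₀ (lt_min hη0 one_pos)
  have eb := eventually_norm_sub_sub_le hU hb' hb'c hx₀ hη0
  have ey := Asymptotics.isLittleO_iff.1 (hasFDerivAt_iff_isLittleO.1 (hy₀' x₀ hx₀)) hη0
  have e1 : ∀ᶠ x in 𝓝 x₀, ‖x - x₀‖ < min 1 (η / (K' + 1)) := by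
    have : Tendsto (fun x : V => ‖x - x₀‖) (𝓝 x₀) (𝓝 0) := by
      have h : Continuous fun x : V => ‖x - x₀‖ := by fun_prop
      exact h.tendsto' _ _ (by simp)
    exact this.eventually_lt_const (by positivity)
  filter_upwards [eA, eb, ey, e1, hU.mem_nhds hx₀] with x hxA hxb hxy hx1 hxU
  have hx1' : ‖x - x₀‖ ≤ 1 := (hx1.trans_le (min_le_left _ _)).le
  have hx2 : (K' + 1) * ‖x - x₀‖ ≤ η := by
    have := (hx1.trans_le (min_le_right _ _)).le
    rwa [le_div_iff₀' (by positivity)] at this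
  set N : ℝ := ‖x - x₀‖ with hN
  have hN0 : 0 ≤ N := norm_nonneg _
  -- bounds along the trajectory
  have hAx : ∀ s ∈ Icc 0 a, ‖A (s, x)‖ ≤ K + K' + 1 ∧ ‖A (s, x) - A (s, x₀)‖ ≤ (K' + 1) * N := by
    intro s hs
    have h1 := hxA s hs
    have h2 : ‖A' (s, x₀) (x - x₀)‖ ≤ K' * N :=
      ((A' (s, x₀)).le_opNorm _).trans (mul_le_mul_of_nonneg_right (hK' s hs) hN0)
    have h3 : ‖A (s, x) - A (s, x₀)‖ ≤ (K' + 1) * N := by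
      have h4 := norm_le_norm_add_norm_sub' (A (s, x) - A (s, x₀)) (A' (s, x₀) (x - x₀))
      have h5 : min η 1 * N ≤ 1 * N := mul_le_mul_of_nonneg_right (min_le_right _ _) hN0
      linarith
    refine ⟨?_, h3⟩
    have h4 := norm_le_norm_add_norm_sub' (A (s, x)) (A (s, x₀))
    have h5 : (K' + 1) * N ≤ (K' + 1) * 1 := mul_le_mul_of_nonneg_left hx1' (by positivity)
    linarith [hK s hs]
  -- The remainder solves the equation with coefficient `A (s, x)`. Its source consists of the
  -- Taylor remainders of `A` and `b` and of the product of the increment of `A` with the linear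
  -- increment of `y`.
  have hgr := norm_le_gronwallBound_of_linear (A := fun s => A (s, x))
    (y := fun s => y (s, x) - y (s, x₀) - w (s, x₀) (x - x₀))
    (g := fun s => (A (s, x) - A (s, x₀) - A' (s, x₀) (x - x₀)) (y (s, x₀))
      + (A (s, x) - A (s, x₀)) (w (s, x₀) (x - x₀))
      + (b (s, x) - b (s, x₀) - b' (s, x₀) (x - x₀)))
    (K := K + K' + 1) (ε := (M + L + 1) * (η * N)) (δ := 1 * (η * N)) (a := a)
    (fun s hs => (hAx s hs).1) (fun s hs => ?_) (fun s hs => ?_) ?_ t ht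
  · refine hgr.trans (le_of_eq ?_)
    -- The Gronwall bound is homogeneous of degree one in initial value and source jointly.
    have hscale : ∀ θ : ℝ, gronwallBound (1 * θ) (K + K' + 1) ((M + L + 1) * θ) t
        = B * θ := by
      intro θ
      have hne : K + K' + 1 ≠ 0 := by positivity
      rw [hB, gronwallBound_of_K_ne_0 hne, gronwallBound_of_K_ne_0 hne]
      ring
    rw [hscale, hη]
    field_simp
  · have t1 : ‖(A (s, x) - A (s, x₀) - A' (s, x₀) (x - x₀)) (y (s, x₀))‖ ≤ (η * N) * M :=
      (ContinuousLinearMap.le_opNorm _ _).trans (mul_le_mul ((hxA s hs).trans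
        (mul_le_mul_of_nonneg_right (min_le_left _ _) hN0)) (hM s hs) (norm_nonneg _)
          (by positivity))
    have t2 : ‖(A (s, x) - A (s, x₀)) (w (s, x₀) (x - x₀))‖ ≤ η * (L * N) :=
      (ContinuousLinearMap.le_opNorm _ _).trans (mul_le_mul ((hAx s hs).2.trans hx2)
        (((w (s, x₀)).le_opNorm _).trans (mul_le_mul_of_nonneg_right (hL s hs) hN0))
          (norm_nonneg _) hη0.le)
    refine (norm_add₃_le).trans ?_
    have t3 := hxb s hs
    calc _ ≤ (η * N) * M + η * (L * N) + η * N := add_le_add (add_le_add t1 t2) t3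
      _ = _ := by ring
  · have hd1 := h.deriv x hxU s hs
    have hd2 := h.deriv x₀ hx₀ s hs
    have hd3 := (hw.deriv x₀ hx₀ s hs).clm_apply (hasDerivWithinAt_const s (Icc 0 a) (x - x₀))
    refine ((hd1.sub hd2).sub hd3).congr_deriv ?_
    simp
    abel
  · simp only [h.initial x hxU, h.initial x₀ hx₀, hw.initial x₀ hx₀, one_mul]
    exact hxy

/-- A solution of a differential equation which is differentiable in the parameter is
differentiable. -/
theorem hasFDerivWithinAt_of_partial {f : ℝ × V → E} {g : ℝ × V → E} {w : V →L[ℝ] E}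
    (hg : ContinuousOn g (Icc 0 a ×ˢ U))
    (hf : ∀ x ∈ U, ∀ t ∈ Icc 0 a, HasDerivWithinAt (fun s => f (s, x)) (g (t, x)) (Icc 0 a) t)
    {t₀ : ℝ} (ht₀ : t₀ ∈ Icc 0 a) {x₀ : V} (hx₀ : x₀ ∈ U)
    (hw : HasFDerivAt (fun x => f (t₀, x)) w x₀) :
    HasFDerivWithinAt f ((ContinuousLinearMap.toSpanSingleton ℝ (g (t₀, x₀))).coprod w)
      (Icc 0 a ×ˢ U) (t₀, x₀) := by
  rw [hasFDerivWithinAt_iff_isLittleO, Asymptotics.isLittleO_iff]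
  intro c hc
  have h1 := hg (t₀, x₀) ⟨ht₀, hx₀⟩
  rw [Metric.continuousWithinAt_iff] at h1
  obtain ⟨r, hr, hgr⟩ := h1 (c / 2) (half_pos hc)
  have h2 := Asymptotics.isLittleO_iff.1 (hasFDerivAt_iff_isLittleO.1 hw) (half_pos hc)
  have h2' : ∀ᶠ p : ℝ × V in 𝓝 (t₀, x₀),
      ‖f (t₀, p.2) - f (t₀, x₀) - w (p.2 - x₀)‖ ≤ c / 2 * ‖p.2 - x₀‖ :=
    (continuous_snd.tendsto' (t₀, x₀) x₀ rfl).eventually h2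
  filter_upwards [self_mem_nhdsWithin, mem_nhdsWithin_of_mem_nhds h2',
    mem_nhdsWithin_of_mem_nhds (Metric.ball_mem_nhds (t₀, x₀) hr)] with p hp hp2 hpr
  obtain ⟨t, x⟩ := p
  obtain ⟨ht, hx⟩ := hp
  simp only at ht hx hp2
  have hxr : dist x x₀ < r := lt_of_le_of_lt (le_max_right _ _) hpr
  have htr : dist t t₀ < r := lt_of_le_of_lt (le_max_left _ _) hpr
  -- Mean value inequality in time at fixed `x`: the time derivative `g` stays within `c / 2` of its
  -- value at the base point.
  have hseg : ‖f (t, x) - f (t₀, x) - (t - t₀) • g (t₀, x₀)‖ ≤ c / 2 * ‖t - t₀‖ := by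
    have := (convex_uIcc t₀ t).norm_image_sub_le_of_norm_hasFDerivWithin_le'
      (f := fun s => f (s, x)) (f' := fun s => ContinuousLinearMap.toSpanSingleton ℝ (g (s, x)))
      (φ := ContinuousLinearMap.toSpanSingleton ℝ (g (t₀, x₀))) (C := c / 2)
      (fun s hs => ((hf x hx s (uIcc_subset_Icc ht₀ ht hs)).mono
        (uIcc_subset_Icc ht₀ ht)).hasFDerivWithinAt)
      (fun s hs => ?_) left_mem_uIcc right_mem_uIcc
    · simpa using this
    · have hsub : ContinuousLinearMap.toSpanSingleton ℝ (g (s, x))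
          - ContinuousLinearMap.toSpanSingleton ℝ (g (t₀, x₀))
          = ContinuousLinearMap.toSpanSingleton ℝ (g (s, x) - g (t₀, x₀)) := by
        ext; simp
      rw [hsub, ContinuousLinearMap.norm_toSpanSingleton,
        ← dist_eq_norm]
      refine (hgr ⟨uIcc_subset_Icc ht₀ ht hs, hx⟩ ?_).le
      refine max_lt (lt_of_le_of_lt ?_ htr) hxr
      rw [Real.dist_eq, Real.dist_eq]
      exact abs_sub_left_of_mem_uIcc hs
  have e : f (t, x) - f (t₀, x₀) - ((ContinuousLinearMap.toSpanSingleton ℝ (g (t₀, x₀))).coprod w)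
      ((t, x) - (t₀, x₀)) = (f (t, x) - f (t₀, x) - (t - t₀) • g (t₀, x₀))
        + (f (t₀, x) - f (t₀, x₀) - w (x - x₀)) := by
    simp only [Prod.mk_sub_mk, ContinuousLinearMap.coprod_apply,
      ContinuousLinearMap.toSpanSingleton_apply]
    abel
  rw [e]
  have n1 : ‖t - t₀‖ ≤ ‖(t, x) - (t₀, x₀)‖ := norm_fst_le ((t, x) - (t₀, x₀))
  have n2 : ‖x - x₀‖ ≤ ‖(t, x) - (t₀, x₀)‖ := norm_snd_le ((t, x) - (t₀, x₀))
  calc _ ≤ _ := norm_add_le _ _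
    _ ≤ c / 2 * ‖(t, x) - (t₀, x₀)‖ + c / 2 * ‖(t, x) - (t₀, x₀)‖ :=
      add_le_add (hseg.trans (mul_le_mul_of_nonneg_left n1 (half_pos hc).le))
        (hp2.trans (mul_le_mul_of_nonneg_left n2 (half_pos hc).le))
    _ = _ := by ring

theorem uniqueDiffOn_Icc_prod (ha : 0 < a) (hU : IsOpen U) :
    UniqueDiffOn ℝ (Icc 0 a ×ˢ U) :=
  (uniqueDiffOn_Icc ha).prod hU.uniqueDiffOn

theorem hasFDerivAt_slice {F : Type*} [NormedAddCommGroup F] [NormedSpace ℝ F] {f : ℝ × V → F}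
    (hU : IsOpen U) (hf : DifferentiableOn ℝ f (Icc 0 a ×ˢ U)) {t : ℝ} (ht : t ∈ Icc 0 a) {x : V}
    (hx : x ∈ U) : HasFDerivAt (fun x => f (t, x))
      ((fderivWithin ℝ f (Icc 0 a ×ˢ U) (t, x)).comp (ContinuousLinearMap.inr ℝ ℝ V)) x := by
  have h1 := (hf (t, x) ⟨ht, hx⟩).hasFDerivWithinAt
  have h2 : HasFDerivWithinAt (fun x : V => (t, x)) (ContinuousLinearMap.inr ℝ ℝ V) U x :=
    (hasFDerivAt_prodMk_right t x).hasFDerivWithinAt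
  exact (h1.comp x h2 fun x hx => ⟨ht, hx⟩).hasFDerivAt (hU.mem_nhds hx)

theorem contDiffOn_flip_apply {X : Type*} [NormedAddCommGroup X] [NormedSpace ℝ X] {s : Set X}
    {n : WithTop ℕ∞} {f : X → V →L[ℝ] E →L[ℝ] E} {g : X → E} (hf : ContDiffOn ℝ n f s)
    (hg : ContDiffOn ℝ n g s) : ContDiffOn ℝ n (fun p => (f p).flip (g p)) s := by
  have h : ContDiffOn ℝ n (fun p => ContinuousLinearMap.apply ℝ E (g p)) s :=
    (ContinuousLinearMap.contDiff _).comp_contDiffOn hg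
  exact h.clm_comp hf

/-- The parameter derivative of a solution solves the variational equation, which is again linear,
with values in `V →L[ℝ] E`. The induction must therefore quantify over the target space, and both
spaces are kept in one universe. At each step the variational source contains `y` only to an order
already established, and the time derivative is read off from the equation. -/
theorem IsLinearSolution.contDiffOn_nat {V : Type} [NormedAddCommGroup V] [NormedSpace ℝ V]
    {a : ℝ} {U : Set V} (ha : 0 < a) (hU : IsOpen U) (n : ℕ) :
    ∀ {E : Type} [NormedAddCommGroup E] [NormedSpace ℝ E] [CompleteSpace E]
      {A : ℝ × V → E →L[ℝ] E} {b : ℝ × V → E} {y₀ : V → E} {y : ℝ × V → E},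
      IsLinearSolution a U A b y₀ y → ContDiffOn ℝ n A (Icc 0 a ×ˢ U) →
      ContDiffOn ℝ n b (Icc 0 a ×ˢ U) → ContDiffOn ℝ n y₀ U →
      ContDiffOn ℝ n y (Icc 0 a ×ˢ U) := by
  have hΩ : UniqueDiffOn ℝ (Icc 0 a ×ˢ U) := uniqueDiffOn_Icc_prod ha hU
  induction n with
  | zero =>
    intro E _ _ _ A b y₀ y h hA hb hy₀
    simp only [Nat.cast_zero, contDiffOn_zero] at *
    exact h.continuousOn hA hb hy₀
  | succ n ih =>
    intro E _ _ _ A b y₀ y h hA hb hy₀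
    have hle : (n : WithTop ℕ∞) ≤ ((n + 1 : ℕ) : WithTop ℕ∞) := by exact_mod_cast Nat.le_succ n
    have hyn := ih h (hA.of_le hle) (hb.of_le hle) (hy₀.of_le hle)
    set A' : ℝ × V → V →L[ℝ] E →L[ℝ] E := fun p =>
      (fderivWithin ℝ A (Icc 0 a ×ˢ U) p).comp (ContinuousLinearMap.inr ℝ ℝ V) with hA'
    set b' : ℝ × V → V →L[ℝ] E := fun p =>
      (fderivWithin ℝ b (Icc 0 a ×ˢ U) p).comp (ContinuousLinearMap.inr ℝ ℝ V) with hb'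
    have cA' : ContDiffOn ℝ n A' (Icc 0 a ×ˢ U) :=
      (hA.fderivWithin hΩ (by norm_cast)).clm_comp contDiffOn_const
    have cb' : ContDiffOn ℝ n b' (Icc 0 a ×ˢ U) :=
      (hb.fderivWithin hΩ (by norm_cast)).clm_comp contDiffOn_const
    have cy' : ContDiffOn ℝ n (fderiv ℝ y₀) U := hy₀.fderiv_of_isOpen hU (by norm_cast)
    have cAw : ContDiffOn ℝ n (fun p => ContinuousLinearMap.compL ℝ V E E (A p)) (Icc 0 a ×ˢ U) :=
      contDiffOn_const.clm_apply (hA.of_le hle)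
    have cbw : ContDiffOn ℝ n (fun p => (A' p).flip (y p) + b' p) (Icc 0 a ×ˢ U) :=
      (contDiffOn_flip_apply cA' hyn).add cb'
    obtain ⟨w, hw, hwc⟩ := exists_isLinearSolution cAw.continuousOn cbw.continuousOn
      cy'.continuousOn
    have hwn := ih hw cAw cbw cy'
    have hdiffA : DifferentiableOn ℝ A (Icc 0 a ×ˢ U) := hA.differentiableOn (by simp)
    have hdiffb : DifferentiableOn ℝ b (Icc 0 a ×ˢ U) := hb.differentiableOn (by simp)
    have hpar := h.hasFDerivAt hU hA.continuousOn hyn.continuousOn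
      (fun t ht x hx => hasFDerivAt_slice hU hdiffA ht hx) cA'.continuousOn
      (fun t ht x hx => hasFDerivAt_slice hU hdiffb ht hx) cb'.continuousOn
      (fun x hx => ((hy₀.differentiableOn (by simp)).differentiableAt (hU.mem_nhds hx)).hasFDerivAt)
      hw hwc
    have cg : ContDiffOn ℝ n (fun p => A p (y p) + b p) (Icc 0 a ×ˢ U) :=
      ((hA.of_le hle).clm_apply hyn).add (hb.of_le hle)
    push_cast
    rw [contDiffOn_succ_iff_hasFDerivWithinAt_of_uniqueDiffOn hΩ]
    refine ⟨fun h => by simp at h, fun p =>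
      (ContinuousLinearMap.toSpanSingleton ℝ (A p (y p) + b p)).comp (.fst ℝ ℝ V)
        + (w p).comp (.snd ℝ ℝ V), ?_, ?_⟩
    · exact (((ContinuousLinearMap.toSpanSingletonCLE (𝕜 := ℝ) (E := E)).contDiff.comp_contDiffOn
        cg).clm_comp contDiffOn_const).add (hwn.clm_comp contDiffOn_const)
    · rintro ⟨t, x⟩ ⟨ht, hx⟩
      exact hasFDerivWithinAt_of_partial cg.continuousOn h.deriv ht hx (hpar t ht x hx)

theorem IsLinearSolution.contDiffOn {V : Type} [NormedAddCommGroup V] [NormedSpace ℝ V]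
    {E : Type} [NormedAddCommGroup E] [NormedSpace ℝ E] [CompleteSpace E]
    {a : ℝ} {U : Set V} (ha : 0 < a) (hU : IsOpen U)
    {A : ℝ × V → E →L[ℝ] E} {b : ℝ × V → E} {y₀ : V → E} {y : ℝ × V → E}
    (h : IsLinearSolution a U A b y₀ y) (hA : ContDiffOn ℝ ∞ A (Icc 0 a ×ˢ U))
    (hb : ContDiffOn ℝ ∞ b (Icc 0 a ×ˢ U)) (hy₀ : ContDiffOn ℝ ∞ y₀ U) :
    ContDiffOn ℝ ∞ y (Icc 0 a ×ˢ U) :=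
  contDiffOn_infty.2 fun n => h.contDiffOn_nat ha hU n (contDiffOn_infty.1 hA n)
    (contDiffOn_infty.1 hb n) (contDiffOn_infty.1 hy₀ n)

end SmoothLinearODE
end StewartGauge

namespace StewartGauge

/-! ### The transport equations in a ring of functions on a null hypersurface -/

/-- The algebraic structure of the ring of smooth functions of `(v, x)` on a null hypersurface: the
derivations `∂_v` (`D`) and `∂_𝒜` (`par 𝒜`), the evaluation `ev` at `v = 0`, and the solvability and
unique solvability of linear transport equations. -/
class TransportRing (R : Type*) [CommRing R] [StarRing R] where
  D : R →+ R
  par : Fin 2 → R →+ R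
  ev : R →+* R
  half : R
  two_mul_half : 2 * half = 1
  D_mul : ∀ a b, D (a * b) = D a * b + a * D b
  par_mul : ∀ A a b, par A (a * b) = par A a * b + a * par A b
  D_star : ∀ a, D (star a) = star (D a)
  par_star : ∀ A a, par A (star a) = star (par A a)
  ev_star : ∀ a, ev (star a) = star (ev a)
  D_par : ∀ A a, D (par A a) = par A (D a)
  par_comm : ∀ A B a, par A (par B a) = par B (par A a)
  ev_par : ∀ A a, ev (par A a) = par A (ev a)
  ev_ev : ∀ a, ev (ev a) = ev a
  D_ev : ∀ a, D (ev a) = 0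
  exists_linear : ∀ (n : ℕ) (c d : Fin n → Fin n → R) (b y₀ : Fin n → R), ∃ y : Fin n → R,
    (∀ i, D (y i) = ∑ j, (c i j * y j + d i j * star (y j)) + b i) ∧ ∀ i, ev (y i) = ev (y₀ i)
  eq_zero_of_linear : ∀ (n : ℕ) (c d : Fin n → Fin n → R) (y : Fin n → R),
    (∀ i, D (y i) = ∑ j, (c i j * y j + d i j * star (y j))) → (∀ i, ev (y i) = 0) →
      ∀ i, y i = 0

namespace TransportRing

variable {R : Type*} [CommRing R] [StarRing R] [TransportRing R]

theorem D_one : D (1 : R) = 0 := by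
  have := D_mul (1 : R) 1
  simpa using this

theorem par_one (A : Fin 2) : par A (1 : R) = 0 := by
  have := par_mul A (1 : R) 1
  simpa using this

theorem D_ofNat (n : ℕ) [n.AtLeastTwo] : D (ofNat(n) : R) = 0 := by
  rw [← Nat.cast_ofNat (R := R) (n := n), ← nsmul_one, map_nsmul, D_one, smul_zero]

theorem par_ofNat (A : Fin 2) (n : ℕ) [n.AtLeastTwo] : par A (ofNat(n) : R) = 0 := by
  rw [← Nat.cast_ofNat (R := R) (n := n), ← nsmul_one, map_nsmul, par_one, smul_zero]

/-- The ring is not assumed to contain the rationals; `half` is the only division needed for the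
inhomogeneous terms of a spin. -/
theorem eq_zero_of_two_mul {a : R} (h : 2 * a = 0) : a = 0 := by
  linear_combination half * h - a * two_mul_half (R := R)

theorem D_half : D (half : R) = 0 := by
  refine eq_zero_of_two_mul ?_
  have := congrArg D (two_mul_half (R := R))
  rwa [D_mul, D_ofNat, D_one, zero_mul, zero_add] at this

theorem par_half (A : Fin 2) : par A (half : R) = 0 := by
  refine eq_zero_of_two_mul ?_
  have := congrArg (par A) (two_mul_half (R := R))
  rwa [par_mul, par_ofNat, par_one, zero_mul, zero_add] at this

theorem star_half : star (half : R) = half := by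
  have := congrArg star (two_mul_half (R := R))
  rw [star_mul', star_one, star_ofNat] at this
  have h := two_mul_half (R := R)
  linear_combination half * this - star half * h

/-- Solutions of a homogeneous scalar transport equation vanish if their initial values do. -/
theorem eq_zero_of_scalar {c d y : R} (h : D y = c * y + d * star y) (h0 : ev y = 0) : y = 0 :=
  eq_zero_of_linear 1 (fun _ _ => c) (fun _ _ => d) (fun _ => y) (by simpa using h)
    (by simpa using h0) 0

/-- The derivation along a vector field `p^𝒜 ∂_𝒜`. -/
def along (p : Fin 2 → R) : R →+ R where
  toFun g := p 0 * par 0 g + p 1 * par 1 g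
  map_zero' := by simp
  map_add' a b := by simp only [map_add]; ring

theorem along_apply (p : Fin 2 → R) (g : R) : along p g = p 0 * par 0 g + p 1 * par 1 g := rfl

theorem along_mul (p : Fin 2 → R) (a b : R) :
    along p (a * b) = along p a * b + a * along p b := by
  simp only [along_apply, par_mul]; ring

theorem along_one (p : Fin 2 → R) : along p (1 : R) = 0 := by simp [along_apply, par_one]

theorem along_half (p : Fin 2 → R) : along p (half : R) = 0 := by simp [along_apply, par_half]

theorem along_ofNat (p : Fin 2 → R) (n : ℕ) [n.AtLeastTwo] : along p (ofNat(n) : R) = 0 := by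
  simp [along_apply, par_ofNat]

theorem ev_along (p : Fin 2 → R) (g : R) : ev (along p g) = along (fun A => ev (p A)) (ev g) := by
  simp [along_apply, ev_par]

end TransportRing

open TransportRing

/-- The unknowns which are governed by transport equations along a null hypersurface. -/
@[ext]
structure Core (R : Type*) where
  P : Fin 2 → R
  rho : R
  sigma : R
  alpha : R
  beta : R
  mu : R
  lam : R
  eps : R
  Psi0 : R
  Psi1 : R
  Psi2 : R
  Psi3 : R
  Psi4 : R

namespace Core

variable {R : Type*} [CommRing R] [StarRing R] [TransportRing R]

/-- `δ = P^𝒜 ∂_𝒜`. -/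
def dl (f : Core R) : R →+ R := along f.P

/-- `δ̄ = P̄^𝒜 ∂_𝒜`. -/
def db (f : Core R) : R →+ R := along fun A => star (f.P A)

/-- `π = α + β̄`. -/
def pi (f : Core R) : R := f.alpha + star f.beta

theorem dl_mul (f : Core R) (a b : R) : f.dl (a * b) = f.dl a * b + a * f.dl b := along_mul _ a b

theorem dl_ofNat (f : Core R) (n : ℕ) [n.AtLeastTwo] : f.dl (ofNat(n)) = 0 := along_ofNat _ n

theorem db_ofNat (f : Core R) (n : ℕ) [n.AtLeastTwo] : f.db (ofNat(n)) = 0 := along_ofNat _ n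

theorem dl_half (f : Core R) : f.dl half = 0 := along_half _

theorem db_half (f : Core R) : f.db half = 0 := along_half _

theorem db_mul (f : Core R) (a b : R) : f.db (a * b) = f.db a * b + a * f.db b := along_mul _ a b

theorem dl_star (f : Core R) (a : R) : f.dl (star a) = star (f.db a) := by
  simp [dl, db, along_apply, par_star]

theorem db_star (f : Core R) (a : R) : f.db (star a) = star (f.dl a) := by
  simp [dl, db, along_apply, par_star]

/-- Apply a ring homomorphism to all the components. -/
def map {S : Type*} [CommRing S] (φ : R →+* S) (f : Core R) : Core S where
  P A := φ (f.P A)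
  rho := φ f.rho
  sigma := φ f.sigma
  alpha := φ f.alpha
  beta := φ f.beta
  mu := φ f.mu
  lam := φ f.lam
  eps := φ f.eps
  Psi0 := φ f.Psi0
  Psi1 := φ f.Psi1
  Psi2 := φ f.Psi2
  Psi3 := φ f.Psi3
  Psi4 := φ f.Psi4

/-- The transport equations for the frame and its null expansion and shear. -/
structure FrameTransport (f : Core R) : Prop where
  P : ∀ A, D (f.P A) = f.rho * f.P A + f.sigma * star (f.P A)
  rho : D f.rho = 2 * f.eps * f.rho + f.rho * f.rho + f.sigma * star f.sigma
  sigma : D f.sigma = f.Psi0 + 2 * f.eps * f.sigma + 2 * f.rho * f.sigma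

/-- The transport equations for `α`, `β` and `Ψ₁`. -/
structure SpinTransport (f : Core R) : Prop where
  alpha : D f.alpha = f.db f.eps + f.alpha * f.rho + f.pi * f.rho + f.beta * star f.sigma
  beta : D f.beta = f.dl f.eps + f.Psi1 + f.beta * f.rho + f.alpha * f.sigma + f.pi * f.sigma
  Psi1 : D f.Psi1 = f.db f.Psi0 - (4 * f.alpha - f.pi) * f.Psi0
    + 2 * (2 * f.rho + f.eps) * f.Psi1

/-- The transport equations for `μ`, `λ` and `Ψ₂`. -/
structure ShearTransport (f : Core R) : Prop where
  mu : D f.mu = f.dl f.pi + f.Psi2 - 2 * f.eps * f.mu - star f.alpha * f.pi + f.beta * f.pi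
    + f.pi * star f.pi + f.mu * f.rho + f.lam * f.sigma
  lam : D f.lam = f.db f.pi - 2 * f.eps * f.lam + f.alpha * f.pi - star f.beta * f.pi
    + f.pi * f.pi + f.lam * f.rho + f.mu * star f.sigma
  Psi2 : D f.Psi2 = f.db f.Psi1 - f.lam * f.Psi0 + 2 * (f.pi - f.alpha) * f.Psi1
    + 3 * f.rho * f.Psi2

/-- The transport equations for `Ψ₃` and `Ψ₄`. -/
structure WeylTransport (f : Core R) : Prop where
  Psi3 : D f.Psi3 = f.db f.Psi2 + 2 * (f.rho - f.eps) * f.Psi3 + 3 * f.pi * f.Psi2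
    - 2 * f.lam * f.Psi1
  Psi4 : D f.Psi4 = f.db f.Psi3 - (4 * f.eps - f.rho) * f.Psi4
    + 2 * (2 * f.pi + f.alpha) * f.Psi3 - 3 * f.lam * f.Psi2

/-- The transport equations along the null hypersurface. -/
structure Transport (f : Core R) : Prop extends
  FrameTransport f, SpinTransport f, ShearTransport f, WeylTransport f

/-- The reality conditions of the gauge. -/
structure IsReal (f : Core R) : Prop where
  rho : star f.rho = f.rho
  mu : star f.mu = f.mu
  eps : star f.eps = f.eps

/-- The constraints on the spheres `v = const`. -/
structure Sphere (f : Core R) : Prop where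
  frame : ∀ A, f.db (f.P A) - star (f.db (f.P A)) = (f.alpha - star f.beta) * f.P A
    - (star f.alpha - f.beta) * star (f.P A)
  ricci_one : f.db f.sigma - f.dl f.rho = f.Psi1 - star f.alpha * f.rho - f.beta * f.rho
    + 3 * f.alpha * f.sigma - star f.beta * f.sigma
  ricci_two : f.db f.beta - f.dl f.alpha = f.Psi2 - f.alpha * star f.alpha
    + 2 * f.alpha * f.beta - f.beta * star f.beta - f.mu * f.rho + f.lam * f.sigma
  ricci_three : f.db f.mu - f.dl f.lam = f.Psi3 - star f.alpha * f.lam + 3 * f.beta * f.lam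
    - f.alpha * f.mu - star f.beta * f.mu

variable {f : Core R}

/-- The commutator `[D, δ] = ρδ + σδ̄`: since `D` commutes with `∂_𝒜`, only the transport of the
frame contributes. -/
theorem D_dl (hP : ∀ A, D (f.P A) = f.rho * f.P A + f.sigma * star (f.P A)) (a : R) :
    D (f.dl a) = f.dl (D a) + f.rho * f.dl a + f.sigma * f.db a := by
  simp only [dl, db, along_apply, map_add, D_mul, hP, D_par]; ring

theorem D_db (hr : star f.rho = f.rho)
    (hP : ∀ A, D (f.P A) = f.rho * f.P A + f.sigma * star (f.P A)) (a : R) :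
    D (f.db a) = f.db (D a) + f.rho * f.db a + star f.sigma * f.dl a := by
  simp only [dl, db, along_apply, map_add, D_mul, D_star, hP, D_par, star_add, star_mul', star_star,
    hr]
  ring

/-- The frame constraint is the commutator `[δ̄, δ]` applied to the coordinates. It extends to all
functions because second derivatives commute. -/
theorem db_dl (hf : ∀ A, f.db (f.P A) - star (f.db (f.P A)) = (f.alpha - star f.beta) * f.P A
    - (star f.alpha - f.beta) * star (f.P A)) (a : R) :
    f.db (f.dl a) - f.dl (f.db a) = (f.alpha - star f.beta) * f.dl a
      - (star f.alpha - f.beta) * f.db a := by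
  have h0 := hf 0
  have h1 := hf 1
  simp only [dl, db, along_apply, map_add, par_mul, par_star, star_add, star_mul', star_star]
    at h0 h1 ⊢
  rw [par_comm 1 0 a]
  linear_combination (par 0 a) * h0 + (par 1 a) * h1

theorem star_db_of_real {a : R} (h : star a = a) : star (f.db a) = f.dl a := by
  rw [← dl_star, h]

theorem star_dl_of_real {a : R} (h : star a = a) : star (f.dl a) = f.db a := by
  rw [← db_star, h]

/-! #### Propagation of the constraints -/

/-- The defect `Z` satisfies `DZ = (3ρ + 2ε)Z - σZ̄`. This comes first because its evolution needs
no other constraint. -/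
theorem ricci_one_of_transport (hr : star f.rho = f.rho) (he : star f.eps = f.eps)
    (hf : f.FrameTransport) (hs : f.SpinTransport)
    (h0 : ev (f.db f.sigma - f.dl f.rho - (f.Psi1 - star f.alpha * f.rho - f.beta * f.rho
      + 3 * f.alpha * f.sigma - star f.beta * f.sigma)) = 0) :
    f.db f.sigma - f.dl f.rho = f.Psi1 - star f.alpha * f.rho - f.beta * f.rho
      + 3 * f.alpha * f.sigma - star f.beta * f.sigma := by
  rw [← sub_eq_zero]
  refine eq_zero_of_scalar (c := 3 * f.rho + 2 * f.eps) (d := -f.sigma) ?_ h0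
  simp only [map_add, map_sub, D_mul, D_ofNat, D_star, D_dl hf.P, D_db hr hf.P, hf.rho, hf.sigma,
    hs.alpha, hs.beta, hs.Psi1, dl_mul, db_mul, dl_star, db_star, star_add, star_sub, star_mul',
    star_star, hr, he, pi, star_ofNat, dl_ofNat, db_ofNat, star_db_of_real hr,
    star_dl_of_real hr, star_db_of_real he, star_dl_of_real he]
  ring

/-- The defect `Z` satisfies `DZ = 2ρZ` once the constraint for `Ψ₁` and its conjugate are known. -/
theorem frame_of_transport (hr : star f.rho = f.rho) (he : star f.eps = f.eps)
    (hf : f.FrameTransport) (hs : f.SpinTransport)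
    (h1 : f.db f.sigma - f.dl f.rho = f.Psi1 - star f.alpha * f.rho - f.beta * f.rho
      + 3 * f.alpha * f.sigma - star f.beta * f.sigma) {A : Fin 2}
    (h0 : ev (f.db (f.P A) - star (f.db (f.P A)) - ((f.alpha - star f.beta) * f.P A
      - (star f.alpha - f.beta) * star (f.P A))) = 0) :
    f.db (f.P A) - star (f.db (f.P A)) = (f.alpha - star f.beta) * f.P A
      - (star f.alpha - f.beta) * star (f.P A) := by
  rw [← sub_eq_zero]
  refine eq_zero_of_scalar (c := 2 * f.rho) (d := 0) ?_ h0
  have h1' := congrArg star h1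
  simp only [map_add, map_sub, D_mul, D_ofNat, D_star, D_dl hf.P, D_db hr hf.P, hf.rho, hf.sigma,
    hs.alpha, hs.beta, hs.Psi1, hf.P, dl_mul, db_mul, dl_star, db_star, star_add, star_sub,
    star_mul', star_star, hr, he, pi, star_ofNat, dl_ofNat, db_ofNat, star_db_of_real hr,
    star_dl_of_real hr, star_db_of_real he, star_dl_of_real he] at h1' ⊢
  linear_combination star (f.P A) * h1 - f.P A * h1'

/-- Second angular derivatives of `ε` enter only through `[δ̄, δ]ε`, which the frame constraint
evaluates. The rest reduces, by the constraint for `Ψ₁`, to `DZ = 2ρZ`. -/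
theorem ricci_two_of_transport (hr : star f.rho = f.rho) (he : star f.eps = f.eps)
    (hf : f.FrameTransport) (hs : f.SpinTransport) (hm : f.ShearTransport)
    (hfr : ∀ A, f.db (f.P A) - star (f.db (f.P A)) = (f.alpha - star f.beta) * f.P A
      - (star f.alpha - f.beta) * star (f.P A))
    (h1 : f.db f.sigma - f.dl f.rho = f.Psi1 - star f.alpha * f.rho - f.beta * f.rho
      + 3 * f.alpha * f.sigma - star f.beta * f.sigma)
    (h0 : ev (f.db f.beta - f.dl f.alpha - (f.Psi2 - f.alpha * star f.alpha
      + 2 * f.alpha * f.beta - f.beta * star f.beta - f.mu * f.rho + f.lam * f.sigma)) = 0) :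
    f.db f.beta - f.dl f.alpha = f.Psi2 - f.alpha * star f.alpha
      + 2 * f.alpha * f.beta - f.beta * star f.beta - f.mu * f.rho + f.lam * f.sigma := by
  rw [← sub_eq_zero]
  refine eq_zero_of_scalar (c := 2 * f.rho) (d := 0) ?_ h0
  have hc := db_dl hfr f.eps
  have h1' := congrArg star h1
  simp only [map_add, map_sub, D_mul, D_ofNat, D_star, D_dl hf.P, D_db hr hf.P, hf.rho, hf.sigma,
    hs.alpha, hs.beta, hs.Psi1, hm.mu, hm.lam, hm.Psi2, dl_mul, db_mul, dl_star, db_star, star_add,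
    star_sub, star_mul', star_star, hr, he, pi, star_ofNat, dl_ofNat, db_ofNat, star_db_of_real hr,
    star_dl_of_real hr, star_db_of_real he, star_dl_of_real he] at h1' ⊢
  linear_combination hc + (2 * f.alpha + star f.beta) * h1 - f.beta * h1'

/-- The non-real part of the source for `μ` is the constraint for `Ψ₂` minus its conjugate, so `μ̄ -
μ` satisfies a homogeneous equation. -/
theorem mu_real_of_transport (hr : star f.rho = f.rho) (he : star f.eps = f.eps)
    (hm : f.ShearTransport)
    (h2 : f.db f.beta - f.dl f.alpha = f.Psi2 - f.alpha * star f.alpha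
      + 2 * f.alpha * f.beta - f.beta * star f.beta - f.mu * f.rho + f.lam * f.sigma)
    (h0 : ev (star f.mu - f.mu) = 0) : star f.mu = f.mu := by
  rw [← sub_eq_zero]
  refine eq_zero_of_scalar (c := 2 * f.rho - 2 * f.eps) (d := 0) ?_ h0
  have h2' := congrArg star h2
  simp only [map_add, map_sub, D_star, hm.mu, dl_star, star_add,
    star_sub, star_mul', star_star, hr, he, pi, star_ofNat] at h2' ⊢
  linear_combination h2 - h2'

/-- Here the second derivatives form `[δ̄, δ]π`. The remaining terms are multiples of the two
preceding Ricci constraints and a conjugate, and reality of `μ` is needed as well. -/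
theorem ricci_three_of_transport (hr : star f.rho = f.rho) (he : star f.eps = f.eps)
    (hmu : star f.mu = f.mu)
    (hf : f.FrameTransport) (hs : f.SpinTransport) (hm : f.ShearTransport) (hw : f.WeylTransport)
    (hfr : ∀ A, f.db (f.P A) - star (f.db (f.P A)) = (f.alpha - star f.beta) * f.P A
      - (star f.alpha - f.beta) * star (f.P A))
    (h1 : f.db f.sigma - f.dl f.rho = f.Psi1 - star f.alpha * f.rho - f.beta * f.rho
      + 3 * f.alpha * f.sigma - star f.beta * f.sigma)
    (h2 : f.db f.beta - f.dl f.alpha = f.Psi2 - f.alpha * star f.alpha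
      + 2 * f.alpha * f.beta - f.beta * star f.beta - f.mu * f.rho + f.lam * f.sigma)
    (h0 : ev (f.db f.mu - f.dl f.lam - (f.Psi3 - star f.alpha * f.lam + 3 * f.beta * f.lam
      - f.alpha * f.mu - star f.beta * f.mu)) = 0) :
    f.db f.mu - f.dl f.lam = f.Psi3 - star f.alpha * f.lam + 3 * f.beta * f.lam
      - f.alpha * f.mu - star f.beta * f.mu := by
  rw [← sub_eq_zero]
  refine eq_zero_of_scalar (c := 2 * f.rho - 2 * f.eps) (d := 0) ?_ h0
  have hc := db_dl hfr f.pi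
  have h1' := congrArg star h1
  have h2' := congrArg star h2
  simp only [map_add, map_sub, D_mul, D_ofNat, D_star, D_dl hf.P, D_db hr hf.P, hf.rho, hf.sigma,
    hs.alpha, hs.beta, hs.Psi1, hm.mu, hm.lam, hm.Psi2, hw.Psi3, dl_mul, db_mul, dl_star, db_star,
    star_add, star_sub, star_mul', star_star, hr, he, hmu, pi, star_ofNat, dl_ofNat, db_ofNat,
    star_db_of_real hr, star_dl_of_real hr, star_db_of_real he, star_dl_of_real he,
    star_db_of_real hmu, star_dl_of_real hmu] at hc h1' h2' ⊢
  linear_combination hc + f.lam * h1 - f.mu * h1' + 2 * (f.alpha + star f.beta) * h2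
end Core
end StewartGauge

/-! ### Covariance under spins of the frame -/

namespace StewartGauge
open TransportRing
namespace Core

variable {R : Type*} [CommRing R] [StarRing R] [TransportRing R]

/-- The spin `m ↦ z m`. -/
def spin (z : R) (f : Core R) : Core R where
  P A := z * f.P A
  rho := f.rho
  sigma := z ^ 2 * f.sigma
  alpha := star z * f.alpha - half * star (f.dl z)
  beta := z * f.beta + half * f.dl z
  mu := f.mu
  lam := star z ^ 2 * f.lam
  eps := f.eps
  Psi0 := z ^ 2 * f.Psi0
  Psi1 := z * f.Psi1
  Psi2 := f.Psi2
  Psi3 := star z * f.Psi3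
  Psi4 := star z ^ 2 * f.Psi4

variable {f : Core R} {z : R}

theorem spin_dl (a : R) : (f.spin z).dl a = z * f.dl a := by
  simp only [dl, along_apply, spin]; ring

theorem spin_db (a : R) : (f.spin z).db a = star z * f.db a := by
  simp only [db, along_apply, spin, star_mul']; ring

theorem spin_pi : (f.spin z).pi = star z * f.pi := by
  simp only [pi, spin, star_add, star_mul', star_half]; ring

/-- Differentiating `z z̄ = 1` eliminates `δ̄z`, so that most covariance identities become
polynomial in `z`, `δz` and their conjugates. -/
theorem db_unitary (hz : z * star z = 1) : f.db z = -(z ^ 2 * star (f.dl z)) := by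
  have h := congrArg f.db hz
  have h1 : f.db (1 : R) = 0 := along_one _
  rw [db_mul, db_star, h1] at h
  linear_combination z * h - f.db z * hz

theorem spin_frameTransport (hz : z * star z = 1) (hD : D z = 0) (hf : f.FrameTransport) :
    (f.spin z).FrameTransport where
  P A := by
    simp only [spin, D_mul, hD, hf.P, star_mul']
    linear_combination (-z * f.sigma * star (f.P A)) * hz
  rho := by
    simp only [spin, hf.rho, star_mul', star_pow]
    linear_combination (- f.sigma * star f.sigma * (z * star z + 1)) * hz
  sigma := by
    simp only [spin, pow_two, D_mul, hD, hf.sigma]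
    ring

/-- As `Dz = 0`, the commutator gives `D(δz) = ρδz + σδ̄z`. This is what the inhomogeneous terms of
`α` and `β` contribute on the right-hand sides. -/
theorem spin_spinTransport (hz : z * star z = 1) (hD : D z = 0) (hf : f.FrameTransport)
    (hr : star f.rho = f.rho) (hs : f.SpinTransport) :
    (f.spin z).SpinTransport where
  alpha := by
    have h2 := two_mul_half (R := R)
    rw [spin_pi, spin_db]
    simp only [spin, map_sub, D_mul, D_star, hD, D_half, hs.alpha, D_dl hf.P, db_unitary hz,
      map_zero, star_zero, star_add, star_mul', star_pow, star_star, hr, star_neg]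
    grind
  beta := by
    have h2 := two_mul_half (R := R)
    rw [spin_pi, spin_dl]
    simp only [spin, map_add, D_mul, D_star, hD, D_half, hs.beta, D_dl hf.P, db_unitary hz,
      map_zero, star_zero, star_add, star_mul', star_pow, star_star, hr, star_neg]
    grind
  Psi1 := by
    have h2 := two_mul_half (R := R)
    rw [spin_pi, spin_db]
    simp only [spin, map_add, D_mul, D_star, hD, D_half, hs.Psi1, D_dl hf.P, db_unitary hz,
      map_zero, star_zero, star_add, star_mul', star_pow, star_star, hr, star_neg, pow_two, db_mul]
    grind

/-- The derivatives of the weights of `π` and `Ψ₁` are absorbed by the inhomogeneous terms of `α`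
and `β`. -/
theorem spin_shearTransport (hz : z * star z = 1) (hD : D z = 0) (hm : f.ShearTransport) :
    (f.spin z).ShearTransport where
  mu := by
    have h2 := two_mul_half (R := R)
    rw [spin_pi, spin_dl]
    simp only [spin, hm.mu, db_unitary hz,
      map_zero, star_zero, star_add, star_sub, star_mul', star_pow, star_star, star_neg, pow_two,
      db_mul, dl_mul, db_star, dl_star, star_half]
    grind
  lam := by
    have h2 := two_mul_half (R := R)
    rw [spin_pi, spin_db]
    simp only [spin, D_mul, D_star, hD, hm.lam, db_unitary hz,
      map_zero, star_zero, star_add, star_sub, star_mul', star_pow, star_star, star_neg, pow_two,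
      db_mul, dl_mul, db_star, dl_star, star_half]
    grind
  Psi2 := by
    have h2 := two_mul_half (R := R)
    rw [spin_pi, spin_db]
    simp only [spin, hm.Psi2, db_unitary hz,
      map_zero, star_zero, star_add, star_sub, star_mul', star_pow, star_star, star_neg, pow_two,
      db_mul, dl_mul, db_star, dl_star, star_half]
    grind

theorem spin_weylTransport (hz : z * star z = 1) (hD : D z = 0) (hw : f.WeylTransport) :
    (f.spin z).WeylTransport where
  Psi3 := by
    have h2 := two_mul_half (R := R)
    rw [spin_pi, spin_db]
    simp only [spin, D_mul, D_star, hD, hw.Psi3, db_unitary hz,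
      map_zero, star_zero, star_add, star_sub, star_mul', star_pow, star_star, star_neg, pow_two,
      db_mul, dl_mul, db_star, dl_star, star_half]
    grind
  Psi4 := by
    have h2 := two_mul_half (R := R)
    rw [spin_pi, spin_db]
    simp only [spin, D_mul, D_star, hD, hw.Psi4, db_unitary hz,
      map_zero, star_zero, star_add, star_sub, star_mul', star_pow, star_star, star_neg, pow_two,
      db_mul, dl_mul, db_star, dl_star, star_half]
    grind

/-- The transport equations are covariant under spins. -/
theorem Transport.spin (hz : z * star z = 1) (hD : D z = 0) (hr : star f.rho = f.rho)
    (h : f.Transport) : (f.spin z).Transport where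
  toFrameTransport := spin_frameTransport hz hD h.toFrameTransport
  toSpinTransport := spin_spinTransport hz hD h.toFrameTransport hr h.toSpinTransport
  toShearTransport := spin_shearTransport hz hD h.toShearTransport
  toWeylTransport := spin_weylTransport hz hD h.toWeylTransport

/-- The constraints are covariant under spins. -/
theorem Sphere.spin (hz : z * star z = 1) (h : f.Sphere) : (f.spin z).Sphere where
  frame A := by
    have h2 := two_mul_half (R := R)
    have h0 := h.frame A
    rw [spin_db]
    simp only [Core.spin, db_unitary hz,
      map_zero, star_zero, star_add, star_sub, star_mul', star_pow, star_star, star_neg, pow_two,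
      db_mul, dl_mul, db_star, dl_star, star_half]
    grind
  ricci_one := by
    have h2 := two_mul_half (R := R)
    have h0 := h.ricci_one
    rw [spin_db, spin_dl]
    simp only [Core.spin, db_unitary hz,
      map_zero, star_zero, star_add, star_sub, star_mul', star_pow, star_star, star_neg, pow_two,
      db_mul, dl_mul, db_star, dl_star, star_half]
    grind
  ricci_two := by
    have h2 := two_mul_half (R := R)
    have h0 := h.ricci_two
    -- This is the only constraint that produces second derivatives of `z`, and they occur as a
    -- commutator.
    have hc := db_dl h.frame z
    have hu := db_unitary (f := f) hz
    rw [hu] at hc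
    rw [spin_db, spin_dl]
    simp only [Core.spin, map_neg, map_add, map_sub, dl_half, db_half, db_unitary hz,
      map_zero, star_zero, star_add, star_sub, star_mul', star_pow, star_star, star_neg, pow_two,
      db_mul, dl_mul, db_star, dl_star, star_half] at hc ⊢
    grind
  ricci_three := by
    have h2 := two_mul_half (R := R)
    have h0 := h.ricci_three
    rw [spin_db, spin_dl]
    simp only [Core.spin, db_unitary hz,
      map_zero, star_zero, star_add, star_sub, star_mul', star_pow, star_star, star_neg, pow_two,
      db_mul, dl_mul, db_star, dl_star, star_half]
    grind

end Core
end StewartGauge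

/-! ### Uniqueness and existence for the transport hierarchy -/

namespace StewartGauge
open TransportRing

namespace TransportRing

variable {R : Type*} [CommRing R] [StarRing R] [TransportRing R]

theorem exists_scalar (c d b y₀ : R) :
    ∃ y, D y = c * y + d * star y + b ∧ ev y = ev y₀ := by
  obtain ⟨y, h, h0⟩ := exists_linear 1 (fun _ _ => c) (fun _ _ => d) (fun _ => b) (fun _ => y₀)
  exact ⟨y 0, by simpa using h 0, h0 0⟩

/-- A transport equation with zero right-hand side has constant solutions only. -/
theorem eq_ev_of_D_eq_zero {y : R} (h : D y = 0) : y = ev y := by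
  rw [← sub_eq_zero]
  exact eq_zero_of_scalar (c := 0) (d := 0) (by simp [h, D_ev]) (by simp [ev_ev])

end TransportRing

namespace Core

variable {R : Type*} [CommRing R] [StarRing R] [TransportRing R] {f g : Core R}

/-- The evaluation of all the components at `v = 0`. -/
def atZero (f : Core R) : Core R := f.map ev

/-! #### Uniqueness -/

/-- Differences of the quadratic terms factor through the differences of the unknowns, so the latter
solve a homogeneous linear system whose coefficients involve both solutions. -/
theorem rho_sigma_unique (hf : f.FrameTransport) (hg : g.FrameTransport) (he : f.eps = g.eps)
    (hΨ : f.Psi0 = g.Psi0) (hρ : ev f.rho = ev g.rho) (hσ : ev f.sigma = ev g.sigma) :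
    f.rho = g.rho ∧ f.sigma = g.sigma := by
  have := eq_zero_of_linear 2
    ![![2 * f.eps + f.rho + g.rho, star g.sigma], ![2 * f.sigma, 2 * f.eps + 2 * g.rho]]
    ![![0, f.sigma], ![0, 0]] ![f.rho - g.rho, f.sigma - g.sigma] ?_ ?_
  · have h0 := this 0
    have h1 := this 1
    simp only [Matrix.cons_val_zero, Matrix.cons_val_one] at h0 h1
    exact ⟨sub_eq_zero.1 h0, sub_eq_zero.1 h1⟩
  · simp [Fin.forall_fin_two, hf.rho, hg.rho, hf.sigma, hg.sigma, hΨ, he]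
    constructor <;> ring
  · simp [Fin.forall_fin_two, hρ, hσ]

theorem P_unique (hf : f.FrameTransport) (hg : g.FrameTransport) (hρ : f.rho = g.rho)
    (hσ : f.sigma = g.sigma) {A : Fin 2} (hP : ev (f.P A) = ev (g.P A)) : f.P A = g.P A := by
  rw [← sub_eq_zero]
  refine eq_zero_of_scalar (c := f.rho) (d := f.sigma) ?_ (by simp [hP])
  simp [hf.P, hg.P, hρ, hσ]
  ring

/-- The initial values determine the solution of the transport equations. -/
theorem Transport.unique (hf : f.Transport) (hg : g.Transport) (he : f.eps = g.eps)
    (hΨ : f.Psi0 = g.Psi0) (h0 : f.atZero = g.atZero) : f = g := by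
  obtain ⟨hρ, hσ⟩ := rho_sigma_unique hf.toFrameTransport hg.toFrameTransport he hΨ
    (congrArg Core.rho h0) (congrArg Core.sigma h0)
  have hP : f.P = g.P := funext fun A =>
    P_unique hf.toFrameTransport hg.toFrameTransport hρ hσ (congrFun (congrArg Core.P h0) A)
  have hdl : f.dl = g.dl := by simp [dl, hP]
  have hdb : f.db = g.db := by simp [db, hP]
  -- With frame and `Ψ₀` already identified, the derivative terms cancel and a closed linear system
  -- for three differences remains.
  have h1 := eq_zero_of_linear 3
    ![![2 * f.rho, star f.sigma, 0], ![2 * f.sigma, f.rho, 1],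
      ![-3 * f.Psi0, 0, 2 * (2 * f.rho + f.eps)]]
    ![![0, f.rho, 0], ![0, f.sigma, 0], ![0, f.Psi0, 0]]
    ![f.alpha - g.alpha, f.beta - g.beta, f.Psi1 - g.Psi1] ?_ ?_
  rotate_left
  · simp [Fin.forall_fin_succ, Fin.sum_univ_succ, hf.alpha, hg.alpha, hf.beta, hg.beta, hf.Psi1,
      hg.Psi1, hΨ, he, hρ, hσ, hdl, hdb, pi]
    refine ⟨?_, ?_, ?_⟩ <;> ring
  · have ha := congrArg Core.alpha h0
    have hb := congrArg Core.beta h0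
    have hc := congrArg Core.Psi1 h0
    simp only [atZero, map] at ha hb hc
    simp [Fin.forall_fin_succ, ha, hb, hc]
  have hα : f.alpha = g.alpha := sub_eq_zero.1 (by simpa using h1 0)
  have hβ : f.beta = g.beta := sub_eq_zero.1 (by simpa using h1 1)
  have hΨ1 : f.Psi1 = g.Psi1 := sub_eq_zero.1 (by simpa using h1 2)
  have hπ : f.pi = g.pi := by simp [pi, hα, hβ]
  -- The derivatives of `π` and `Ψ₁` now cancel, and this stage has no conjugate terms.
  have h2 := eq_zero_of_linear 3
    ![![f.rho - 2 * f.eps, f.sigma, 1], ![star f.sigma, f.rho - 2 * f.eps, 0],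
      ![0, -f.Psi0, 3 * f.rho]]
    ![![0, 0, 0], ![0, 0, 0], ![0, 0, 0]]
    ![f.mu - g.mu, f.lam - g.lam, f.Psi2 - g.Psi2] ?_ ?_
  rotate_left
  · simp [Fin.forall_fin_succ, Fin.sum_univ_succ, hf.mu, hg.mu, hf.lam, hg.lam, hf.Psi2,
      hg.Psi2, hΨ, he, hρ, hσ, hdl, hdb, hπ, hα, hβ, hΨ1]
    refine ⟨?_, ?_, ?_⟩ <;> ring
  · have ha := congrArg Core.mu h0
    have hb := congrArg Core.lam h0
    have hc := congrArg Core.Psi2 h0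
    simp only [atZero, map] at ha hb hc
    simp [Fin.forall_fin_succ, ha, hb, hc]
  have hμ : f.mu = g.mu := sub_eq_zero.1 (by simpa using h2 0)
  have hl : f.lam = g.lam := sub_eq_zero.1 (by simpa using h2 1)
  have hΨ2 : f.Psi2 = g.Psi2 := sub_eq_zero.1 (by simpa using h2 2)
  have hΨ3 : f.Psi3 = g.Psi3 := by
    rw [← sub_eq_zero]
    refine eq_zero_of_scalar (c := 2 * (f.rho - f.eps)) (d := 0) ?_ ?_
    · simp [hf.Psi3, hg.Psi3, he, hρ, hdb, hπ, hl, hΨ1, hΨ2]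
      ring
    · have := congrArg Core.Psi3 h0
      simp only [atZero, map] at this
      simp [this]
  have hΨ4 : f.Psi4 = g.Psi4 := by
    rw [← sub_eq_zero]
    refine eq_zero_of_scalar (c := -(4 * f.eps - f.rho)) (d := 0) ?_ ?_
    · simp [hf.Psi4, hg.Psi4, he, hρ, hdb, hπ, hl, hΨ2, hΨ3, hα]
      ring
    · have := congrArg Core.Psi4 h0
      simp only [atZero, map] at this
      simp [this]
  ext <;> simp [*]

/-- The determinant of the frame `m, m̄`. -/
def frameDet (f : Core R) : R := f.P 0 * star (f.P 1) - f.P 1 * star (f.P 0)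

/-- On a sphere, `P`, `π`, `ρ`, `σ`, `μ` and `λ` determine the remaining components. -/
theorem Sphere.unique (hf : f.Sphere) (hg : g.Sphere) (hdet : ∀ a, f.frameDet * a = 0 → a = 0)
    (hP : f.P = g.P) (hπ : f.pi = g.pi) (hρ : f.rho = g.rho) (hσ : f.sigma = g.sigma)
    (hμ : f.mu = g.mu) (hl : f.lam = g.lam) :
    f.alpha = g.alpha ∧ f.beta = g.beta ∧ f.Psi1 = g.Psi1 ∧ f.Psi2 = g.Psi2 ∧
      f.Psi3 = g.Psi3 := by
  have hdl : f.dl = g.dl := by simp [dl, hP]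
  have hdb : f.db = g.db := by simp [db, hP]
  -- The two components of the frame constraint are linear equations for `α - β̄` and its conjugate.
  -- Eliminating the conjugate leaves the frame determinant as coefficient.
  have hκ : (f.alpha - star f.beta) - (g.alpha - star g.beta) = 0 := by
    apply hdet
    have f0 := hf.frame 0
    have f1 := hf.frame 1
    have g0 := hg.frame 0
    have g1 := hg.frame 1
    rw [← hP, ← hdb] at g0 g1
    rw [frameDet]
    linear_combination star (f.P 1) * (g0 - f0) - star (f.P 0) * (g1 - f1)
  have h2 := two_mul_half (R := R)
  simp only [pi] at hπ
  have hα : f.alpha = g.alpha := by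
    linear_combination half * hκ + half * hπ - (f.alpha - g.alpha) * h2
  have hβ : f.beta = g.beta := by
    have : star f.beta = star g.beta := by linear_combination hπ - hα
    simpa using congrArg star this
  refine ⟨hα, hβ, ?_, ?_, ?_⟩
  · have h := hf.ricci_one
    rw [hdl, hdb, hρ, hσ, hα, hβ, hg.ricci_one] at h
    linear_combination -h
  · have h := hf.ricci_two
    rw [hdl, hdb, hρ, hσ, hα, hβ, hμ, hl, hg.ricci_two] at h
    linear_combination -h
  · have h := hf.ricci_three
    rw [hdl, hdb, hα, hβ, hμ, hl, hg.ricci_three] at h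
    linear_combination -h

/-! #### Existence -/

/-- A solution of the linear system which is equivalent to the Riccati equation for `ρ`, `σ`. -/
structure RiccatiSolution (eps Psi0 rho₀ sigma₀ : R) (a b a' b' : R) : Prop where
  D_a : D a = a'
  D_b : D b = b'
  D_a' : D a' = 2 * eps * a' - Psi0 * star b
  D_b' : D b' = 2 * eps * b' - Psi0 * star a
  ev_a : ev a = 1
  ev_b : ev b = 0
  ev_a' : ev a' = -ev rho₀
  ev_b' : ev b' = -ev sigma₀

/-- This first order system is `D²Y = 2εDY - NY` with `Y = 1`, `DY = -M` initially. Being linear, it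
is solvable on the whole slab, even where the Riccati solution breaks down. -/
theorem exists_riccatiSolution (eps Psi0 rho₀ sigma₀ : R) :
    ∃ a b a' b', RiccatiSolution eps Psi0 rho₀ sigma₀ a b a' b' := by
  obtain ⟨y, h, h0⟩ := exists_linear 4
    ![![0, 0, 1, 0], ![0, 0, 0, 1], ![0, 0, 2 * eps, 0], ![0, 0, 0, 2 * eps]]
    ![![0, 0, 0, 0], ![0, 0, 0, 0], ![0, -Psi0, 0, 0], ![-Psi0, 0, 0, 0]]
    ![0, 0, 0, 0] ![1, 0, -rho₀, -sigma₀]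
  simp only [Fin.forall_fin_succ, Fin.sum_univ_succ] at h h0
  simp at h h0
  obtain ⟨h1, h2, h3, h4⟩ := h
  obtain ⟨i1, i2, i3, i4⟩ := h0
  exact ⟨y 0, y 1, y 2, y 3, h1, h2, h3.trans (by ring), h4.trans (by ring), i1, i2, i3, i4⟩

theorem RiccatiSolution.unique {eps Psi0 rho₀ sigma₀ a b a' b' a₁ b₁ a₁' b₁' : R}
    (h : RiccatiSolution eps Psi0 rho₀ sigma₀ a b a' b')
    (h₁ : RiccatiSolution eps Psi0 rho₀ sigma₀ a₁ b₁ a₁' b₁') : a = a₁ ∧ b = b₁ := by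
  have := eq_zero_of_linear 4
    ![![0, 0, 1, 0], ![0, 0, 0, 1], ![0, 0, 2 * eps, 0], ![0, 0, 0, 2 * eps]]
    ![![0, 0, 0, 0], ![0, 0, 0, 0], ![0, -Psi0, 0, 0], ![-Psi0, 0, 0, 0]]
    ![a - a₁, b - b₁, a' - a₁', b' - b₁'] ?_ ?_
  · exact ⟨sub_eq_zero.1 (by simpa using this 0), sub_eq_zero.1 (by simpa using this 1)⟩
  · simp [Fin.forall_fin_succ, Fin.sum_univ_succ, h.D_a, h.D_b, h.D_a', h.D_b', h₁.D_a, h₁.D_b,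
      h₁.D_a', h₁.D_b']
    constructor <;> ring
  · simp [Fin.forall_fin_succ, h.ev_a, h.ev_b, h.ev_a', h.ev_b', h₁.ev_a, h₁.ev_b, h₁.ev_a',
      h₁.ev_b']

/-- Needed for restriction to smaller slabs and for pull-back under a change of coordinates. -/
theorem RiccatiSolution.map {S : Type*} [CommRing S] [StarRing S] [TransportRing S]
    {eps Psi0 rho sigma a b p q : R} {rho' sigma' : S} {φ : R →+* S}
    (hstar : ∀ a, φ (star a) = star (φ a)) (hD : ∀ a, φ (D a) = D (φ a))
    (hev : ∀ a, φ (ev a) = ev (φ a)) (h : RiccatiSolution eps Psi0 rho sigma a b p q)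
    (hrho : ev (φ rho) = ev rho') (hsigma : ev (φ sigma) = ev sigma') :
    RiccatiSolution (φ eps) (φ Psi0) rho' sigma' (φ a) (φ b) (φ p) (φ q) where
  D_a := by rw [← hD, h.D_a]
  D_b := by rw [← hD, h.D_b]
  D_a' := by rw [← hD, h.D_a']; simp only [map_sub, map_mul, map_ofNat, hstar]
  D_b' := by rw [← hD, h.D_b']; simp only [map_sub, map_mul, map_ofNat, hstar]
  ev_a := by rw [← hev, h.ev_a, map_one]
  ev_b := by rw [← hev, h.ev_b, map_zero]
  ev_a' := by rw [← hev, h.ev_a', map_neg, hev, hrho]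
  ev_b' := by rw [← hev, h.ev_b', map_neg, hev, hsigma]

/-- The entry `a` has spin weight zero and `b` has weight two, so `aā - bb̄` is spin invariant. -/
theorem RiccatiSolution.spin {eps Psi0 rho₀ sigma₀ a b a' b' z : R}
    (h : RiccatiSolution eps Psi0 rho₀ sigma₀ a b a' b') (hz : z * star z = 1) (hD : D z = 0) :
    RiccatiSolution eps (z ^ 2 * Psi0) rho₀ (z ^ 2 * sigma₀) a (z ^ 2 * b) a' (z ^ 2 * b') where
  D_a := h.D_a
  D_b := by simp [pow_two, D_mul, hD, h.D_b]
  D_a' := by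
    rw [h.D_a', star_mul', star_pow]
    linear_combination Psi0 * star b * (z * star z + 1) * hz
  D_b' := by
    simp only [pow_two, D_mul, hD, h.D_b']
    ring
  ev_a := h.ev_a
  ev_b := by simp [h.ev_b]
  ev_a' := h.ev_a'
  ev_b' := by simp [h.ev_b']

/-- Solutions of the Riccati equation for `ρ` and `σ`. -/
theorem RiccatiSolution.exists_rho_sigma {eps Psi0 rho₀ sigma₀ a b a' b' e : R}
    (h : RiccatiSolution eps Psi0 rho₀ sigma₀ a b a' b') (he : star eps = eps)
    (hr : star (ev rho₀) = ev rho₀) (hu : (a * star a - b * star b) * e = 1) :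
    ∃ rho sigma : R, D rho = 2 * eps * rho + rho * rho + sigma * star sigma ∧
      D sigma = Psi0 + 2 * eps * sigma + 2 * rho * sigma ∧ star rho = rho ∧
      ev rho = ev rho₀ ∧ ev sigma = ev sigma₀ ∧
      D (a * star a - b * star b) = -2 * rho * (a * star a - b * star b) := by
  -- A Wronskian identity: the defect satisfies `Dw = 2εw` and vanishes initially because `ρ` is
  -- real there. It makes `ρ` real everywhere.
  have hN : a' * star a - b' * star b = a * star a' - b * star b' := by
    rw [← sub_eq_zero]
    refine eq_zero_of_scalar (c := 2 * eps) (d := 0) ?_ ?_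
    · simp only [map_sub, D_mul, D_star, h.D_a, h.D_b, h.D_a', h.D_b', star_sub, star_mul', he,
        star_ofNat, star_star]
      ring
    · simp [h.ev_a, h.ev_b, h.ev_a', ev_star, hr]
  have hes : star e = e := by
    have h1 := congrArg star hu
    simp only [star_mul', star_sub, star_star, star_one] at h1
    linear_combination e * h1 - star e * hu
  have hDd : D (a * star a - b * star b) = 2 * (a' * star a - b' * star b) := by
    simp only [map_sub, D_mul, D_star, h.D_a, h.D_b]
    linear_combination -hN
  have hDe : D e = -(2 * (a' * star a - b' * star b)) * e ^ 2 := by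
    have h1 := congrArg D hu
    rw [D_mul, hDd, D_one] at h1
    linear_combination e * h1 - D e * hu
  have hd0 : ev e = 1 := by
    have h1 := congrArg ev hu
    simpa [h.ev_a, h.ev_b, ev_star] using h1
  -- These are the entries of the first row of `-(DY)Y⁻¹`, where `e` is the inverse of `det Y`. The
  -- last claim is Jacobi's formula for the determinant.
  refine ⟨-(a' * star a - b' * star b) * e, -(b' * a - a' * b) * e, ?_, ?_, ?_, ?_, ?_, ?_⟩
  · simp only [map_neg, map_sub, D_mul, D_star, h.D_a, h.D_b, h.D_a', h.D_b', hDe, star_neg,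
      star_sub, star_mul', hes, star_star]
    grind
  · simp only [map_neg, map_sub, D_mul, D_star, h.D_a, h.D_b, h.D_a', h.D_b', hDe, star_neg,
      star_sub, star_mul', hes, star_star]
    grind
  · simp only [star_neg, star_sub, star_mul', hes, star_star]
    linear_combination e * hN
  · simp [h.ev_a, h.ev_b, h.ev_a', hd0, ev_star]
  · simp [h.ev_a, h.ev_b, h.ev_b', hd0]
  · rw [hDd]
    linear_combination (-2 * (a' * star a - b' * star b)) * hu

theorem ev_dl (a : R) : ev (f.dl a) = f.atZero.dl (ev a) := ev_along _ _

theorem ev_db (a : R) : ev (f.db a) = f.atZero.db (ev a) := by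
  simp [db, ev_along, ev_star, atZero, map]

/-- Reality and the constraints propagate along the null hypersurface. -/
theorem Transport.sphere (h : f.Transport) (he : star f.eps = f.eps) (hr : star f.rho = f.rho)
    (hre : f.atZero.IsReal) (hs : f.atZero.Sphere) : f.Sphere ∧ star f.mu = f.mu := by
  have h1 := ricci_one_of_transport hr he h.toFrameTransport h.toSpinTransport (by
    simp only [map_sub, map_add, map_mul, ev_dl, ev_db, ev_star, map_ofNat]
    exact sub_eq_zero.2 hs.ricci_one)
  have hfr : ∀ A, f.db (f.P A) - star (f.db (f.P A)) = (f.alpha - star f.beta) * f.P A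
      - (star f.alpha - f.beta) * star (f.P A) := fun A =>
    frame_of_transport hr he h.toFrameTransport h.toSpinTransport h1 (by
      simp only [map_sub, map_add, map_mul, ev_dl, ev_db, ev_star, map_ofNat]
      exact sub_eq_zero.2 (hs.frame A))
  have h2 := ricci_two_of_transport hr he h.toFrameTransport h.toSpinTransport h.toShearTransport
    hfr h1 (by
      simp only [map_sub, map_add, map_mul, ev_dl, ev_db, ev_star, map_ofNat]
      exact sub_eq_zero.2 hs.ricci_two)
  have hμ := mu_real_of_transport hr he h.toShearTransport h2 (by
    simp only [map_sub, ev_star]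
    exact sub_eq_zero.2 hre.mu)
  have h3 := ricci_three_of_transport hr he hμ h.toFrameTransport h.toSpinTransport
    h.toShearTransport h.toWeylTransport hfr h1 h2 (by
      simp only [map_sub, map_add, map_mul, ev_dl, ev_db, ev_star, map_ofNat]
      exact sub_eq_zero.2 hs.ricci_three)
  exact ⟨⟨hfr, h1, h2, h3⟩, hμ⟩

/-- Existence of solutions of the transport equations with given initial values, as long as the
solution of the Riccati equation exists. -/
theorem exists_transport (f₀ : Core R) (he : star f₀.eps = f₀.eps) (hre : f₀.atZero.IsReal)
    (hs : f₀.atZero.Sphere) {a b a' b' e : R}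
    (h : RiccatiSolution f₀.eps f₀.Psi0 f₀.rho f₀.sigma a b a' b')
    (hu : (a * star a - b * star b) * e = 1) :
    ∃ f : Core R, f.Transport ∧ f.Sphere ∧ f.IsReal ∧ f.eps = f₀.eps ∧ f.Psi0 = f₀.Psi0 ∧
      f.atZero = f₀.atZero ∧ f.frameDet * (a * star a - b * star b) = ev f₀.frameDet := by
  obtain ⟨rho, sigma, hrho, hsigma, hr, hrho0, hsigma0, hd⟩ := h.exists_rho_sigma he hre.rho hu
  choose P hP hP0 using fun A => exists_scalar rho sigma 0 (f₀.P A)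
  -- The components of `s` are `α`, `β`, `Ψ₁`. The term `π = α + β̄` has been expanded, which
  -- produces the conjugate coefficients.
  obtain ⟨s, hs1, hs0⟩ := exists_linear 3
    ![![2 * rho, star sigma, 0], ![2 * sigma, rho, 1],
      ![-3 * f₀.Psi0, 0, 2 * (2 * rho + f₀.eps)]]
    ![![0, rho, 0], ![0, sigma, 0], ![0, f₀.Psi0, 0]]
    ![along (fun A => star (P A)) f₀.eps, along P f₀.eps, along (fun A => star (P A)) f₀.Psi0]
    ![f₀.alpha, f₀.beta, f₀.Psi1]
  -- The components of `m` are `μ`, `λ`, `Ψ₂`; everything built from `s` is a known source at this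
  -- stage.
  obtain ⟨m, hm1, hm0⟩ := exists_linear 3
    ![![rho - 2 * f₀.eps, sigma, 1], ![star sigma, rho - 2 * f₀.eps, 0],
      ![0, -f₀.Psi0, 3 * rho]]
    ![![0, 0, 0], ![0, 0, 0], ![0, 0, 0]]
    ![along P (s 0 + star (s 1)) - star (s 0) * (s 0 + star (s 1)) + s 1 * (s 0 + star (s 1))
        + (s 0 + star (s 1)) * star (s 0 + star (s 1)),
      along (fun A => star (P A)) (s 0 + star (s 1)) + s 0 * (s 0 + star (s 1))
        - star (s 1) * (s 0 + star (s 1)) + (s 0 + star (s 1)) * (s 0 + star (s 1)),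
      along (fun A => star (P A)) (s 2) + 2 * (s 0 + star (s 1) - s 0) * s 2]
    ![f₀.mu, f₀.lam, f₀.Psi2]
  obtain ⟨Psi3, h3, h30⟩ := exists_scalar (2 * (rho - f₀.eps)) 0
    (along (fun A => star (P A)) (m 2) + 3 * (s 0 + star (s 1)) * m 2 - 2 * m 1 * s 2) f₀.Psi3
  obtain ⟨Psi4, h4, h40⟩ := exists_scalar (-(4 * f₀.eps - rho)) 0
    (along (fun A => star (P A)) Psi3 + 2 * (2 * (s 0 + star (s 1)) + s 0) * Psi3
      - 3 * m 1 * m 2) f₀.Psi4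
  simp only [Fin.forall_fin_succ, Fin.sum_univ_succ] at hs1 hs0 hm1 hm0
  simp at hs1 hs0 hm1 hm0
  set f : Core R :=
    { P := P, rho := rho, sigma := sigma, alpha := s 0, beta := s 1, mu := m 0, lam := m 1,
      eps := f₀.eps, Psi0 := f₀.Psi0, Psi1 := s 2, Psi2 := m 2, Psi3 := Psi3, Psi4 := Psi4 } with hf
  have ht : f.Transport :=
    { P := fun A => (hP A).trans (add_zero _)
      rho := hrho
      sigma := hsigma
      alpha := hs1.1.trans (by simp only [hf, db, pi]; ring)
      beta := hs1.2.1.trans (by simp only [hf, dl, pi]; ring)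
      Psi1 := hs1.2.2.trans (by simp only [hf, db, pi]; ring)
      mu := hm1.1.trans (by simp only [hf, dl, pi, star_add, star_star, map_add]; ring)
      lam := hm1.2.1.trans (by simp only [hf, db, pi, map_add]; ring)
      Psi2 := hm1.2.2.trans (by simp only [hf, db, pi]; ring)
      Psi3 := h3.trans (by simp only [hf, db, pi]; ring)
      Psi4 := h4.trans (by simp only [hf, db, pi]; ring) }
  have hstart : f.atZero = f₀.atZero := by
    ext
    exacts [hP0 _, hrho0, hsigma0, hs0.1, hs0.2.1, hm0.1, hm0.2.1, rfl, rfl, hs0.2.2, hm0.2.2,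
      h30, h40]
  obtain ⟨hsph, hμ⟩ := ht.sphere he hr (hstart ▸ hre) (hstart ▸ hs)
  refine ⟨f, ht, hsph, ⟨hr, hμ, he⟩, rfl, rfl, hstart, ?_⟩
  have hdet0 : ev f.frameDet = ev f₀.frameDet := by
    simp only [frameDet, map_sub, map_mul, ev_star]
    rw [show f.P = P from rfl, hP0, hP0]
  -- The frame determinant grows at rate `2ρ` and the Riccati determinant at rate `-2ρ`, so their
  -- product is constant along the generators. The frame thus stays non-degenerate.
  rw [eq_ev_of_D_eq_zero (y := f.frameDet * (a * star a - b * star b)), map_mul, hdet0]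
  · simp [h.ev_a, h.ev_b, ev_star]
  · rw [D_mul, hd]
    simp only [frameDet, map_sub, D_mul, D_star, ht.P, star_add, star_mul', star_star,
      show star f.rho = f.rho from hr]
    rw [show rho = f.rho from rfl]
    ring

/-- The constraints are preserved by homomorphisms which commute with the angular derivatives. -/
theorem Sphere.map {S : Type*} [CommRing S] [StarRing S] [TransportRing S] {φ : R →+* S}
    (hstar : ∀ a, φ (star a) = star (φ a)) (hpar : ∀ A a, φ (par A a) = par A (φ a))
    (h : f.Sphere) : (f.map φ).Sphere := by
  have hdl : ∀ a, φ (f.dl a) = (f.map φ).dl (φ a) := fun a => by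
    simp [dl, along_apply, hpar, Core.map]
  have hdb : ∀ a, φ (f.db a) = (f.map φ).db (φ a) := fun a => by
    simp [db, along_apply, hpar, hstar, Core.map]
  refine ⟨fun A => ?_, ?_, ?_, ?_⟩
  · have := congrArg φ (h.frame A)
    simp only [map_sub, map_add, map_mul, hdl, hdb, hstar, map_ofNat] at this
    exact this
  · have := congrArg φ h.ricci_one
    simp only [map_sub, map_add, map_mul, hdl, hdb, hstar, map_ofNat] at this
    exact this
  · have := congrArg φ h.ricci_two
    simp only [map_sub, map_add, map_mul, hdl, hdb, hstar, map_ofNat] at this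
    exact this
  · have := congrArg φ h.ricci_three
    simp only [map_sub, map_add, map_mul, hdl, hdb, hstar, map_ofNat] at this
    exact this

theorem Sphere.atZero (h : f.Sphere) : f.atZero.Sphere := h.map ev_star ev_par

/-- The constraints can be solved for the components which are not freely specifiable. -/
theorem exists_sphere (P : Fin 2 → R) (pi rho sigma mu lam eps Psi0 Psi4 : R) {e : R}
    (hu : (P 0 * star (P 1) - P 1 * star (P 0)) * e = 1) :
    ∃ f : Core R, f.Sphere ∧ f.P = P ∧ f.pi = pi ∧ f.rho = rho ∧ f.sigma = sigma ∧ f.mu = mu ∧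
      f.lam = lam ∧ f.eps = eps ∧ f.Psi0 = Psi0 ∧ f.Psi4 = Psi4 := by
  set db : R →+ R := along fun A => star (P A) with hdb
  set dl : R →+ R := along P with hdl
  -- Cramer's rule for `α - β̄` in the frame constraint. Together with `π = α + β̄` it fixes `α` and
  -- `β`.
  set κ : R := ((db (P 0) - star (db (P 0))) * star (P 1)
    - (db (P 1) - star (db (P 1))) * star (P 0)) * e with hκ
  set alpha : R := half * (pi + κ) with halpha
  set beta : R := half * star (pi - κ) with hbeta
  have h2 := two_mul_half (R := R)
  -- The determinant of `m, m̄` is anti-Hermitian; this sign makes the conjugate equation for `κ`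
  -- consistent.
  have hes : star e = -e := by
    have h1 := congrArg star hu
    simp only [star_mul', star_sub, star_star, star_one] at h1
    linear_combination -e * h1 - star e * hu
  have hsβ : star beta = half * (pi - κ) := by
    rw [hbeta, star_mul', star_half, star_star]
  have hαβ : alpha - star beta = κ := by
    rw [hsβ, halpha]
    linear_combination κ * h2
  have hαβ' : star alpha - beta = star κ := by
    rw [← hαβ, star_sub, star_star]
  let f : Core R :=
    { P := P, rho := rho, sigma := sigma, alpha := alpha, beta := beta, mu := mu, lam := lam,
      eps := eps, Psi0 := Psi0,
      -- Each of `Ψ₁`, `Ψ₂`, `Ψ₃` occurs undifferentiated in exactly one constraint and is defined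
      -- as its residual.
      Psi1 := db sigma - dl rho - (-star alpha * rho - beta * rho
        + 3 * alpha * sigma - star beta * sigma),
      Psi2 := db beta - dl alpha - (- alpha * star alpha
        + 2 * alpha * beta - beta * star beta - mu * rho + lam * sigma),
      Psi3 := db mu - dl lam - (- star alpha * lam + 3 * beta * lam
        - alpha * mu - star beta * mu),
      Psi4 := Psi4 }
  have hfdb : f.db = db := rfl
  have hfdl : f.dl = dl := rfl
  refine ⟨f, ⟨fun A => ?_, ?_, ?_, ?_⟩, rfl, ?_, rfl, rfl, rfl, rfl, rfl, rfl, rfl⟩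
  · change db (P A) - star (db (P A)) = (alpha - star beta) * P A
      - (star alpha - beta) * star (P A)
    rw [hαβ, hαβ', hκ]
    simp only [star_mul', star_sub, star_star, hes]
    fin_cases A
    · simp only [Fin.zero_eta]
      linear_combination -(db (P 0) - star (db (P 0))) * hu
    · simp only [Fin.mk_one]
      linear_combination -(db (P 1) - star (db (P 1))) * hu
  · rw [hfdb, hfdl]; simp only [f]; ring
  · rw [hfdb, hfdl]; simp only [f]; ring
  · rw [hfdb, hfdl]; simp only [f]; ring
  · change alpha + star beta = pi
    rw [hsβ, halpha]
    linear_combination pi * h2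

/-! ### Exchange of the null directions -/

/-- The exchange of the two null directions. -/
def prime (f : Core R) (eps : R) : Core R where
  P A := star (f.P A)
  rho := -f.mu
  sigma := -f.lam
  alpha := -f.beta
  beta := -f.alpha
  mu := -f.rho
  lam := -f.sigma
  eps := eps
  Psi0 := f.Psi4
  Psi1 := f.Psi3
  Psi2 := f.Psi2
  Psi3 := f.Psi1
  Psi4 := f.Psi0

theorem prime_dl (eps a : R) : (f.prime eps).dl a = f.db a := rfl

theorem prime_db (eps a : R) : (f.prime eps).db a = f.dl a := by
  simp [db, dl, prime]

/-- The constraints for `Ψ₁` and `Ψ₃` are interchanged, the one for `Ψ₂` is fixed, and the frame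
constraint is reproduced up to sign. No constraint contains `ε`, so its replacement is arbitrary. -/
theorem Sphere.prime (h : f.Sphere) (eps : R) : (f.prime eps).Sphere where
  frame A := by
    have := h.frame A
    rw [prime_db]
    simp only [Core.prime, dl_star, star_star, star_neg]
    linear_combination -this
  ricci_one := by
    have := h.ricci_three
    rw [prime_db, prime_dl]
    simp only [Core.prime, map_neg, star_neg]
    linear_combination this
  ricci_two := by
    have := h.ricci_two
    rw [prime_db, prime_dl]
    simp only [Core.prime, map_neg, star_neg]
    linear_combination this
  ricci_three := by
    have := h.ricci_one
    rw [prime_db, prime_dl]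
    simp only [Core.prime, map_neg, star_neg]
    linear_combination this

end Core
end StewartGauge

namespace StewartGauge
open TransportRing Set TopologicalSpace

/-! ### Smooth functions on a null hypersurface -/

/-- The part `0 ≤ v ≤ a` of a null hypersurface over the coordinate patch `U`. -/
def slab (a : Ioi (0 : ℝ)) (U : Opens E2) : Set (ℝ × E2) := Icc 0 (a : ℝ) ×ˢ (U : Set E2)

/-- Extension by zero of a function on the slab. -/
def extZero (a : Ioi (0 : ℝ)) (U : Opens E2) (f : slab a U → ℂ) (p : ℝ × E2) : ℂ :=
  open Classical in if h : p ∈ slab a U then f ⟨p, h⟩ else 0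

/-- The ring of smooth complex functions on the slab. -/
def smoothSubring (a : Ioi (0 : ℝ)) (U : Opens E2) : Subring (slab a U → ℂ) where
  carrier := {f | ContDiffOn ℝ ∞ (extZero a U f) (slab a U)}
  mul_mem' {f g} hf hg := (hf.mul hg).congr fun p hp => by simp [extZero, hp]
  add_mem' {f g} hf hg := (hf.add hg).congr fun p hp => by simp [extZero, hp]
  one_mem' := (contDiffOn_const (c := (1 : ℂ))).congr fun p hp => by simp [extZero, hp]
  zero_mem' := (contDiffOn_const (c := (0 : ℂ))).congr fun p hp => by simp [extZero]
  neg_mem' {f} hf := hf.neg.congr fun p hp => by simp [extZero, hp]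

/-- The type of smooth complex functions on the slab. -/
def SmoothFn (a : Ioi (0 : ℝ)) (U : Opens E2) : Type := smoothSubring a U

namespace SmoothFn

variable {a : Ioi (0 : ℝ)} {U : Opens E2}

instance : CommRing (SmoothFn a U) := inferInstanceAs (CommRing (smoothSubring a U))

/-- The values of a smooth function on the slab; zero outside of the slab. -/
def fn (f : SmoothFn a U) : ℝ × E2 → ℂ := extZero a U f.1

theorem contDiffOn_fn (f : SmoothFn a U) : ContDiffOn ℝ ∞ f.fn (slab a U) := f.2

/-- The element of the ring which is defined by a smooth function. -/
def mk (F : ℝ × E2 → ℂ) (hF : ContDiffOn ℝ ∞ F (slab a U)) : SmoothFn a U :=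
  ⟨fun p => F p, hF.congr fun p hp => by simp [extZero, hp]⟩

theorem fn_mk {F : ℝ × E2 → ℂ} (hF : ContDiffOn ℝ ∞ F (slab a U)) {p : ℝ × E2}
    (hp : p ∈ slab a U) : (mk F hF).fn p = F p := by
  simp [fn, mk, extZero, hp]

theorem ext_fn {f g : SmoothFn a U} (h : ∀ p ∈ slab a U, f.fn p = g.fn p) : f = g := by
  refine Subtype.ext (funext fun p => ?_)
  simpa [fn, extZero] using h p p.2

theorem fn_add (f g : SmoothFn a U) (p : ℝ × E2) : (f + g).fn p = f.fn p + g.fn p := by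
  by_cases hp : p ∈ slab a U <;> simp [fn, extZero, hp]; rfl

theorem fn_mul (f g : SmoothFn a U) (p : ℝ × E2) : (f * g).fn p = f.fn p * g.fn p := by
  by_cases hp : p ∈ slab a U <;> simp [fn, extZero, hp]; rfl

theorem fn_sub (f g : SmoothFn a U) (p : ℝ × E2) : (f - g).fn p = f.fn p - g.fn p := by
  by_cases hp : p ∈ slab a U <;> simp [fn, extZero, hp]; rfl

theorem fn_neg (f : SmoothFn a U) (p : ℝ × E2) : (-f).fn p = -f.fn p := by
  by_cases hp : p ∈ slab a U <;> simp [fn, extZero, hp]; rfl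

theorem fn_zero (p : ℝ × E2) : (0 : SmoothFn a U).fn p = 0 := by
  by_cases hp : p ∈ slab a U <;> simp [fn, extZero, hp]; rfl

theorem fn_one {p : ℝ × E2} (hp : p ∈ slab a U) : (1 : SmoothFn a U).fn p = 1 := by
  simp [fn, extZero, hp]; rfl

/-- The complex conjugate. -/
def conjFn (f : SmoothFn a U) : SmoothFn a U :=
  mk (fun p => conj (f.fn p))
    (ContDiff.comp_contDiffOn (g := fun w : ℂ => conj w) Complex.conjCLE.contDiff f.contDiffOn_fn)

theorem fn_conjFn (f : SmoothFn a U) {p : ℝ × E2} (hp : p ∈ slab a U) :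
    f.conjFn.fn p = conj (f.fn p) := fn_mk _ hp

instance : StarRing (SmoothFn a U) where
  star := conjFn
  star_involutive f := ext_fn fun p hp => by
    rw [fn_conjFn _ hp, fn_conjFn _ hp, Complex.conj_conj]
  star_mul f g := ext_fn fun p hp => by
    rw [fn_mul, fn_conjFn _ hp, fn_conjFn _ hp, fn_conjFn _ hp, fn_mul, map_mul, mul_comm]
  star_add f g := ext_fn fun p hp => by
    rw [fn_add, fn_conjFn _ hp, fn_conjFn _ hp, fn_conjFn _ hp, fn_add, map_add]

theorem fn_star (f : SmoothFn a U) (p : ℝ × E2) : (star f).fn p = conj (f.fn p) := by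
  by_cases hp : p ∈ slab a U
  · exact fn_conjFn f hp
  · simp [fn, extZero, hp]

theorem fn_ofNat (n : ℕ) [n.AtLeastTwo] {p : ℝ × E2} (hp : p ∈ slab a U) :
    (ofNat(n) : SmoothFn a U).fn p = ofNat(n) := by
  simp only [fn, extZero, hp, dif_pos]; rfl

theorem uniqueDiffOn_slab : UniqueDiffOn ℝ (slab a U) := uniqueDiffOn_Icc_prod a.2 U.2

theorem mem_closure_interior_slab {p : ℝ × E2} (hp : p ∈ slab a U) :
    p ∈ closure (interior (slab a U)) := by
  rw [slab, interior_prod_eq, closure_prod_eq, interior_Icc, closure_Ioo (ne_of_lt a.2),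
    U.isOpen.interior_eq]
  exact ⟨hp.1, subset_closure hp.2⟩

theorem differentiableOn_fn (f : SmoothFn a U) : DifferentiableOn ℝ f.fn (slab a U) :=
  f.contDiffOn_fn.differentiableOn (by simp)

theorem contDiffOn_fderivWithin_fn (f : SmoothFn a U) :
    ContDiffOn ℝ ∞ (fderivWithin ℝ f.fn (slab a U)) (slab a U) :=
  ((contDiffOn_infty_iff_fderivWithin uniqueDiffOn_slab).1 f.contDiffOn_fn).2

/-- The derivative in the direction `w`. -/
def dir (w : ℝ × E2) : SmoothFn a U →+ SmoothFn a U where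
  toFun f := mk (fun p => fderivWithin ℝ f.fn (slab a U) p w)
    (f.contDiffOn_fderivWithin_fn.clm_apply contDiffOn_const)
  map_zero' := ext_fn fun p hp => by
    rw [fn_mk _ hp, fn_zero, show (0 : SmoothFn a U).fn = fun _ => 0 from funext fn_zero]
    simp
  map_add' f g := ext_fn fun p hp => by
    rw [fn_add, fn_mk _ hp, fn_mk _ hp, fn_mk _ hp,
      show (f + g).fn = f.fn + g.fn from funext (fn_add f g),
      fderivWithin_add (uniqueDiffOn_slab p hp) (f.differentiableOn_fn p hp)
        (g.differentiableOn_fn p hp), add_apply]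

theorem fn_dir (w : ℝ × E2) (f : SmoothFn a U) {p : ℝ × E2} (hp : p ∈ slab a U) :
    (dir w f).fn p = fderivWithin ℝ f.fn (slab a U) p w := fn_mk _ hp

theorem dir_mul (w : ℝ × E2) (f g : SmoothFn a U) : dir w (f * g) = dir w f * g + f * dir w g :=
  ext_fn fun p hp => by
    rw [fn_add, fn_mul, fn_mul, fn_dir _ _ hp,
      fn_dir _ _ hp, fn_dir _ _ hp,
      show (f * g).fn = f.fn * g.fn from funext (fn_mul f g),
      fderivWithin_mul (uniqueDiffOn_slab p hp) (f.differentiableOn_fn p hp)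
        (g.differentiableOn_fn p hp)]
    simp only [add_apply, smul_apply, smul_eq_mul]
    ring

theorem dir_star (w : ℝ × E2) (f : SmoothFn a U) : dir w (star f) = star (dir w f) :=
  ext_fn fun p hp => by
    rw [fn_star, fn_dir _ _ hp, fn_dir _ _ hp,
      show (star f).fn = fun p => conj (f.fn p) from funext (fn_star f)]
    have := (Complex.conjCLE.toContinuousLinearMap.hasFDerivAt.comp_hasFDerivWithinAt p
      (f.differentiableOn_fn p hp).hasFDerivWithinAt).fderivWithin (uniqueDiffOn_slab p hp)
    exact congrArg (fun L => L w) this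

/-- Symmetry of the second derivative holds up to the boundary because every point of the slab is a
limit of interior points. -/
theorem dir_comm (w w' : ℝ × E2) (f : SmoothFn a U) : dir w (dir w' f) = dir w' (dir w f) := by
  have key : ∀ w w' : ℝ × E2, ∀ p ∈ slab a U, (dir w (dir w' f)).fn p
      = fderivWithin ℝ (fderivWithin ℝ f.fn (slab a U)) (slab a U) p w w' := by
    intro w w' p hp
    have hd : DifferentiableWithinAt ℝ (fderivWithin ℝ f.fn (slab a U)) (slab a U) p :=
      f.contDiffOn_fderivWithin_fn.differentiableOn (by simp) p hp
    rw [fn_dir _ _ hp, fderivWithin_congr (fun q hq => fn_dir w' f hq) (fn_dir w' f hp),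
      (hd.hasFDerivWithinAt.clm_apply (hasFDerivWithinAt_const w' p _)).fderivWithin
        (uniqueDiffOn_slab p hp)]
    simp
  refine ext_fn fun p hp => ?_
  rw [key w w' p hp, key w' w p hp]
  exact ((f.contDiffOn_fn p hp).isSymmSndFDerivWithinAt
    (by simp only [minSmoothness_of_isRCLikeNormedField]; exact WithTop.coe_le_coe.2 le_top)
    uniqueDiffOn_slab
    (mem_closure_interior_slab hp) hp).eq _ _

/-- Pull-back along a smooth map between slabs. -/
def comp {a' : Ioi (0 : ℝ)} {U' : Opens E2} (Θ : ℝ × E2 → ℝ × E2)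
    (hΘ : ContDiffOn ℝ ∞ Θ (slab a' U')) (hm : MapsTo Θ (slab a' U') (slab a U)) :
    SmoothFn a U →+* SmoothFn a' U' where
  toFun f := mk (fun p => f.fn (Θ p)) (f.contDiffOn_fn.comp hΘ hm)
  map_zero' := ext_fn fun p hp => by rw [fn_mk _ hp, fn_zero, fn_zero]
  map_one' := ext_fn fun p hp => by rw [fn_mk _ hp, fn_one (hm hp), fn_one hp]
  map_add' f g := ext_fn fun p hp => by
    rw [fn_add, fn_mk _ hp, fn_mk _ hp, fn_mk _ hp, fn_add]
  map_mul' f g := ext_fn fun p hp => by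
    rw [fn_mul, fn_mk _ hp, fn_mk _ hp, fn_mk _ hp, fn_mul]

section comp

variable {a' : Ioi (0 : ℝ)} {U' : Opens E2} {Θ : ℝ × E2 → ℝ × E2}
  {hΘ : ContDiffOn ℝ ∞ Θ (slab a' U')} {hm : MapsTo Θ (slab a' U') (slab a U)}

theorem fn_comp (f : SmoothFn a U) {p : ℝ × E2} (hp : p ∈ slab a' U') :
    (comp Θ hΘ hm f).fn p = f.fn (Θ p) := fn_mk _ hp

theorem comp_star (f : SmoothFn a U) : comp Θ hΘ hm (star f) = star (comp Θ hΘ hm f) :=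
  ext_fn fun p hp => by rw [fn_star, fn_comp _ hp, fn_comp _ hp, fn_star]

/-- The chain rule up to the boundary. It serves evaluation at `v = 0`, changes of coordinates and
restriction to smaller slabs alike. -/
theorem fn_dir_comp (f : SmoothFn a U) (w : ℝ × E2) {L : ℝ × E2 →L[ℝ] ℝ × E2} {p : ℝ × E2}
    (hp : p ∈ slab a' U') (hL : HasFDerivWithinAt Θ L (slab a' U') p) :
    (dir w (comp Θ hΘ hm f)).fn p = (dir (L w) f).fn (Θ p) := by
  have h := (((f.differentiableOn_fn _ (hm hp)).hasFDerivWithinAt).comp p hL hm).fderivWithin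
    (uniqueDiffOn_slab p hp)
  rw [fn_dir _ _ hp, fn_dir _ _ (hm hp),
    fderivWithin_congr (fun q hq => fn_comp f hq) (fn_comp f hp)]
  exact congrArg (fun L => L w) h

end comp

theorem hasDerivWithinAt_fn (f : SmoothFn a U) {t : ℝ} (ht : t ∈ Icc 0 (a : ℝ)) {x : E2}
    (hx : x ∈ U) : HasDerivWithinAt (fun s => f.fn (s, x)) ((dir (1, 0) f).fn (t, x))
      (Icc 0 (a : ℝ)) t := by
  have hp : (t, x) ∈ slab a U := ⟨ht, hx⟩
  rw [fn_dir _ _ hp]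
  have h2 : HasDerivWithinAt (fun s : ℝ => (s, x)) ((1 : ℝ), (0 : E2)) (Icc 0 (a : ℝ)) t :=
    ((hasDerivAt_id t).prodMk (hasDerivAt_const t x)).hasDerivWithinAt
  have hm : MapsTo (fun s : ℝ => (s, x)) (Icc 0 (a : ℝ)) (slab a U) := fun s hs => ⟨hs, hx⟩
  exact (f.differentiableOn_fn _ hp).hasFDerivWithinAt.comp_hasDerivWithinAt t h2 hm

theorem hasFDerivAt_fn (f : SmoothFn a U) {t : ℝ} (ht : t ∈ Icc 0 (a : ℝ)) {x : E2}
    (hx : x ∈ U) : HasFDerivAt (fun x => f.fn (t, x))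
      ((fderivWithin ℝ f.fn (slab a U) (t, x)).comp (ContinuousLinearMap.inr ℝ ℝ E2)) x :=
  hasFDerivAt_slice U.2 f.differentiableOn_fn ht hx

theorem pd_fn (f : SmoothFn a U) (A : Fin 2) {t : ℝ} (ht : t ∈ Icc 0 (a : ℝ)) {x : E2}
    (hx : x ∈ U) : pd A (fun x => f.fn (t, x)) x
      = (dir (0, EuclideanSpace.single A 1) f).fn (t, x) := by
  rw [pd, (f.hasFDerivAt_fn ht hx).fderiv, fn_dir _ _ (⟨ht, hx⟩ : (t, x) ∈ slab a U)]
  rfl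

/-- The linear map `y ↦ c y + d ȳ` on `ℂⁿ`. -/
def linMap {n : ℕ} (c d : Fin n → Fin n → ℂ) : (Fin n → ℂ) →L[ℝ] (Fin n → ℂ) :=
  LinearMap.toContinuousLinearMap
    { toFun := fun y i => ∑ j, (c i j * y j + d i j * conj (y j))
      map_add' := fun y y' => by
        funext i
        simp only [Pi.add_apply, map_add, ← Finset.sum_add_distrib]
        exact Finset.sum_congr rfl fun j _ => by ring
      map_smul' := fun r y => by
        funext i
        simp only [Pi.smul_apply, Complex.real_smul, map_mul, Complex.conj_ofReal, RingHom.id_apply,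
          Finset.mul_sum]
        exact Finset.sum_congr rfl fun j _ => by ring }

theorem linMap_apply {n : ℕ} (c d : Fin n → Fin n → ℂ) (y : Fin n → ℂ) (i : Fin n) :
    linMap c d y i = ∑ j, (c i j * y j + d i j * conj (y j)) := rfl

theorem contDiffOn_linMap {n : ℕ} (c d : Fin n → Fin n → SmoothFn a U) :
    ContDiffOn ℝ ∞ (fun p => linMap (fun i j => (c i j).fn p) (fun i j => (d i j).fn p))
      (slab a U) := by
  rw [contDiffOn_clm_apply]
  intro y
  rw [contDiffOn_pi]
  intro i
  simp only [linMap_apply]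
  exact ContDiffOn.sum fun j _ => (((c i j).contDiffOn_fn).mul contDiffOn_const).add
    (((d i j).contDiffOn_fn).mul contDiffOn_const)

theorem fn_sum {ι : Type*} (s : Finset ι) (f : ι → SmoothFn a U) (p : ℝ × E2) :
    (∑ i ∈ s, f i).fn p = ∑ i ∈ s, (f i).fn p := by
  classical
  induction s using Finset.induction_on with
  | empty => simp [fn_zero]
  | insert i s hi ih => rw [Finset.sum_insert hi, Finset.sum_insert hi, fn_add, ih]

/-- The map `(v, x) ↦ (0, x)`. -/
theorem mapsTo_initial (a a' : Ioi (0 : ℝ)) (U : Opens E2) :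
    MapsTo (fun p : ℝ × E2 => ((0 : ℝ), p.2)) (slab a' U) (slab a U) :=
  fun _ hp => ⟨⟨le_rfl, le_of_lt a.2⟩, hp.2⟩

/-- Restriction to `v = 0`, extended independently of `v`. -/
def initial (a a' : Ioi (0 : ℝ)) (U : Opens E2) : SmoothFn a U →+* SmoothFn a' U :=
  comp (fun p => (0, p.2)) (contDiff_const.prodMk contDiff_snd).contDiffOn (mapsTo_initial a a' U)

theorem fn_initial {a' : Ioi (0 : ℝ)} (f : SmoothFn a U) {p : ℝ × E2} (hp : p ∈ slab a' U) :
    (initial a a' U f).fn p = f.fn (0, p.2) := fn_comp f hp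

theorem fn_dir_initial {a' : Ioi (0 : ℝ)} (f : SmoothFn a U) (w : ℝ × E2) {p : ℝ × E2}
    (hp : p ∈ slab a' U) : (dir w (initial a a' U f)).fn p = (dir (0, w.2) f).fn (0, p.2) :=
  fn_dir_comp f w hp (L := (0 : ℝ × E2 →L[ℝ] ℝ).prod (.snd ℝ ℝ E2))
    (((hasFDerivAt_const (0 : ℝ) p).prodMk hasFDerivAt_snd).hasFDerivWithinAt)

theorem zero_mem_slab {p : ℝ × E2} (hp : p ∈ slab a U) : ((0 : ℝ), p.2) ∈ slab a U :=
  mapsTo_initial a a U hp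

/-- Transport equations involve conjugates and are only real-linear, so they are solved as real
linear equations in `ℂⁿ` with `x` as parameter. Smooth dependence on `x` puts the solution back into
the ring. -/
theorem exists_linear_smooth (n : ℕ) (c d : Fin n → Fin n → SmoothFn a U)
    (b y₀ : Fin n → SmoothFn a U) : ∃ y : Fin n → SmoothFn a U,
      (∀ i, dir (1, 0) (y i) = ∑ j, (c i j * y j + d i j * star (y j)) + b i) ∧
        ∀ i, initial a a U (y i) = initial a a U (y₀ i) := by
  have hA := contDiffOn_linMap c d
  have hb : ContDiffOn ℝ ∞ (fun p i => (b i).fn p) (slab a U) :=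
    contDiffOn_pi.2 fun i => (b i).contDiffOn_fn
  have hy₀ : ContDiffOn ℝ ∞ (fun x i => (y₀ i).fn (0, x)) (U : Set E2) :=
    contDiffOn_pi.2 fun i => (y₀ i).contDiffOn_fn.comp
      (contDiff_const.prodMk contDiff_id).contDiffOn fun x hx => ⟨⟨le_rfl, le_of_lt a.2⟩, hx⟩
  obtain ⟨y, hy, -⟩ := exists_isLinearSolution (a := (a : ℝ)) (U := (U : Set E2)) hA.continuousOn
    hb.continuousOn hy₀.continuousOn
  have hyc := hy.contDiffOn a.2 U.isOpen hA hb hy₀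
  have hyi : ∀ i, ContDiffOn ℝ ∞ (fun p => y p i) (slab a U) := contDiffOn_pi.1 hyc
  refine ⟨fun i => mk _ (hyi i), fun i => ext_fn fun p hp => ?_, fun i => ext_fn fun p hp => ?_⟩
  · obtain ⟨t, x⟩ := p
    have h1 := hasDerivWithinAt_fn (mk _ (hyi i)) hp.1 hp.2
    have h2 := (hasDerivWithinAt_pi.1 (hy.deriv x hp.2 t hp.1) i).congr
      (f₁ := fun s => (mk _ (hyi i)).fn (s, x)) (fun s hs => fn_mk (hyi i) ⟨hs,
      hp.2⟩) (fn_mk (hyi i) hp)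
    -- The derivative within the interval is unique, so the directional derivative in the ring is
    -- the one supplied by the equation.
    have h3 := (uniqueDiffOn_Icc (show (0 : ℝ) < a from a.2) t hp.1).eq_deriv _ h1 h2
    rw [h3, fn_add, fn_sum, Pi.add_apply, linMap_apply]
    simp only [fn_add, fn_mul, fn_star, fn_mk _ hp]
  · rw [fn_initial _ hp, fn_initial _ hp, fn_mk _ (zero_mem_slab hp), hy.initial _ hp.2]

/-- For each fixed `x` this is uniqueness for an ordinary differential equation. -/
theorem eq_zero_of_linear_smooth (n : ℕ) (c d : Fin n → Fin n → SmoothFn a U)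
    (y : Fin n → SmoothFn a U)
    (hy : ∀ i, dir (1, 0) (y i) = ∑ j, (c i j * y j + d i j * star (y j)))
    (h0 : ∀ i, initial a a U (y i) = 0) (i : Fin n) : y i = 0 := by
  refine ext_fn fun p hp => ?_
  obtain ⟨t, x⟩ := p
  have hA := continuousOn_slice (x := x) (contDiffOn_linMap c d).continuousOn hp.2
  have := eq_zero_of_linear_ode (y := fun s i => (y i).fn (s, x)) hA (fun s hs => ?_) ?_ t hp.1
  · rw [fn_zero]
    exact congrFun this i
  · rw [hasDerivWithinAt_pi]
    intro i
    refine (hasDerivWithinAt_fn (y i) hs hp.2).congr_deriv ?_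
    rw [hy, fn_sum, linMap_apply]
    simp only [fn_add, fn_mul, fn_star]
  · funext i
    have := congrArg (fun f => fn f (t, x)) (h0 i)
    simp only [fn_initial _ hp, fn_zero] at this
    exact this

/-- The bridge between algebra and analysis: every identity and solvability statement above now
applies to smooth functions on the closed slab. -/
instance : TransportRing (SmoothFn a U) where
  D := dir (1, 0)
  par A := dir (0, EuclideanSpace.single A 1)
  ev := initial a a U
  half := mk (fun _ => 1 / 2) contDiffOn_const
  two_mul_half := ext_fn fun p hp => by
    rw [fn_mul, fn_mk _ hp, fn_one hp, fn_ofNat 2 hp]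
    norm_num
  D_mul := dir_mul _
  par_mul _ := dir_mul _
  D_star := dir_star _
  par_star _ := dir_star _
  ev_star := comp_star
  D_par _ := dir_comm _ _
  par_comm _ _ := dir_comm _ _
  ev_par A f := ext_fn fun p hp => by rw [fn_initial _ hp, fn_dir_initial _ _ hp]
  ev_ev f := ext_fn fun p hp => by
    rw [fn_initial _ hp, fn_initial _ (zero_mem_slab hp), fn_initial _ hp]
  D_ev f := ext_fn fun p hp => by
    rw [fn_dir_initial _ _ hp, fn_zero, fn_dir _ _ (zero_mem_slab hp)]
    exact map_zero _
  exists_linear := exists_linear_smooth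
  eq_zero_of_linear := eq_zero_of_linear_smooth

theorem fn_half {p : ℝ × E2} (hp : p ∈ slab a U) : (half : SmoothFn a U).fn p = 1 / 2 :=
  fn_mk _ hp

/-- A function without zeros is invertible. -/
theorem exists_inverse {f : SmoothFn a U} (h : ∀ p ∈ slab a U, f.fn p ≠ 0) : ∃ e, f * e = 1 :=
  ⟨mk (fun p => (f.fn p)⁻¹) (f.contDiffOn_fn.inv h), ext_fn fun p hp => by
    rw [fn_mul, fn_mk _ hp, fn_one hp, mul_inv_cancel₀ (h p hp)]⟩

end SmoothFn
end StewartGauge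

namespace StewartGauge
open TransportRing

/-! ### The NP equations in the ring of functions on a null hypersurface -/

section RingEquations

variable {R : Type*} [CommRing R] [StarRing R] [TransportRing R]

/-- The unknowns which are governed by transport equations. -/
@[simps]
def coreOf (L : Comp → R) : Core R where
  P A := L (.P A)
  rho := L .rho
  sigma := L .sigma
  alpha := L .alpha
  beta := L .beta
  mu := L .mu
  lam := L .lam
  eps := L .eps
  Psi0 := L (.Psi 0)
  Psi1 := L (.Psi 1)
  Psi2 := L (.Psi 2)
  Psi3 := L (.Psi 3)
  Psi4 := L (.Psi 4)

/-- The NP equations and gauge conditions on `𝒩⋆`. -/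
structure OutEqs (L : Comp → R) : Prop where
  transport : (coreOf L).Transport
  sphere : (coreOf L).Sphere
  real : (coreOf L).IsReal
  pi : L .pi = L .alpha + star (L .beta)
  C : ∀ A, L (.C A) = 0
  Q : D (L .Q) = -2 * L .eps * L .Q
  Q_tau : (coreOf L).dl (L .Q) = (L .tau - star (L .pi)) * L .Q
  Q_real : star (L .Q) = L .Q
  Q_atZero : ev (L .Q) = 1

/-- The NP equations and gauge conditions on `𝒩⋆'`. -/
structure InEqs (L : Comp → R) : Prop where
  transport : ((coreOf L).prime 0).Transport
  sphere : (coreOf L).Sphere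
  rho_real : star (L .rho) = L .rho
  mu_real : star (L .mu) = L .mu
  pi : L .pi = L .alpha + star (L .beta)
  tau : L .tau = star (L .pi)
  Q : L .Q = 1
  C : ∀ A, D (L (.C A)) = -2 * L .pi * L (.P A) - 2 * star (L .pi) * star (L (.P A))
  C_atZero : ∀ A, ev (L (.C A)) = 0
  eps : D (L .eps) = -L (.Psi 2) - 2 * L .beta * L .pi - 2 * L .alpha * star (L .pi)
    - L .pi * star (L .pi)

variable {L : Comp → R} {φ : R →+* ℂ}

/-- The full constraints differ from the reduced ones only by multiples of `μ̄ - μ` and `ρ̄ - ρ`. -/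
theorem sphereEqs_of_sphere (h : (coreOf L).Sphere) (hρ : star (L .rho) = L .rho)
    (hμ : star (L .mu) = L .mu) (hQ : (coreOf L).dl (L .Q) = (L .tau - star (L .pi)) * L .Q)
    (hφ : ∀ a, φ (star a) = conj (φ a)) :
    SphereEqs (fun c => φ (L c)) (fun c => φ ((coreOf L).dl (L c)))
      (fun c => φ ((coreOf L).db (L c))) where
  frame_P A := by
    have := congrArg φ (h.frame A)
    simp only [map_add, map_sub, map_mul, map_neg, hφ, map_ofNat, coreOf] at this ⊢
    exact this
  frame_Q := by
    have := congrArg φ hQ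
    simp only [map_add, map_sub, map_mul, map_neg, hφ, map_ofNat] at this ⊢
    exact this
  ricci_Psi2 := by
    have hm := congrArg φ hμ
    have := congrArg φ h.ricci_two
    simp only [map_add, map_sub, map_mul, map_neg, hφ, map_ofNat, coreOf] at this hm ⊢
    linear_combination this - φ (L .eps) * hm
  ricci_Psi3 := by
    have hm := congrArg φ hμ
    have := congrArg φ h.ricci_three
    simp only [map_add, map_sub, map_mul, map_neg, hφ, map_ofNat, coreOf] at this hm ⊢
    linear_combination this - φ (L .pi) * hm
  ricci_Psi1 := by
    have hm := congrArg φ hρ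
    have := congrArg φ h.ricci_one
    simp only [map_add, map_sub, map_mul, map_neg, hφ, map_ofNat, coreOf] at this hm ⊢
    linear_combination this - φ (L .tau) * hm

theorem OutEqs.sphereEqs (h : OutEqs L) (hφ : ∀ a, φ (star a) = conj (φ a)) :
    SphereEqs (fun c => φ (L c)) (fun c => φ ((coreOf L).dl (L c)))
      (fun c => φ ((coreOf L).db (L c))) :=
  sphereEqs_of_sphere h.sphere h.real.rho h.real.mu h.Q_tau hφ

theorem InEqs.sphereEqs (h : InEqs L) (hφ : ∀ a, φ (star a) = conj (φ a)) :
    SphereEqs (fun c => φ (L c)) (fun c => φ ((coreOf L).dl (L c)))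
      (fun c => φ ((coreOf L).db (L c))) :=
  sphereEqs_of_sphere h.sphere h.rho_real h.mu_real
    (by rw [h.Q, h.tau, sub_self, zero_mul]; exact along_one _) hφ

theorem OutEqs.D_pi (h : OutEqs L) : D (L .pi) = 2 * (coreOf L).db (L .eps) + star (L (.Psi 1))
    + 2 * L .pi * L .rho + 2 * star (L .pi) * star (L .sigma) := by
  have ha : D (L .alpha) = _ := h.transport.alpha
  have hb : D (L .beta) = _ := h.transport.beta
  have hr : star (L .rho) = L .rho := h.real.rho
  have he : star (L .eps) = L .eps := h.real.eps
  rw [h.pi, map_add, D_star, ha, hb]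
  simp only [star_add, star_mul', Core.pi, star_star, ← Core.db_star]
  simp only [coreOf, hr, he]
  ring

/-- The equation for `τ` is not independent: it follows by applying `D` to `δQ = (τ - π̄)Q` and
commuting `D` with `δ`. The factor `Q` stays because it is not yet known to be invertible. -/
theorem OutEqs.D_tau (h : OutEqs L) : D (L .tau) * L .Q = (L (.Psi 1) + star (L .pi) * L .rho
    + L .pi * L .sigma + L .rho * L .tau + L .sigma * star (L .tau)) * L .Q := by
  have hr : star (L .rho) = L .rho := h.real.rho
  have he : star (L .eps) = L .eps := h.real.eps
  have hdb : (coreOf L).db (L .Q) = (star (L .tau) - L .pi) * L .Q := by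
    rw [← Core.star_dl_of_real h.Q_real, h.Q_tau, star_mul', star_sub, star_star, h.Q_real]
  have hDQ : (coreOf L).dl (D (L .Q)) = -2 * ((coreOf L).dl (L .eps) * L .Q
      + L .eps * (coreOf L).dl (L .Q)) := by
    rw [h.Q, neg_mul, neg_mul, map_neg, mul_assoc, Core.dl_mul, Core.dl_ofNat, Core.dl_mul]
    ring
  have hpi : star (D (L .pi)) = 2 * (coreOf L).dl (L .eps) + L (.Psi 1)
      + 2 * star (L .pi) * L .rho + 2 * L .pi * L .sigma := by
    rw [h.D_pi]
    simp only [star_add, star_mul', star_star, star_ofNat, ← Core.dl_star, hr, he]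
  have h1 := congrArg D h.Q_tau
  rw [Core.D_dl h.transport.P, hDQ, hdb, D_mul, map_sub, D_star, hpi, h.Q, h.Q_tau] at h1
  simp only [show (coreOf L).rho = L .rho from rfl, show (coreOf L).sigma = L .sigma from rfl] at h1
  linear_combination -h1

theorem Core.pi_coreOf (h : L .pi = L .alpha + star (L .beta)) : (coreOf L).pi = L .pi := h.symm

/-- The reality of `ε`, `ρ`, `μ` and the definition of `π` account for all differences between the
two forms, except in the equation for `τ`, which is derived above. -/
theorem OutEqs.outgoingEqs (h : OutEqs L) (hφ : ∀ a, φ (star a) = conj (φ a))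
    (hQ : φ (L .Q) ≠ 0) :
    OutgoingEqs (fun c => φ (L c)) (fun c => φ (D (L c))) (fun c => φ ((coreOf L).dl (L c)))
      (fun c => φ ((coreOf L).db (L c))) := by
  have ht := h.transport
  have he := congrArg φ h.real.eps
  have hr := congrArg φ h.real.rho
  have hm := congrArg φ h.real.mu
  have hp := congrArg φ h.pi
  have hp' := congrArg φ (congrArg star h.pi)
  simp only [map_add, map_sub, map_mul, map_neg, hφ, map_ofNat, coreOf, star_add, star_star]
    at he hr hm hp hp'
  refine ⟨fun A => ?_, ?_, ?_, ?_, ?_, ?_, ?_, ?_, ?_, ?_, ?_, ?_, ?_⟩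
  · have := congrArg φ (ht.P A)
    rw [h.C, map_zero, map_zero]
    simp only [map_add, map_sub, map_mul, map_neg, hφ, map_ofNat, coreOf] at this ⊢
    linear_combination this + φ (L (.P A)) * he
  · have := congrArg φ h.Q
    simp only [map_add, map_sub, map_mul, map_neg, hφ, map_ofNat, coreOf] at this ⊢
    linear_combination this + φ (L .Q) * he
  · have := congrArg φ h.D_tau
    simp only [map_add, map_sub, map_mul, map_neg, hφ, map_ofNat, coreOf] at this ⊢
    refine mul_right_cancel₀ hQ ?_
    linear_combination -this - φ (L .tau) * φ (L .Q) * he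
  · have := congrArg φ ht.beta
    simp only [Core.pi_coreOf h.pi] at this
    simp only [map_add, map_sub, map_mul, map_neg, hφ, map_ofNat, coreOf_P,
      coreOf_rho, coreOf_sigma, coreOf_alpha, coreOf_beta, coreOf_mu, coreOf_lam,
      coreOf_eps, coreOf_Psi0, coreOf_Psi1, coreOf_Psi2, coreOf_Psi3, coreOf_Psi4] at this ⊢
    linear_combination -this - φ (L .beta) * he + φ (L .eps) * hp' + φ (L .beta) * hr
  · have := congrArg φ ht.sigma
    simp only [map_add, map_sub, map_mul, map_neg, hφ, map_ofNat, coreOf_P,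
      coreOf_rho, coreOf_sigma, coreOf_alpha, coreOf_beta, coreOf_mu, coreOf_lam,
      coreOf_eps, coreOf_Psi0, coreOf_Psi1, coreOf_Psi2, coreOf_Psi3, coreOf_Psi4] at this ⊢
    linear_combination -this - φ (L .sigma) * he + φ (L .sigma) * hr
  · have := congrArg φ ht.mu
    simp only [Core.pi_coreOf h.pi] at this
    simp only [map_add, map_sub, map_mul, map_neg, hφ, map_ofNat, coreOf_P,
      coreOf_rho, coreOf_sigma, coreOf_alpha, coreOf_beta, coreOf_mu, coreOf_lam,
      coreOf_eps, coreOf_Psi0, coreOf_Psi1, coreOf_Psi2, coreOf_Psi3, coreOf_Psi4] at this ⊢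
    linear_combination -this - φ (L .mu) * he + φ (L .mu) * hr
  · have := congrArg φ ht.alpha
    simp only [Core.pi_coreOf h.pi] at this
    simp only [map_add, map_sub, map_mul, map_neg, hφ, map_ofNat, coreOf_P,
      coreOf_rho, coreOf_sigma, coreOf_alpha, coreOf_beta, coreOf_mu, coreOf_lam,
      coreOf_eps, coreOf_Psi0, coreOf_Psi1, coreOf_Psi2, coreOf_Psi3, coreOf_Psi4] at this ⊢
    linear_combination -this + φ (L .alpha) * he + φ (L .eps) * hp
  · have := congrArg φ ht.rho
    simp only [map_add, map_sub, map_mul, map_neg, hφ, map_ofNat, coreOf_P,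
      coreOf_rho, coreOf_sigma, coreOf_alpha, coreOf_beta, coreOf_mu, coreOf_lam,
      coreOf_eps, coreOf_Psi0, coreOf_Psi1, coreOf_Psi2, coreOf_Psi3, coreOf_Psi4] at this ⊢
    linear_combination -this + φ (L .rho) * he
  · have := congrArg φ ht.lam
    simp only [Core.pi_coreOf h.pi] at this
    simp only [map_add, map_sub, map_mul, map_neg, hφ, map_ofNat, coreOf_P,
      coreOf_rho, coreOf_sigma, coreOf_alpha, coreOf_beta, coreOf_mu, coreOf_lam,
      coreOf_eps, coreOf_Psi0, coreOf_Psi1, coreOf_Psi2, coreOf_Psi3, coreOf_Psi4] at this ⊢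
    linear_combination -this + φ (L .lam) * he
  · have := congrArg φ ht.Psi1
    simp only [Core.pi_coreOf h.pi] at this
    simp only [map_add, map_sub, map_mul, map_neg, hφ, map_ofNat, coreOf_P,
      coreOf_rho, coreOf_sigma, coreOf_alpha, coreOf_beta, coreOf_mu, coreOf_lam,
      coreOf_eps, coreOf_Psi0, coreOf_Psi1, coreOf_Psi2, coreOf_Psi3, coreOf_Psi4] at this ⊢
    linear_combination -this
  · have := congrArg φ ht.Psi2
    simp only [Core.pi_coreOf h.pi] at this
    simp only [map_add, map_sub, map_mul, map_neg, hφ, map_ofNat, coreOf_P,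
      coreOf_rho, coreOf_sigma, coreOf_alpha, coreOf_beta, coreOf_mu, coreOf_lam,
      coreOf_eps, coreOf_Psi0, coreOf_Psi1, coreOf_Psi2, coreOf_Psi3, coreOf_Psi4] at this ⊢
    linear_combination this
  · have := congrArg φ ht.Psi3
    simp only [Core.pi_coreOf h.pi] at this
    simp only [map_add, map_sub, map_mul, map_neg, hφ, map_ofNat, coreOf_P,
      coreOf_rho, coreOf_sigma, coreOf_alpha, coreOf_beta, coreOf_mu, coreOf_lam,
      coreOf_eps, coreOf_Psi0, coreOf_Psi1, coreOf_Psi2, coreOf_Psi3, coreOf_Psi4] at this ⊢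
    linear_combination this
  · have := congrArg φ ht.Psi4
    simp only [Core.pi_coreOf h.pi] at this
    simp only [map_add, map_sub, map_mul, map_neg, hφ, map_ofNat, coreOf_P,
      coreOf_rho, coreOf_sigma, coreOf_alpha, coreOf_beta, coreOf_mu, coreOf_lam,
      coreOf_eps, coreOf_Psi0, coreOf_Psi1, coreOf_Psi2, coreOf_Psi3, coreOf_Psi4] at this ⊢
    linear_combination -this

/-- With `Q = 1` and `τ = π̄`, most equations with `Δ` are the transport equations of the primed
unknowns. Those for `C` and `ε` are separate, and the one for `π` is a consequence. -/
theorem InEqs.incomingEqs (h : InEqs L) (hφ : ∀ a, φ (star a) = conj (φ a)) :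
    IncomingEqs (fun c => φ (L c)) (fun c => φ (D (L c))) (fun c => φ ((coreOf L).dl (L c)))
      (fun c => φ ((coreOf L).db (L c))) := by
  have ht := h.transport
  have hr := congrArg φ h.rho_real
  have hm := congrArg φ h.mu_real
  have hp := congrArg φ h.pi
  have hp' := congrArg φ (congrArg star h.pi)
  have htau := congrArg φ h.tau
  have htau' := congrArg φ (congrArg star h.tau)
  -- In the exchanged system the role of `π` is played by `-τ`.
  have hprime : ((coreOf L).prime 0).pi = -L .tau := by
    rw [h.tau, h.pi]; simp [Core.pi, Core.prime]
  simp only [map_add, map_sub, map_mul, map_neg, hφ, map_ofNat, star_add, star_star]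
    at hr hm hp hp' htau htau'
  have halpha := congrArg φ ht.beta
  have hbeta := congrArg φ ht.alpha
  have hsigma := congrArg φ ht.lam
  have hlam := congrArg φ ht.sigma
  have hmu := congrArg φ ht.rho
  have hrho := congrArg φ ht.mu
  have hPsi0 := congrArg φ ht.Psi4
  have hPsi1 := congrArg φ ht.Psi3
  have hPsi2 := congrArg φ ht.Psi2
  have hPsi3 := congrArg φ ht.Psi1
  have hbeta' := congrArg φ (congrArg star ht.alpha)
  simp only [Core.prime_dl, Core.prime_db, hprime]
    at halpha hbeta hsigma hrho hPsi0 hPsi1 hPsi2 hPsi3 hbeta'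
  simp only [Core.prime, map_add, map_sub, map_mul, map_neg, hφ, map_ofNat, map_zero, star_add,
    star_mul', star_zero,
    star_neg, star_star, Complex.conj_conj, coreOf_P, coreOf_rho, coreOf_sigma, coreOf_alpha,
    coreOf_beta, coreOf_mu, coreOf_lam,
      coreOf_eps, coreOf_Psi0, coreOf_Psi1, coreOf_Psi2, coreOf_Psi3, coreOf_Psi4]
    at halpha hbeta hsigma hlam hmu hrho hPsi0 hPsi1 hPsi2 hPsi3 hbeta'
  refine ⟨fun A => ?_, fun A => ?_, ?_, ?_, ?_, ?_, ?_, ?_, ?_, ?_, ?_, ?_, ?_, ?_⟩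
  · have := congrArg φ (h.C A)
    simp only [map_add, map_sub, map_mul, map_neg, hφ, map_ofNat] at this ⊢
    linear_combination this + φ (L (.P A)) * htau' + conj (φ (L (.P A))) * htau
  · have := congrArg φ (congrArg star (ht.P A))
    simp only [Core.prime, ← D_star, star_star, star_add, star_mul', star_neg, map_add, map_mul,
      map_neg, hφ, coreOf_P, coreOf_mu, coreOf_lam] at this ⊢
    linear_combination this - φ (L (.P A)) * hm
  · have := congrArg φ h.eps
    simp only [map_add, map_sub, map_mul, map_neg, hφ, map_ofNat] at this ⊢
    linear_combination this + φ (L .beta) * htau' + (φ (L .pi) + φ (L .alpha)) * htau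
  -- As `π = α + β̄`, its equation is the sum of the one for `α` and the conjugate of the one for
  -- `β`.
  · have := congrArg φ (congrArg D h.pi)
    simp only [map_add, map_sub, map_mul, map_neg, hφ, map_ofNat, D_star] at this ⊢
    linear_combination this - halpha - hbeta' + φ (L .mu) * hp + φ (L .lam) * hp'
      - (conj (φ (L .beta)) + conj (φ (L .tau))) * hm
  · linear_combination hbeta
  · linear_combination hmu
  · linear_combination hsigma
  · linear_combination halpha - φ (L .alpha) * hm
  · linear_combination hlam - φ (L .lam) * hm
  · linear_combination hrho - φ (L .rho) * hm
  · linear_combination hPsi0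
  · linear_combination hPsi1
  · linear_combination hPsi2
  · linear_combination hPsi3

/-! The converse: the equations hold in the ring if they hold at all the points. -/

variable {Φ : Set (R →+* ℂ)}

theorem sphere_of_sphereEqs (hΦ : ∀ φ ∈ Φ, ∀ a, φ (star a) = conj (φ a))
    (hinj : ∀ a b : R, (∀ φ ∈ Φ, φ a = φ b) → a = b) (hρ : star (L .rho) = L .rho)
    (hμ : star (L .mu) = L .mu)
    (hs : ∀ φ ∈ Φ, SphereEqs (fun c => φ (L c)) (fun c => φ ((coreOf L).dl (L c)))
      (fun c => φ ((coreOf L).db (L c)))) : (coreOf L).Sphere where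
  frame A := hinj _ _ fun φ hφ => by
    have := (hs φ hφ).frame_P A
    simp only [map_add, map_sub, map_mul, map_neg, hΦ φ hφ, map_ofNat, coreOf_P, coreOf_rho,
      coreOf_sigma, coreOf_alpha, coreOf_beta,
      coreOf_mu, coreOf_lam, coreOf_eps, coreOf_Psi0, coreOf_Psi1, coreOf_Psi2, coreOf_Psi3,
      coreOf_Psi4] at this ⊢
    exact this
  ricci_one := hinj _ _ fun φ hφ => by
    have hm := congrArg φ hρ
    have := (hs φ hφ).ricci_Psi1
    simp only [map_add, map_sub, map_mul, map_neg, hΦ φ hφ, map_ofNat, coreOf_P, coreOf_rho,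
      coreOf_sigma, coreOf_alpha, coreOf_beta,
      coreOf_mu, coreOf_lam, coreOf_eps, coreOf_Psi0, coreOf_Psi1, coreOf_Psi2, coreOf_Psi3,
      coreOf_Psi4] at this hm ⊢
    linear_combination this + φ (L .tau) * hm
  ricci_two := hinj _ _ fun φ hφ => by
    have hm := congrArg φ hμ
    have := (hs φ hφ).ricci_Psi2
    simp only [map_add, map_sub, map_mul, map_neg, hΦ φ hφ, map_ofNat, coreOf_P, coreOf_rho,
      coreOf_sigma, coreOf_alpha, coreOf_beta,
      coreOf_mu, coreOf_lam, coreOf_eps, coreOf_Psi0, coreOf_Psi1, coreOf_Psi2, coreOf_Psi3,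
      coreOf_Psi4] at this hm ⊢
    linear_combination this + φ (L .eps) * hm
  ricci_three := hinj _ _ fun φ hφ => by
    have hm := congrArg φ hμ
    have := (hs φ hφ).ricci_Psi3
    simp only [map_add, map_sub, map_mul, map_neg, hΦ φ hφ, map_ofNat, coreOf_P, coreOf_rho,
      coreOf_sigma, coreOf_alpha, coreOf_beta,
      coreOf_mu, coreOf_lam, coreOf_eps, coreOf_Psi0, coreOf_Psi1, coreOf_Psi2, coreOf_Psi3,
      coreOf_Psi4] at this hm ⊢
    linear_combination this + φ (L .pi) * hm

/-- The homomorphisms in `Φ` are point evaluations in the application; since they separate elements,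
pointwise equations lift to the ring. -/
theorem OutEqs.of_pointwise (hΦ : ∀ φ ∈ Φ, ∀ a, φ (star a) = conj (φ a))
    (hinj : ∀ a b : R, (∀ φ ∈ Φ, φ a = φ b) → a = b)
    (hg : ∀ φ ∈ Φ, PointGauge (fun c => φ (L c)))
    (ho : ∀ φ ∈ Φ, OutgoingEqs (fun c => φ (L c)) (fun c => φ (D (L c)))
      (fun c => φ ((coreOf L).dl (L c))) (fun c => φ ((coreOf L).db (L c))))
    (hs : ∀ φ ∈ Φ, SphereEqs (fun c => φ (L c)) (fun c => φ ((coreOf L).dl (L c)))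
      (fun c => φ ((coreOf L).db (L c))))
    (hC : ∀ A, L (.C A) = 0) (he : star (L .eps) = L .eps) (hQ : ev (L .Q) = 1) : OutEqs L := by
  have hρ : star (L .rho) = L .rho := hinj _ _ fun φ hφ => (hΦ φ hφ _).trans (hg φ hφ).rho_real
  have hμ : star (L .mu) = L .mu := hinj _ _ fun φ hφ => (hΦ φ hφ _).trans (hg φ hφ).mu_real
  have hπ : L .pi = L .alpha + star (L .beta) := hinj _ _ fun φ hφ => by
    rw [map_add, hΦ φ hφ]; exact (hg φ hφ).pi_eq
  have hreal : ∀ φ ∈ Φ, conj (φ (L .eps)) = φ (L .eps) ∧ conj (φ (L .rho)) = φ (L .rho) ∧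
      φ (L .pi) = φ (L .alpha) + conj (φ (L .beta)) ∧
      conj (φ (L .pi)) = conj (φ (L .alpha)) + φ (L .beta) := fun φ hφ => by
    have := (hg φ hφ).pi_eq
    refine ⟨(hΦ φ hφ _).symm.trans (congrArg φ he), (hg φ hφ).rho_real, this, ?_⟩
    rw [this, map_add, Complex.conj_conj]
  refine ⟨⟨⟨fun A => ?_, ?_, ?_⟩, ⟨?_, ?_, ?_⟩, ⟨?_, ?_, ?_⟩, ⟨?_, ?_⟩⟩,
    sphere_of_sphereEqs hΦ hinj hρ hμ hs, ⟨hρ, hμ, he⟩, hπ, hC, ?_, ?_,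
    hinj _ _ fun φ hφ => (hΦ φ hφ _).trans (hg φ hφ).Q_real, hQ⟩
  all_goals
    refine hinj _ _ fun φ hφ => ?_
    obtain ⟨he, hr, hp, hp'⟩ := hreal φ hφ
    replace ho := ho φ hφ
    replace hΦ := hΦ φ hφ
    simp only [Core.pi_coreOf hπ, map_add, map_sub, map_mul, map_neg, hΦ, map_ofNat, coreOf_P,
      coreOf_rho, coreOf_sigma, coreOf_alpha, coreOf_beta,
      coreOf_mu, coreOf_lam, coreOf_eps, coreOf_Psi0, coreOf_Psi1, coreOf_Psi2, coreOf_Psi3,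
      coreOf_Psi4]
  · have := ho.frame_P A
    rw [hC, map_zero, map_zero] at this
    linear_combination this - φ (L (.P A)) * he
  · linear_combination -ho.ricci_rho + φ (L .rho) * he
  · linear_combination -ho.ricci_sigma - φ (L .sigma) * he + φ (L .sigma) * hr
  · linear_combination -ho.ricci_alpha + φ (L .alpha) * he + φ (L .eps) * hp
  · linear_combination -ho.ricci_beta - φ (L .beta) * he + φ (L .eps) * hp' + φ (L .beta) * hr
  · linear_combination -ho.bianchi_Psi1
  · linear_combination -ho.ricci_mu - φ (L .mu) * he + φ (L .mu) * hr
  · linear_combination -ho.ricci_lam + φ (L .lam) * he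
  · linear_combination ho.bianchi_Psi2
  · linear_combination ho.bianchi_Psi3
  · linear_combination -ho.bianchi_Psi4
  · linear_combination ho.frame_Q - φ (L .Q) * he
  · exact (hs φ hφ).frame_Q

/-- The relation `τ = π̄` is not a gauge condition here: it is the constraint on `δQ` with `Q = 1`.
-/
theorem InEqs.of_pointwise (hΦ : ∀ φ ∈ Φ, ∀ a, φ (star a) = conj (φ a))
    (hinj : ∀ a b : R, (∀ φ ∈ Φ, φ a = φ b) → a = b)
    (hg : ∀ φ ∈ Φ, PointGauge (fun c => φ (L c)))
    (hi : ∀ φ ∈ Φ, IncomingEqs (fun c => φ (L c)) (fun c => φ (D (L c)))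
      (fun c => φ ((coreOf L).dl (L c))) (fun c => φ ((coreOf L).db (L c))))
    (hs : ∀ φ ∈ Φ, SphereEqs (fun c => φ (L c)) (fun c => φ ((coreOf L).dl (L c)))
      (fun c => φ ((coreOf L).db (L c))))
    (hQ : L .Q = 1) (hC : ∀ A, ev (L (.C A)) = 0) : InEqs L := by
  have hρ : star (L .rho) = L .rho := hinj _ _ fun φ hφ => (hΦ φ hφ _).trans (hg φ hφ).rho_real
  have hμ : star (L .mu) = L .mu := hinj _ _ fun φ hφ => (hΦ φ hφ _).trans (hg φ hφ).mu_real
  have hπ : L .pi = L .alpha + star (L .beta) := hinj _ _ fun φ hφ => by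
    rw [map_add, hΦ φ hφ]; exact (hg φ hφ).pi_eq
  have hτ : L .tau = star (L .pi) := hinj _ _ fun φ hφ => by
    have := (hs φ hφ).frame_Q
    rw [hQ, show (coreOf L).dl 1 = 0 from along_one _, map_zero, map_one] at this
    rw [hΦ φ hφ]
    linear_combination -this
  have hprime : ((coreOf L).prime 0).pi = -L .tau := by
    rw [hτ, hπ]; simp [Core.pi, Core.prime]
  have hreal : ∀ φ ∈ Φ, conj (φ (L .mu)) = φ (L .mu) ∧ φ (L .tau) = conj (φ (L .pi)) ∧
      conj (φ (L .tau)) = φ (L .pi) := fun φ hφ => by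
    have := (congrArg φ hτ).trans (hΦ φ hφ _)
    refine ⟨(hg φ hφ).mu_real, this, ?_⟩
    rw [this, Complex.conj_conj]
  refine ⟨⟨⟨fun A => ?_, ?_, ?_⟩, ⟨?_, ?_, ?_⟩, ⟨?_, ?_, ?_⟩, ⟨?_, ?_⟩⟩,
    sphere_of_sphereEqs hΦ hinj hρ hμ hs, hρ, hμ, hπ, hτ, hQ, fun A => ?_, hC, ?_⟩
  all_goals
    refine hinj _ _ fun φ hφ => ?_
    obtain ⟨hm, ht, ht'⟩ := hreal φ hφ
    replace hi := hi φ hφ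
    replace hΦ := hΦ φ hφ
    try simp only [Core.prime_dl, Core.prime_db, hprime]
    simp only [Core.prime, map_add, map_sub, map_mul, map_neg, hΦ, map_ofNat, map_zero,
      star_neg, star_star, D_star, coreOf_P, coreOf_rho, coreOf_sigma, coreOf_alpha, coreOf_beta,
      coreOf_mu, coreOf_lam, coreOf_eps, coreOf_Psi0, coreOf_Psi1, coreOf_Psi2, coreOf_Psi3,
      coreOf_Psi4]
  · have := congrArg conj (hi.frame_P A)
    simp only [map_sub, map_mul, map_neg, Complex.conj_conj] at this
    linear_combination this - conj (φ (L (.P A))) * hm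
  · linear_combination hi.ricci_mu
  · linear_combination hi.ricci_lam + φ (L .lam) * hm
  · linear_combination hi.ricci_beta
  · linear_combination hi.ricci_alpha + φ (L .alpha) * hm
  · linear_combination hi.bianchi_Psi3
  · linear_combination hi.ricci_rho + φ (L .rho) * hm
  · linear_combination hi.ricci_sigma
  · linear_combination hi.bianchi_Psi2
  · linear_combination hi.bianchi_Psi1
  · linear_combination hi.bianchi_Psi0
  · linear_combination hi.frame_C A - φ (L (.P A)) * ht' - conj (φ (L (.P A))) * ht
  · linear_combination hi.ricci_eps - φ (L .beta) * ht' - (φ (L .pi) + φ (L .alpha)) * ht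

end RingEquations
end StewartGauge

namespace StewartGauge
open TransportRing

/-! ### Change of coordinates and frame -/

section ChangeOfPatch

variable {R' R : Type*} [CommRing R'] [StarRing R'] [TransportRing R'] [CommRing R] [StarRing R]
  [TransportRing R]

/-- The pull-back of functions along a change of the angular coordinates, with its Jacobian matrix
`jac A B = ∂_B t^A`. -/
structure Pullback (R' R : Type*) [CommRing R] [StarRing R] [TransportRing R] [CommRing R']
    [StarRing R'] [TransportRing R'] where
  hom : R' →+* R
  jac : Fin 2 → Fin 2 → R
  hom_star : ∀ a, hom (star a) = star (hom a)
  hom_D : ∀ a, hom (D a) = D (hom a)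
  hom_ev : ∀ a, hom (ev a) = ev (hom a)
  par_hom : ∀ B a, par B (hom a) = jac 0 B * hom (par 0 a) + jac 1 B * hom (par 1 a)
  jac_real : ∀ A B, star (jac A B) = jac A B
  D_jac : ∀ A B, D (jac A B) = 0
  par_jac : ∀ A B B', par B' (jac A B) = par B (jac A B')

namespace Pullback

variable (T : Pullback R' R)

/-- The components of the image of a vector field. -/
def push (w : Fin 2 → R) (A : Fin 2) : R := T.jac A 0 * w 0 + T.jac A 1 * w 1

variable {T} {f' : Core R'} {f : Core R} {z : R}

theorem hom_along {p' : Fin 2 → R'} {p : Fin 2 → R} (h : ∀ A, T.hom (p' A) = T.push p A) (a : R') :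
    along p (T.hom a) = T.hom (along p' a) := by
  simp only [along_apply, map_add, map_mul, h, T.par_hom, push]
  ring

/-- The pulled back core, with the frame replaced by `P`. -/
def core (T : Pullback R' R) (f' : Core R') (P : Fin 2 → R) : Core R :=
  { f'.map T.hom with P := P }

section core

variable {P : Fin 2 → R}

theorem core_dl (hP : ∀ A, T.hom (f'.P A) = T.push P A) (a : R') :
    (T.core f' P).dl (T.hom a) = T.hom (f'.dl a) := hom_along hP a

theorem core_db (hP : ∀ A, T.hom (f'.P A) = T.push P A) (a : R') :
    (T.core f' P).db (T.hom a) = T.hom (f'.db a) :=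
  hom_along (fun A => by
    rw [T.hom_star, hP]
    simp only [push, star_add, star_mul', T.jac_real]
    rfl) a

/-- The scalar constraints pull back verbatim. The frame constraint is a vector equation: it pulls
back to the Jacobian applied to the defect, and the Jacobian is invertible. -/
theorem core_sphere (hP : ∀ A, T.hom (f'.P A) = T.push P A) (hs : f'.Sphere)
    {d : R} (hd : (T.jac 0 0 * T.jac 1 1 - T.jac 0 1 * T.jac 1 0) * d = 1) : (T.core f' P).Sphere
    where
  frame := by
    set X : Fin 2 → R := fun B => (T.core f' P).db (P B) - star ((T.core f' P).db (P B))
      - (((T.core f' P).alpha - star (T.core f' P).beta) * P B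
        - (star (T.core f' P).alpha - (T.core f' P).beta) * star (P B)) with hX
    have key : ∀ A, T.jac A 0 * X 0 + T.jac A 1 * X 1 = 0 := fun A => by
      have h := congrArg T.hom (hs.frame A)
      simp only [map_sub, map_mul, T.hom_star, ← core_db hP, hP, push] at h
      simp only [map_add, Core.db_mul, star_add, star_sub, star_mul', star_star, T.jac_real,
        ← Core.dl_star] at h
      simp only [hX, show (T.core f' P).alpha = T.hom f'.alpha from rfl,
        show (T.core f' P).beta = T.hom f'.beta from rfl, ← Core.dl_star]
      -- The derivatives of the Jacobian cancel by the symmetry of the second derivatives of the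
      -- coordinate change.
      have hj := T.par_jac A 1 0
      have h2 : (T.core f' P).db (T.jac A 0) * P 0 + (T.core f' P).db (T.jac A 1) * P 1
          = (T.core f' P).dl (T.jac A 0) * star (P 0)
            + (T.core f' P).dl (T.jac A 1) * star (P 1) := by
        simp only [Core.db, Core.dl, along_apply, show (T.core f' P).P = P from rfl]
        linear_combination (star (P 0) * P 1 - P 0 * star (P 1)) * hj
      linear_combination h - h2
    have h0 := key 0
    have h1 := key 1
    intro A
    rw [← sub_eq_zero]
    change X A = 0
    fin_cases A
    · simp only [Fin.zero_eta]
      linear_combination -X 0 * hd + d * T.jac 1 1 * h0 - d * T.jac 0 1 * h1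
    · simp only [Fin.mk_one]
      linear_combination -X 1 * hd - d * T.jac 1 0 * h0 + d * T.jac 0 0 * h1
  ricci_one := by
    have h := congrArg T.hom hs.ricci_one
    simp only [map_sub, map_add, map_mul, T.hom_star, map_ofNat, ← core_db hP, ← core_dl hP] at h
    exact h
  ricci_two := by
    have h := congrArg T.hom hs.ricci_two
    simp only [map_sub, map_add, map_mul, T.hom_star, map_ofNat, ← core_db hP, ← core_dl hP] at h
    exact h
  ricci_three := by
    have h := congrArg T.hom hs.ricci_three
    simp only [map_sub, map_add, map_mul, T.hom_star, map_ofNat, ← core_db hP, ← core_dl hP] at h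
    exact h

theorem core_pi : (T.core f' P).pi = T.hom f'.pi := by
  simp only [Core.pi, map_add, T.hom_star]
  rfl

/-- All unknowns except the frame are scalars and pull back directly; the transport of the frame
components has to be supplied. -/
theorem core_transport (hP : ∀ A, T.hom (f'.P A) = T.push P A) (ht : f'.Transport)
    (hD : ∀ A, D (P A) = T.hom f'.rho * P A + T.hom f'.sigma * star (P A)) :
    (T.core f' P).Transport := by
  refine ⟨⟨hD, ?_, ?_⟩, ⟨?_, ?_, ?_⟩, ⟨?_, ?_, ?_⟩, ⟨?_, ?_⟩⟩
  · have h := congrArg T.hom ht.rho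
    simp only [map_sub, map_add, map_mul, T.hom_star, map_ofNat, T.hom_D] at h
    exact h
  · have h := congrArg T.hom ht.sigma
    simp only [map_sub, map_add, map_mul, T.hom_star, map_ofNat, T.hom_D] at h
    exact h
  · have h := congrArg T.hom ht.alpha
    simp only [map_sub, map_add, map_mul, T.hom_star, map_ofNat, T.hom_D, ← core_db hP,
      ← core_dl hP, ← core_pi (P := P)] at h
    exact h
  · have h := congrArg T.hom ht.beta
    simp only [map_sub, map_add, map_mul, T.hom_star, map_ofNat, T.hom_D, ← core_db hP,
      ← core_dl hP, ← core_pi (P := P)] at h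
    exact h
  · have h := congrArg T.hom ht.Psi1
    simp only [map_sub, map_add, map_mul, T.hom_star, map_ofNat, T.hom_D, ← core_db hP,
      ← core_dl hP, ← core_pi (P := P)] at h
    exact h
  · have h := congrArg T.hom ht.mu
    simp only [map_sub, map_add, map_mul, T.hom_star, map_ofNat, T.hom_D, ← core_db hP,
      ← core_dl hP, ← core_pi (P := P)] at h
    exact h
  · have h := congrArg T.hom ht.lam
    simp only [map_sub, map_add, map_mul, T.hom_star, map_ofNat, T.hom_D, ← core_db hP,
      ← core_dl hP, ← core_pi (P := P)] at h
    exact h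
  · have h := congrArg T.hom ht.Psi2
    simp only [map_sub, map_add, map_mul, T.hom_star, map_ofNat, T.hom_D, ← core_db hP,
      ← core_dl hP, ← core_pi (P := P)] at h
    exact h
  · have h := congrArg T.hom ht.Psi3
    simp only [map_sub, map_add, map_mul, T.hom_star, map_ofNat, T.hom_D, ← core_db hP,
      ← core_dl hP, ← core_pi (P := P)] at h
    exact h
  · have h := congrArg T.hom ht.Psi4
    simp only [map_sub, map_add, map_mul, T.hom_star, map_ofNat, T.hom_D, ← core_db hP,
      ← core_dl hP, ← core_pi (P := P)] at h
    exact h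

end core

/-- The freely specifiable data of `f'` and `f` are related by the change of coordinates and the
spin `z`. -/
structure DataRelated (T : Pullback R' R) (z : R) (f' : Core R') (f : Core R) : Prop where
  eps : T.hom f'.eps = f.eps
  Psi0 : T.hom f'.Psi0 = z ^ 2 * f.Psi0
  P : ∀ A, ev (T.hom (f'.P A)) = ev (z * T.push f.P A)
  rho : ev (T.hom f'.rho) = ev f.rho
  sigma : ev (T.hom f'.sigma) = ev (z ^ 2 * f.sigma)
  mu : ev (T.hom f'.mu) = ev f.mu
  lam : ev (T.hom f'.lam) = ev (star z ^ 2 * f.lam)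
  pi : ev (T.hom f'.pi) = ev (star z * f.pi)
  Psi4 : ev (T.hom f'.Psi4) = ev (star z ^ 2 * f.Psi4)

/-- Solutions of the transport equations whose freely specifiable data are related, are related. -/
theorem DataRelated.core_eq (h : T.DataRelated z f' f) (hz : z * star z = 1) (hDz : D z = 0)
    (ht' : f'.Transport) (hs' : f'.Sphere) (ht : f.Transport) (hs : f.Sphere)
    (hr : star f.rho = f.rho) {e : R'} (hu : f'.frameDet * e = 1) :
    (∀ A, T.hom (f'.P A) = T.push (f.spin z).P A) ∧ T.core f' (f.spin z).P = f.spin z := by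
  have hH := ht.spin hz hDz hr
  have hHs := hs.spin hz
  have hmap : (f'.map T.hom).FrameTransport := by
    refine ⟨fun A => ?_, ?_, ?_⟩
    · have h := congrArg T.hom (ht'.P A)
      simp only [map_sub, map_add, map_mul, T.hom_star, map_ofNat, T.hom_D] at h
      exact h
    · have h := congrArg T.hom ht'.rho
      simp only [map_sub, map_add, map_mul, T.hom_star, map_ofNat, T.hom_D] at h
      exact h
    · have h := congrArg T.hom ht'.sigma
      simp only [map_sub, map_add, map_mul, T.hom_star, map_ofNat, T.hom_D] at h
      exact h
  -- The equations for `ρ` and `σ` contain no angular derivatives, so they can be compared before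
  -- the frames are matched.
  obtain ⟨hρ, hσ⟩ := Core.rho_sigma_unique hmap hH.toFrameTransport h.eps h.Psi0 h.rho h.sigma
  have hP : ∀ A, T.hom (f'.P A) = T.push (f.spin z).P A := fun A => by
    rw [← sub_eq_zero]
    refine eq_zero_of_scalar (c := (f.spin z).rho) (d := (f.spin z).sigma) ?_ ?_
    · have h1 : D (T.hom (f'.P A)) = _ := hmap.P A
      rw [hρ, hσ] at h1
      rw [map_sub, h1]
      simp only [push, map_add, D_mul, T.D_jac, hH.P, star_sub, star_add, star_mul', T.jac_real]
      simp only [Core.map]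
      ring
    · rw [map_sub, h.P, sub_eq_zero]
      congr 1
      simp only [push, Core.spin]
      ring
  have hdet : T.hom f'.frameDet = (T.jac 0 0 * T.jac 1 1 - T.jac 0 1 * T.jac 1 0)
      * (f.spin z).frameDet := by
    simp only [Core.frameDet, map_sub, map_mul, T.hom_star, hP, push, star_add, star_mul',
      T.jac_real]
    ring
  -- Invertibility of the Jacobian is extracted from non-degeneracy of the frame of `f'`.
  have hu' : (T.jac 0 0 * T.jac 1 1 - T.jac 0 1 * T.jac 1 0)
      * (f.spin z).frameDet * T.hom e = 1 := by
    rw [← hdet, ← map_mul, hu, map_one]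
  have hGt := core_transport hP ht' (fun A => by rw [hH.P, ← hρ, ← hσ]; rfl)
  have hGs := core_sphere hP hs' (d := (f.spin z).frameDet * T.hom e) (by rw [← mul_assoc, hu'])
  refine ⟨hP, Core.Transport.unique hGt hH h.eps h.Psi0 ?_⟩
  have hπ : (T.core f' (f.spin z).P).atZero.pi = (f.spin z).atZero.pi := by
    have h1 : ∀ g : Core R, g.atZero.pi = ev g.pi := fun g => by
      simp only [Core.pi, map_add, ev_star]; rfl
    rw [h1, h1, core_pi, h.pi, Core.spin_pi]
  -- The remaining initial values are fixed by the constraints on `𝒮⋆`, so the prescribed components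
  -- suffice.
  obtain ⟨h1, h2, h3, h4, h5⟩ := hGs.atZero.unique hHs.atZero (fun a ha => by
      have h1 := congrArg ev hu'
      simp only [map_mul, map_one] at h1
      have h2 : (T.core f' (f.spin z).P).atZero.frameDet = ev (f.spin z).frameDet := by
        simp only [Core.frameDet, map_sub, map_mul, ev_star]; rfl
      rw [h2] at ha
      linear_combination -a * h1
        + ev (T.jac 0 0 * T.jac 1 1 - T.jac 0 1 * T.jac 1 0) * ev (T.hom e) * ha)
    rfl hπ h.rho h.sigma h.mu h.lam
  ext
  exacts [rfl, h.rho, h.sigma, h1, h2, h.mu, h.lam, congrArg ev h.eps, congrArg ev h.Psi0, h3, h4,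
    h5, h.Psi4]

variable {L' : Comp → R'} {L : Comp → R}

/-- All the fields are related by the change of coordinates and the spin `z`. -/
structure FieldsRelated (T : Pullback R' R) (z : R) (L' : Comp → R') (L : Comp → R) : Prop where
  C : ∀ A, T.hom (L' (.C A)) = T.push (fun B => L (.C B)) A
  P : ∀ A, T.hom (L' (.P A)) = z * T.push (fun B => L (.P B)) A
  Q : T.hom (L' .Q) = L .Q
  eps : T.hom (L' .eps) = L .eps + half * star z * along (fun A => L (.C A)) z
  pi : T.hom (L' .pi) = star z * L .pi
  beta : T.hom (L' .beta) = z * L .beta + half * (coreOf L).dl z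
  mu : T.hom (L' .mu) = L .mu
  alpha : T.hom (L' .alpha) = star z * L .alpha - half * star ((coreOf L).dl z)
  lam : T.hom (L' .lam) = star z ^ 2 * L .lam
  tau : T.hom (L' .tau) = z * L .tau
  sigma : T.hom (L' .sigma) = z ^ 2 * L .sigma
  rho : T.hom (L' .rho) = L .rho
  Psi0 : T.hom (L' (.Psi 0)) = z ^ 2 * L (.Psi 0)
  Psi1 : T.hom (L' (.Psi 1)) = z * L (.Psi 1)
  Psi2 : T.hom (L' (.Psi 2)) = L (.Psi 2)
  Psi3 : T.hom (L' (.Psi 3)) = star z * L (.Psi 3)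
  Psi4 : T.hom (L' (.Psi 4)) = star z ^ 2 * L (.Psi 4)

/-- After the transported unknowns are matched, `Q` agrees by its transport equation and `τ` by
dividing the constraint on `δQ` by `Q`. -/
theorem DataRelated.fieldsRelated_out (h : T.DataRelated z (coreOf L') (coreOf L))
    (hz : z * star z = 1) (hDz : D z = 0) (h' : OutEqs L') (hL : OutEqs L) {e : R'}
    (hu : (coreOf L').frameDet * e = 1) {q : R} (hq : L .Q * q = 1) :
    T.FieldsRelated z L' L := by
  obtain ⟨hP, hc⟩ := h.core_eq hz hDz h'.transport h'.sphere hL.transport hL.sphere hL.real.rho hu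
  have hdl := core_dl hP (L' .Q)
  have hπ : T.hom (L' .pi) = star z * L .pi := by
    have := congrArg Core.pi hc
    rwa [core_pi, Core.spin_pi, Core.pi_coreOf h'.pi, Core.pi_coreOf hL.pi] at this
  have heps : T.hom (L' .eps) = L .eps := h.eps
  have hQ : T.hom (L' .Q) = L .Q := by
    rw [← sub_eq_zero]
    refine eq_zero_of_scalar (c := -2 * L .eps) (d := 0) ?_ ?_
    · rw [map_sub, ← T.hom_D, h'.Q, hL.Q]
      simp only [map_mul, map_neg, map_ofNat, heps]
      ring
    · rw [map_sub, ← T.hom_ev, h'.Q_atZero, hL.Q_atZero, map_one, sub_self]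
  refine
    { C := fun A => by simp [h'.C, hL.C, push]
      P := fun A => (hP A).trans (by simp only [push, Core.spin, coreOf_P]; ring)
      Q := hQ
      eps := heps.trans (by simp [along_apply, hL.C])
      pi := hπ
      beta := congrArg Core.beta hc
      mu := congrArg Core.mu hc
      alpha := congrArg Core.alpha hc
      lam := congrArg Core.lam hc
      tau := ?_
      sigma := congrArg Core.sigma hc
      rho := congrArg Core.rho hc
      Psi0 := congrArg Core.Psi0 hc
      Psi1 := congrArg Core.Psi1 hc
      Psi2 := congrArg Core.Psi2 hc
      Psi3 := congrArg Core.Psi3 hc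
      Psi4 := congrArg Core.Psi4 hc }
  rw [hc, hQ, Core.spin_dl, hL.Q_tau, h'.Q_tau, map_mul, map_sub, T.hom_star, hπ, hQ, star_mul',
    star_star] at hdl
  linear_combination -q * hdl - (T.hom (L' .tau) - z * L .tau) * hq

/-- The exchanged frame is `m̄`, hence the spin `z̄` for the primed unknowns. `C` and `ε` lie
outside the hierarchy and are compared through their own equations. -/
theorem DataRelated.fieldsRelated_in
    (h : T.DataRelated (star z) ((coreOf L').prime 0) ((coreOf L).prime 0))
    (heps : ev (T.hom (L' .eps)) = ev (L .eps))
    (hz : z * star z = 1) (hDz : D z = 0) (h' : InEqs L') (hL : InEqs L) {e : R'}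
    (hu : (coreOf L').frameDet * e = 1) : T.FieldsRelated z L' L := by
  obtain ⟨hP, hc⟩ := h.core_eq (by rw [star_star, mul_comm, hz]) (by rw [D_star, hDz, star_zero])
    h'.transport (h'.sphere.prime 0) hL.transport (hL.sphere.prime 0)
    (by simp [Core.prime, hL.mu_real]) (e := -e) (by
      simp only [Core.frameDet, Core.prime, coreOf_P, star_star] at hu ⊢
      linear_combination hu)
  have hPp : ∀ A, T.hom (L' (.P A)) = z * T.push (fun B => L (.P B)) A := fun A => by
    have := congrArg star (hP A)
    simp only [Core.prime, Core.spin, coreOf_P, push, T.hom_star, star_add, star_mul', star_star,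
      T.jac_real] at this
    rw [this, push]
    ring
  have hneg : ∀ {a b : R}, -a = -b → a = b := fun h => neg_injective h
  have hbeta : T.hom (L' .beta) = z * L .beta + half * (coreOf L).dl z := by
    have := congrArg Core.alpha hc
    simp only [Core.spin, core, Core.map, Core.prime_dl] at this
    simp only [Core.prime, map_neg, star_star, Core.db_star, coreOf_beta] at this
    linear_combination -this
  have halpha : T.hom (L' .alpha) = star z * L .alpha - half * star ((coreOf L).dl z) := by
    have := congrArg Core.beta hc
    simp only [Core.spin, core, Core.map, Core.prime_dl] at this
    simp only [Core.prime, map_neg, star_star, Core.db_star, coreOf_alpha] at this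
    linear_combination -this
  have hπ : T.hom (L' .pi) = star z * L .pi := by
    rw [h'.pi, hL.pi, map_add, T.hom_star, halpha, hbeta]
    simp only [star_add, star_mul', star_half]
    ring
  have hPsi2 : T.hom (L' (.Psi 2)) = L (.Psi 2) := congrArg Core.Psi2 hc
  have hC : ∀ A, T.hom (L' (.C A)) = T.push (fun B => L (.C B)) A := fun A => by
    rw [← sub_eq_zero]
    refine eq_zero_of_scalar (c := 0) (d := 0) ?_ ?_
    · rw [map_sub, ← T.hom_D, h'.C]
      simp only [push, map_add, map_sub, map_neg, map_mul, map_ofNat, D_mul, T.D_jac, hL.C,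
        T.hom_star, hπ, hPp, star_mul', star_add, star_star, T.jac_real]
      grind
    · rw [map_sub, ← T.hom_ev, h'.C_atZero]
      simp [push, hL.C_atZero]
  have hdbz := Core.db_unitary (f := coreOf L) hz
  have h2 := two_mul_half (R := R)
  refine
    { C := hC
      P := hPp
      Q := by rw [h'.Q, hL.Q, map_one]
      eps := ?_
      pi := hπ
      beta := hbeta
      mu := hneg ((map_neg T.hom _).symm.trans (congrArg Core.rho hc))
      alpha := halpha
      lam := ?_
      tau := by rw [h'.tau, hL.tau, T.hom_star, hπ, star_mul', star_star]
      sigma := ?_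
      rho := hneg ((map_neg T.hom _).symm.trans (congrArg Core.mu hc))
      Psi0 := ?_
      Psi1 := ?_
      Psi2 := hPsi2
      Psi3 := congrArg Core.Psi1 hc
      Psi4 := congrArg Core.Psi0 hc }
  · rw [← sub_eq_zero]
    refine eq_zero_of_scalar (c := 0) (d := 0) ?_ ?_
    -- The rate of change of `C^𝒜 ∂_𝒜 z` accounts for the inhomogeneous term of `ε`; off `𝒮⋆` the
    -- vector `C` need not vanish on `𝒩⋆'`.
    · have hal : D (along (fun A => L (.C A)) z)
          = -2 * L .pi * (coreOf L).dl z - 2 * star (L .pi) * (coreOf L).db z := by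
        simp only [along_apply, map_add, D_mul, hL.C, D_par, hDz, map_zero, Core.dl, Core.db,
          coreOf_P]
        ring
      rw [map_sub, ← T.hom_D, h'.eps, map_add, hL.eps, D_mul, D_mul, D_half, D_star, hDz, hal, hdbz]
      simp only [map_sub, map_neg, map_mul, map_ofNat, T.hom_star, hπ, hPsi2, hbeta, halpha,
        star_mul', star_star, star_zero]
      generalize (coreOf L).dl z = w
      grind
    · simp [heps, ev_along, along_apply, hL.C_atZero]
  · have := congrArg Core.sigma hc
    simp only [Core.spin, core, Core.map, Core.prime, map_neg, coreOf_lam] at this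
    linear_combination -this
  · have := congrArg Core.lam hc
    simp only [Core.spin, core, Core.map, Core.prime, map_neg, coreOf_sigma, star_star] at this
    linear_combination -this
  · have := congrArg Core.Psi4 hc
    simp only [Core.spin, core, Core.map, Core.prime, star_star] at this
    exact this
  · have := congrArg Core.Psi3 hc
    simp only [Core.spin, core, Core.map, Core.prime, star_star] at this
    exact this

/-- The determinant of the solution of the Riccati equation is independent of the coordinates and of
the frame. -/
theorem riccati_det {eps' Psi0' rho' sigma' a' b' p' q' : R'} {eps Psi0 rho sigma a b p q : R}
    (h' : Core.RiccatiSolution eps' Psi0' rho' sigma' a' b' p' q')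
    (h : Core.RiccatiSolution eps Psi0 rho sigma a b p q) (hz : z * star z = 1) (hDz : D z = 0)
    (heps : T.hom eps' = eps) (hPsi0 : T.hom Psi0' = z ^ 2 * Psi0)
    (hrho : ev (T.hom rho') = ev rho) (hsigma : ev (T.hom sigma') = ev (z ^ 2 * sigma)) :
    T.hom (a' * star a' - b' * star b') = a * star a - b * star b := by
  have hT := h'.map T.hom_star T.hom_D T.hom_ev hrho hsigma
  rw [heps, hPsi0] at hT
  obtain ⟨ha, hb⟩ := hT.unique (h.spin hz hDz)
  simp only [map_sub, map_mul, T.hom_star, ha, hb, star_mul', star_pow]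
  linear_combination -b * star b * (z * star z + 1) * hz

end Pullback
end ChangeOfPatch
end StewartGauge

/-! ### Point evaluations, coordinate changes and restrictions of fields -/

namespace StewartGauge
open TransportRing Set TopologicalSpace

namespace SmoothFn

variable {a : Ioi (0 : ℝ)} {U : Opens E2}

/-- Evaluation at a point. -/
def evalAt {p : ℝ × E2} (hp : p ∈ slab a U) : SmoothFn a U →+* ℂ where
  toFun f := f.fn p
  map_zero' := fn_zero p
  map_one' := fn_one hp
  map_add' f g := fn_add f g p
  map_mul' f g := fn_mul f g p

theorem evalAt_star {p : ℝ × E2} (hp : p ∈ slab a U) (f : SmoothFn a U) :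
    evalAt hp (star f) = conj (evalAt hp f) := fn_star f p

theorem mem_slab_of_Ico {t : ℝ} (ht : t ∈ Ico 0 (a : ℝ)) {x : E2} (hx : x ∈ U) :
    (t, x) ∈ slab a U := ⟨Ico_subset_Icc_self ht, hx⟩

/-- By continuity the end `v = a` may be omitted; the one-sided derivatives of the fields are
compared only at `v < a`. -/
theorem ext_fn_Ico {f g : SmoothFn a U}
    (h : ∀ t ∈ Ico 0 (a : ℝ), ∀ x ∈ U, f.fn (t, x) = g.fn (t, x)) : f = g := by
  refine ext_fn fun p hp => ?_
  refine EqOn.of_subset_closure (s := Ico 0 (a : ℝ) ×ˢ (U : Set E2)) (t := slab a U)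
    (fun q hq => h q.1 hq.1 q.2 hq.2)
    f.contDiffOn_fn.continuousOn g.contDiffOn_fn.continuousOn
    (prod_mono Ico_subset_Icc_self subset_rfl) ?_ hp
  rw [closure_prod_eq, closure_Ico (ne_of_lt a.2)]
  exact prod_mono subset_rfl subset_closure

theorem fn_ev (f : SmoothFn a U) {p : ℝ × E2} (hp : p ∈ slab a U) :
    (ev f).fn p = f.fn (0, p.2) := fn_initial f hp

/-- For `t < a` the closed interval is a neighbourhood of `t` within the half line, so values beyond
the slab do not matter. -/
theorem derivWithin_eq_fn_D (f : SmoothFn a U) {g : ℝ → ℂ} {x : E2} (hx : x ∈ U)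
    (hg : ∀ s ∈ Icc 0 (a : ℝ), g s = f.fn (s, x)) {t : ℝ} (ht : t ∈ Ico 0 (a : ℝ)) :
    derivWithin g (Ici 0) t = (D f).fn (t, x) := by
  have ht' := Ico_subset_Icc_self ht
  have h := (f.hasDerivWithinAt_fn ht' hx).congr hg (hg t ht')
  refine HasDerivWithinAt.derivWithin (h.mono_of_mem_nhdsWithin ?_)
    (uniqueDiffOn_Ici 0 t ht.1)
  rw [← Ici_inter_Iic]
  exact Filter.inter_mem self_mem_nhdsWithin (mem_nhdsWithin_of_mem_nhds (Iic_mem_nhds ht.2))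

theorem pd_eq_fn_par (f : SmoothFn a U) {g : E2 → ℂ} {t : ℝ} (ht : t ∈ Icc 0 (a : ℝ))
    (hg : ∀ x ∈ U, g x = f.fn (t, x)) (A : Fin 2) {x : E2} (hx : x ∈ U) :
    pd A g x = (par A f).fn (t, x) := by
  refine Eq.trans ?_ (f.pd_fn A ht hx)
  rw [pd, pd, Filter.EventuallyEq.fderiv_eq]
  exact Filter.eventually_of_mem (U.isOpen.mem_nhds hx) hg

/-! #### Change of coordinates -/

section pullback

variable {W U' : Opens E2} {t : E2 → E2}

theorem contDiffOn_coord (ht : ContDiffOn ℝ ∞ t W) (A : Fin 2) :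
    ContDiffOn ℝ ∞ (fun p : ℝ × E2 => ((t p.2 A : ℝ) : ℂ)) (slab a W) := by
  have h1 : ContDiffOn ℝ ∞ (fun p : ℝ × E2 => t p.2) (slab a W) :=
    ht.comp contDiff_snd.contDiffOn fun p hp => hp.2
  exact Complex.ofRealCLM.contDiff.comp_contDiffOn
    ((EuclideanSpace.proj (𝕜 := ℝ) A).contDiff.comp_contDiffOn h1)

/-- The component `t^𝒜` of the change of coordinates. -/
def coord (a : Ioi (0 : ℝ)) (ht : ContDiffOn ℝ ∞ t W) (A : Fin 2) : SmoothFn a W :=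
  mk _ (contDiffOn_coord ht A)

theorem fn_par_coord (ht : ContDiffOn ℝ ∞ t W) (A B : Fin 2) {p : ℝ × E2} (hp : p ∈ slab a W) :
    (par B (coord a ht A)).fn p
      = ((fderiv ℝ t p.2 (EuclideanSpace.single B 1) A : ℝ) : ℂ) := by
  rw [← pd_eq_fn_par (coord a ht A) hp.1 (g := fun x => ((t x A : ℝ) : ℂ))
    (fun x hx => (fn_mk (contDiffOn_coord ht A) (p := (p.1, x)) ⟨hp.1, hx⟩).symm) B hp.2, pd]
  have hd : HasFDerivAt t (fderiv ℝ t p.2) p.2 :=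
    ((ht.contDiffAt (W.isOpen.mem_nhds hp.2)).differentiableAt (by simp)).hasFDerivAt
  have := (Complex.ofRealCLM.hasFDerivAt.comp p.2
    ((EuclideanSpace.proj (𝕜 := ℝ) A).hasFDerivAt.comp p.2 hd)).fderiv
  exact congrArg (fun L => L (EuclideanSpace.single B 1)) this

theorem D_eq_zero_of_const {f : SmoothFn a U} (h : ∀ p ∈ slab a U, f.fn p = f.fn (0, p.2)) :
    D f = 0 := by
  rw [show f = ev f from ext_fn fun p hp => by rw [fn_ev _ hp, h p hp], D_ev]

theorem contDiffOn_lift (ht : ContDiffOn ℝ ∞ t W) :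
    ContDiffOn ℝ ∞ (fun p : ℝ × E2 => (p.1, t p.2)) (slab a W) :=
  contDiff_fst.contDiffOn.prodMk (ht.comp contDiff_snd.contDiffOn fun _ hp => hp.2)

theorem mapsTo_lift (hm : MapsTo t W U') :
    MapsTo (fun p : ℝ × E2 => (p.1, t p.2)) (slab a W) (slab a U') := fun _ hp => ⟨hp.1, hm hp.2⟩

theorem hasFDerivWithinAt_lift (ht : ContDiffOn ℝ ∞ t W) {p : ℝ × E2} (hp : p ∈ slab a W) :
    HasFDerivWithinAt (fun p : ℝ × E2 => (p.1, t p.2))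
      ((ContinuousLinearMap.fst ℝ ℝ E2).prod ((fderiv ℝ t p.2).comp (.snd ℝ ℝ E2)))
      (slab a W) p := by
  have hd : HasFDerivAt t (fderiv ℝ t p.2) p.2 :=
    ((ht.contDiffAt (W.isOpen.mem_nhds hp.2)).differentiableAt (by simp)).hasFDerivAt
  exact (hasFDerivAt_fst.prodMk (hd.comp p hasFDerivAt_snd)).hasFDerivWithinAt

/-- The pull-back along a change of the angular coordinates. -/
def pullback (a : Ioi (0 : ℝ)) (ht : ContDiffOn ℝ ∞ t W) (hm : MapsTo t W U') :
    Pullback (SmoothFn a U') (SmoothFn a W) where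
  hom := comp (fun p => (p.1, t p.2)) (contDiffOn_lift ht) (mapsTo_lift hm)
  jac A B := par B (coord a ht A)
  hom_star := comp_star
  hom_D f := ext_fn fun p hp => by
    rw [fn_comp _ hp]
    refine Eq.trans ?_ (fn_dir_comp f (1, 0) hp (hasFDerivWithinAt_lift ht hp)).symm
    have : ((ContinuousLinearMap.fst ℝ ℝ E2).prod ((fderiv ℝ t p.2).comp (.snd ℝ ℝ E2))) (1, 0)
        = (1, 0) := Prod.ext rfl (map_zero (fderiv ℝ t p.2))
    rw [this]
    rfl
  hom_ev f := ext_fn fun p hp => by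
    rw [fn_comp _ hp, fn_ev _ hp, fn_ev _ (mapsTo_lift hm hp), fn_comp _ (zero_mem_slab hp)]
  par_hom B f := ext_fn fun p hp => by
    refine (fn_dir_comp f (0, EuclideanSpace.single B 1) hp
      (hasFDerivWithinAt_lift ht hp)).trans ?_
    rw [fn_add, fn_mul, fn_mul, fn_par_coord ht _ _ hp, fn_par_coord ht _ _ hp, fn_comp _ hp,
      fn_comp _ hp]
    have hq : (p.1, t p.2) ∈ slab a U' := mapsTo_lift hm hp
    change _ = _ * (dir _ f).fn _ + _ * (dir _ f).fn _
    rw [fn_dir _ _ hq, fn_dir _ _ hq, fn_dir _ _ hq, ← Complex.real_smul, ← Complex.real_smul,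
      ← map_smul, ← map_smul, ← map_add]
    congr 1
    refine Prod.ext (by simp) ?_
    ext i
    fin_cases i <;> simp
  jac_real A B := by
    rw [← par_star]
    congr 1
    refine ext_fn fun p hp => ?_
    rw [fn_star, coord, fn_mk _ hp, Complex.conj_ofReal]
  D_jac A B := by
    rw [D_par, D_eq_zero_of_const, map_zero]
    intro p hp
    rw [coord, fn_mk _ hp, fn_mk _ (zero_mem_slab hp)]
  par_jac A B B' := par_comm _ _ _

theorem fn_pullback (ht : ContDiffOn ℝ ∞ t W) (hm : MapsTo t W U') (f : SmoothFn a U')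
    {p : ℝ × E2} (hp : p ∈ slab a W) : ((pullback a ht hm).hom f).fn p = f.fn (p.1, t p.2) :=
  fn_comp (hΘ := contDiffOn_lift ht) (hm := mapsTo_lift hm) f hp

theorem fn_push (ht : ContDiffOn ℝ ∞ t W) (hm : MapsTo t W U') (w : Fin 2 → SmoothFn a W)
    (A : Fin 2) {p : ℝ × E2} (hp : p ∈ slab a W) :
    ((pullback a ht hm).push w A).fn p = push t p.2 (fun B => (w B).fn p) A := by
  rw [Pullback.push, push, Fin.sum_univ_two, fn_add, fn_mul, fn_mul]
  congr 2 <;> exact fn_par_coord ht _ _ hp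

end pullback

end SmoothFn

open SmoothFn

variable {a : Ioi (0 : ℝ)} {U : Opens E2} {F : Fields} {L : Comp → SmoothFn a U}

/-! ### Fields on `𝒩⋆` and `𝒩⋆'` as elements of the ring of smooth functions -/

/-- `L` is the restriction of the fields to `𝒩⋆`. -/
def IsOut (F : Fields) (L : Comp → SmoothFn a U) : Prop :=
  ∀ c, ∀ s ∈ Icc 0 (a : ℝ), ∀ x ∈ U, F c s 0 x = (L c).fn (s, x)

/-- `L` is the restriction of the fields to `𝒩⋆'`. -/
def IsIn (F : Fields) (L : Comp → SmoothFn a U) : Prop :=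
  ∀ c, ∀ s ∈ Icc 0 (a : ℝ), ∀ x ∈ U, F c 0 s x = (L c).fn (s, x)

section

variable {t : ℝ} (ht : t ∈ Ico 0 (a : ℝ)) {x : E2} (hx : x ∈ U)

theorem IsOut.val (h : IsOut F L) :
    val F t 0 x = fun c => evalAt (mem_slab_of_Ico ht hx) (L c) :=
  funext fun c => h c t (Ico_subset_Icc_self ht) x hx

/-- The gauge condition `C = 0` reduces the operator to `∂_v`. -/
theorem IsOut.opD (h : IsOut F L) (hC : ∀ A, F (.C A) t 0 x = 0) :
    opD F t 0 x = fun c => evalAt (mem_slab_of_Ico ht hx) (D (L c)) := by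
  funext c
  simp only [StewartGauge.opD, hC, zero_mul, Finset.sum_const_zero, add_zero]
  exact derivWithin_eq_fn_D (L c) hx (fun s hs => h c s hs x hx) ht

theorem IsOut.opd (h : IsOut F L) :
    opd F t 0 x = fun c => evalAt (mem_slab_of_Ico ht hx) ((coreOf L).dl (L c)) := by
  funext c
  have ht' := Ico_subset_Icc_self ht
  simp only [StewartGauge.opd, Fin.sum_univ_two, h _ t ht' x hx,
    pd_eq_fn_par (L c) ht' (h c t ht') _ hx]
  simp only [Core.dl, along_apply, map_add, map_mul]
  rfl

theorem IsOut.opdb (h : IsOut F L) :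
    opdb F t 0 x = fun c => evalAt (mem_slab_of_Ico ht hx) ((coreOf L).db (L c)) := by
  funext c
  have ht' := Ico_subset_Icc_self ht
  simp only [StewartGauge.opdb, Fin.sum_univ_two, h _ t ht' x hx,
    pd_eq_fn_par (L c) ht' (h c t ht') _ hx]
  simp only [Core.db, along_apply, map_add, map_mul, evalAt_star]
  rfl

theorem IsIn.val (h : IsIn F L) :
    val F 0 t x = fun c => evalAt (mem_slab_of_Ico ht hx) (L c) :=
  funext fun c => h c t (Ico_subset_Icc_self ht) x hx

theorem IsIn.opDelta (h : IsIn F L) (hQ : F .Q 0 t x = 1) :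
    opDelta F 0 t x = fun c => evalAt (mem_slab_of_Ico ht hx) (D (L c)) := by
  funext c
  simp only [StewartGauge.opDelta, hQ, one_mul]
  exact derivWithin_eq_fn_D (L c) hx (fun s hs => h c s hs x hx) ht

theorem IsIn.opd (h : IsIn F L) :
    opd F 0 t x = fun c => evalAt (mem_slab_of_Ico ht hx) ((coreOf L).dl (L c)) := by
  funext c
  have ht' := Ico_subset_Icc_self ht
  simp only [StewartGauge.opd, Fin.sum_univ_two, h _ t ht' x hx,
    pd_eq_fn_par (L c) ht' (h c t ht') _ hx]
  simp only [Core.dl, along_apply, map_add, map_mul]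
  rfl

theorem IsIn.opdb (h : IsIn F L) :
    opdb F 0 t x = fun c => evalAt (mem_slab_of_Ico ht hx) ((coreOf L).db (L c)) := by
  funext c
  have ht' := Ico_subset_Icc_self ht
  simp only [StewartGauge.opdb, Fin.sum_univ_two, h _ t ht' x hx,
    pd_eq_fn_par (L c) ht' (h c t ht') _ hx]
  simp only [Core.db, along_apply, map_add, map_mul, evalAt_star]
  rfl

end

/-- The evaluations at the points with `0 ≤ v < a`. -/
def points (a : Ioi (0 : ℝ)) (U : Opens E2) : Set (SmoothFn a U →+* ℂ) :=
  {φ | ∃ t, ∃ ht : t ∈ Ico 0 (a : ℝ), ∃ x, ∃ hx : x ∈ U, φ = evalAt (mem_slab_of_Ico ht hx)}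

theorem points_star : ∀ φ ∈ points a U, ∀ f, φ (star f) = conj (φ f) := by
  rintro _ ⟨t, ht, x, hx, rfl⟩ f
  exact evalAt_star _ f

theorem points_injective (f g : SmoothFn a U) (h : ∀ φ ∈ points a U, φ f = φ g) : f = g :=
  ext_fn_Ico fun t ht x hx => h _ ⟨t, ht, x, hx, rfl⟩

variable {v₁ u₁ : ℝ}

/-- The strict inequality places the closed slab inside the domain of the data. The initial value `Q
= 1` is taken from `𝒩⋆'` at `𝒮⋆`, which is why `u₁` must be positive. -/
theorem IsCharacteristicData.exists_out (h : IsCharacteristicData U v₁ u₁ F) (hu : 0 < u₁)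
    (ha : (a : ℝ) < v₁) : ∃ L : Comp → SmoothFn a U, IsOut F L ∧ OutEqs L ∧
      (∃ e, (coreOf L).frameDet * e = 1) ∧ ∃ q, L .Q * q = 1 := by
  have hsub : Icc 0 (a : ℝ) ⊆ Ico 0 v₁ := fun s hs => ⟨hs.1, hs.2.trans_lt ha⟩
  have hs : ∀ c, ContDiffOn ℝ ∞ (fun p : ℝ × E2 => F c p.1 0 p.2) (slab a U) := fun c =>
    (h.smooth_out c).mono (prod_mono hsub subset_rfl)
  have hL : IsOut F fun c => SmoothFn.mk _ (hs c) := fun c s hs' x hx =>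
    (fn_mk (hs c) (p := (s, x)) ⟨hs', hx⟩).symm
  have h0 : (0 : ℝ) ∈ Ico 0 u₁ := ⟨le_rfl, hu⟩
  refine ⟨_, hL, OutEqs.of_pointwise points_star points_injective ?_ ?_ ?_ ?_ ?_ ?_,
    exists_inverse ?_, exists_inverse ?_⟩
  · rintro _ ⟨t, ht, x, hx, rfl⟩
    rw [← hL.val ht hx]
    exact h.gauge_out t (hsub (Ico_subset_Icc_self ht)) x hx
  · rintro _ ⟨t, ht, x, hx, rfl⟩
    have ht' := hsub (Ico_subset_Icc_self ht)
    rw [← hL.val ht hx, ← hL.opD ht hx (h.boundary_gauge.C_zero t ht' x hx), ← hL.opd ht hx,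
      ← hL.opdb ht hx]
    exact h.eqs_out t ht' x hx
  · rintro _ ⟨t, ht, x, hx, rfl⟩
    have ht' := hsub (Ico_subset_Icc_self ht)
    rw [← hL.val ht hx, ← hL.opd ht hx, ← hL.opdb ht hx]
    exact h.constraints_out t ht' x hx
  · refine fun A => ext_fn fun p hp => ?_
    rw [fn_mk _ hp, fn_zero]
    exact h.boundary_gauge.C_zero _ (hsub hp.1) _ hp.2 A
  · refine ext_fn fun p hp => ?_
    rw [fn_star, fn_mk _ hp]
    exact h.boundary_gauge.eps_real _ (hsub hp.1) _ hp.2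
  · refine ext_fn fun p hp => ?_
    rw [fn_ev _ hp, fn_mk _ (zero_mem_slab hp), fn_one hp]
    exact h.boundary_gauge.Q_one 0 h0 _ hp.2
  · intro p hp
    rw [Core.frameDet, fn_sub, fn_mul, fn_mul, fn_star, fn_star]
    simp only [coreOf_P, fn_mk _ hp]
    exact (h.gauge_out _ (hsub hp.1) _ hp.2).P_indep
  · intro p hp
    rw [fn_mk _ hp]
    exact fun h0 => ne_of_gt (h.gauge_out _ (hsub hp.1) _ hp.2).Q_pos
      ((congrArg Complex.re h0).trans Complex.zero_re)

/-- Symmetrically, the initial value `C = 0` is taken from `𝒩⋆` at `𝒮⋆`. -/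
theorem IsCharacteristicData.exists_in (h : IsCharacteristicData U v₁ u₁ F) (hv : 0 < v₁)
    (ha : (a : ℝ) < u₁) : ∃ L : Comp → SmoothFn a U, IsIn F L ∧ InEqs L ∧
      ∃ e, (coreOf L).frameDet * e = 1 := by
  have hsub : Icc 0 (a : ℝ) ⊆ Ico 0 u₁ := fun s hs => ⟨hs.1, hs.2.trans_lt ha⟩
  have hs : ∀ c, ContDiffOn ℝ ∞ (fun p : ℝ × E2 => F c 0 p.1 p.2) (slab a U) := fun c =>
    (h.smooth_in c).mono (prod_mono hsub subset_rfl)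
  have hL : IsIn F fun c => SmoothFn.mk _ (hs c) := fun c s hs' x hx =>
    (fn_mk (hs c) (p := (s, x)) ⟨hs', hx⟩).symm
  have h0 : (0 : ℝ) ∈ Ico 0 v₁ := ⟨le_rfl, hv⟩
  refine ⟨_, hL, InEqs.of_pointwise points_star points_injective ?_ ?_ ?_ ?_ ?_,
    exists_inverse ?_⟩
  · rintro _ ⟨t, ht, x, hx, rfl⟩
    rw [← hL.val ht hx]
    exact h.gauge_in t (hsub (Ico_subset_Icc_self ht)) x hx
  · rintro _ ⟨t, ht, x, hx, rfl⟩
    have ht' := hsub (Ico_subset_Icc_self ht)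
    rw [← hL.val ht hx, ← hL.opDelta ht hx (h.boundary_gauge.Q_one t ht' x hx), ← hL.opd ht hx,
      ← hL.opdb ht hx]
    exact h.eqs_in t ht' x hx
  · rintro _ ⟨t, ht, x, hx, rfl⟩
    have ht' := hsub (Ico_subset_Icc_self ht)
    rw [← hL.val ht hx, ← hL.opd ht hx, ← hL.opdb ht hx]
    exact h.constraints_in t ht' x hx
  · refine ext_fn fun p hp => ?_
    rw [fn_mk _ hp, fn_one hp]
    exact h.boundary_gauge.Q_one _ (hsub hp.1) _ hp.2
  · refine fun A => ext_fn fun p hp => ?_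
    rw [fn_ev _ hp, fn_mk _ (zero_mem_slab hp), fn_zero]
    exact h.boundary_gauge.C_zero 0 h0 _ hp.2 A
  · intro p hp
    rw [Core.frameDet, fn_sub, fn_mul, fn_mul, fn_star, fn_star]
    simp only [coreOf_P, fn_mk _ hp]
    exact (h.gauge_in _ (hsub hp.1) _ hp.2).P_indep

end StewartGauge

namespace StewartGauge
open TransportRing Set TopologicalSpace SmoothFn

/-! ### Full data sets whose reduced data are related -/

theorem IsCharacteristicData.mono {U W : Set E2} {v₁ u₁ v₂ u₂ : ℝ} {F : Fields}
    (h : IsCharacteristicData U v₁ u₁ F) (hW : W ⊆ U) (hv : v₂ ≤ v₁) (hu : u₂ ≤ u₁) :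
    IsCharacteristicData W v₂ u₂ F :=
  have hv' : Ico 0 v₂ ⊆ Ico 0 v₁ := Ico_subset_Ico_right hv
  have hu' : Ico 0 u₂ ⊆ Ico 0 u₁ := Ico_subset_Ico_right hu
  { smooth_out := fun c => (h.smooth_out c).mono (prod_mono hv' hW)
    smooth_in := fun c => (h.smooth_in c).mono (prod_mono hu' hW)
    boundary_gauge :=
      ⟨fun v hv x hx => h.boundary_gauge.C_zero v (hv' hv) x (hW hx),
        fun v hv x hx => h.boundary_gauge.eps_real v (hv' hv) x (hW hx),
        fun u hu x hx => h.boundary_gauge.Q_one u (hu' hu) x (hW hx)⟩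
    gauge_out := fun v hv x hx => h.gauge_out v (hv' hv) x (hW hx)
    gauge_in := fun u hu x hx => h.gauge_in u (hu' hu) x (hW hx)
    eqs_out := fun v hv x hx => h.eqs_out v (hv' hv) x (hW hx)
    eqs_in := fun u hu x hx => h.eqs_in u (hu' hu) x (hW hx)
    constraints_out := fun v hv x hx => h.constraints_out v (hv' hv) x (hW hx)
    constraints_in := fun u hu x hx => h.constraints_in u (hu' hu) x (hW hx) }

theorem Induces.mono {U W : Set E2} {v₁ u₁ v₂ u₂ : ℝ} {F : Fields} {r : ReducedData}
    (h : Induces U v₁ u₁ F r) (hW : W ⊆ U) (hv : v₂ ≤ v₁) (hu : u₂ ≤ u₁) :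
    Induces W v₂ u₂ F r :=
  have hv' : Ico 0 v₂ ⊆ Ico 0 v₁ := Ico_subset_Ico_right hv
  have hu' : Ico 0 u₂ ⊆ Ico 0 u₁ := Ico_subset_Ico_right hu
  { Psi0 := fun v hv x hx => h.Psi0 v (hv' hv) x (hW hx)
    epsSum := fun v hv x hx => h.epsSum v (hv' hv) x (hW hx)
    Psi4 := fun u hu x hx => h.Psi4 u (hu' hu) x (hW hx)
    lam := fun x hx => h.lam x (hW hx)
    sigma := fun x hx => h.sigma x (hW hx)
    mu := fun x hx => h.mu x (hW hx)
    rho := fun x hx => h.rho x (hW hx)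
    pi := fun x hx => h.pi x (hW hx)
    P := fun A x hx => h.P A x (hW hx) }

/-- A vacuum solution induces a full data set. -/
theorem IsVacuumSolution.isCharacteristicData {U : Set E2} {v₁ u₁ : ℝ} {F : Fields}
    (h : IsVacuumSolution U v₁ u₁ F) (hv : 0 < v₁) (hu : 0 < u₁) :
    IsCharacteristicData U v₁ u₁ F :=
  have hv0 : (0 : ℝ) ∈ Ico 0 v₁ := ⟨le_rfl, hv⟩
  have hu0 : (0 : ℝ) ∈ Ico 0 u₁ := ⟨le_rfl, hu⟩
  { smooth_out := fun c => (h.smooth c).comp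
      (contDiff_fst.prodMk (contDiff_const.prodMk contDiff_snd)).contDiffOn
      fun _ hp => ⟨hp.1, hu0, hp.2⟩
    smooth_in := fun c => (h.smooth c).comp
      (contDiff_const.prodMk (contDiff_fst.prodMk contDiff_snd)).contDiffOn
      fun _ hp => ⟨hv0, hp.1, hp.2⟩
    boundary_gauge := h.boundary_gauge
    gauge_out := fun v hv => h.gauge v hv 0 hu0
    gauge_in := fun u hu => h.gauge 0 hv0 u hu
    eqs_out := fun v hv => h.eqs_D v hv 0 hu0
    eqs_in := fun u hu => h.eqs_Delta 0 hv0 u hu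
    constraints_out := fun v hv => h.constraints v hv 0 hu0
    constraints_in := fun u hu => h.constraints 0 hv0 u hu }

variable {U' W : Opens E2} {v₁ u₁ vmax umax : ℝ} {F F' : Fields} {r r' : ReducedData}
  {t : E2 → E2} {z : E2 → ℂ}

theorem contDiffOn_comp_snd {a : Ioi (0 : ℝ)} (hz : ContDiffOn ℝ ∞ z W) :
    ContDiffOn ℝ ∞ (fun p : ℝ × E2 => z p.2) (slab a W) :=
  hz.comp contDiff_snd.contDiffOn fun _ hp => hp.2

/-- A function of the angular coordinates, as a function on the slab. -/
def const (a : Ioi (0 : ℝ)) (hz : ContDiffOn ℝ ∞ z W) : SmoothFn a W :=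
  SmoothFn.mk _ (contDiffOn_comp_snd hz)

theorem fn_const {a : Ioi (0 : ℝ)} (hz : ContDiffOn ℝ ∞ z W) {p : ℝ × E2} (hp : p ∈ slab a W) :
    (const a hz).fn p = z p.2 := fn_mk _ hp

theorem D_const {a : Ioi (0 : ℝ)} (hz : ContDiffOn ℝ ∞ z W) : D (const a hz) = 0 :=
  D_eq_zero_of_const fun p hp => by rw [fn_const hz hp, fn_const hz (zero_mem_slab hp)]

theorem const_unitary {a : Ioi (0 : ℝ)} (hz : ContDiffOn ℝ ∞ z W) (h1 : ∀ x ∈ W, ‖z x‖ = 1) :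
    const a hz * star (const a hz) = 1 :=
  ext_fn fun p hp => by
    rw [fn_mul, fn_star, fn_const hz hp, fn_one hp, Complex.mul_conj, Complex.normSq_eq_norm_sq,
      h1 _ hp.2]
    norm_num

theorem fn_par_const {a : Ioi (0 : ℝ)} (hz : ContDiffOn ℝ ∞ z W) (A : Fin 2) {p : ℝ × E2}
    (hp : p ∈ slab a W) : (par A (const a hz)).fn p = pd A z p.2 :=
  (pd_eq_fn_par _ hp.1 (fun x hx => (fn_const hz (p := (p.1, x)) ⟨hp.1, hx⟩).symm) A hp.2).symm

/-- The pointwise form of the relation between fields on two patches. -/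
theorem related_of_fieldsRelated {a : Ioi (0 : ℝ)} (ht : ContDiffOn ℝ ∞ t W) (hm : MapsTo t W U')
    (hz : ContDiffOn ℝ ∞ z W) {L' : Comp → SmoothFn a U'} {L : Comp → SmoothFn a W}
    (h : (pullback a ht hm).FieldsRelated (const a hz) L' L) {s v u : ℝ} {x : E2}
    (hp : (s, x) ∈ slab a W) (hL : ∀ c, F c v u x = (L c).fn (s, x))
    (hL' : ∀ c, F' c v u (t x) = (L' c).fn (s, t x)) : Related F F' t z v u x := by
  have e := fun {f g : SmoothFn a W} (h : f = g) => congrArg (fun f => fn f (s, x)) h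
  have hsum : ∀ w : Fin 2 → SmoothFn a W, (along w (const a hz)).fn (s, x)
      = ∑ A, (w A).fn (s, x) * pd A z x := fun w => by
    rw [along_apply, Fin.sum_univ_two, fn_add, fn_mul, fn_mul, fn_par_const hz _ hp,
      fn_par_const hz _ hp]
  constructor
  · intro A
    have := e (h.C A)
    simp only [fn_pullback ht hm _ hp, fn_push ht hm _ _ hp] at this
    simpa only [hL, hL'] using this
  · intro A
    have := e (h.P A)
    simp only [fn_pullback ht hm _ hp, fn_mul, fn_push ht hm _ _ hp, fn_const hz hp] at this
    simpa only [hL, hL'] using this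
  all_goals simp only [hL, hL']
  · simpa only [fn_pullback ht hm _ hp] using e h.Q
  · simpa only [fn_pullback ht hm _ hp, fn_add, fn_mul, fn_star, fn_half hp, fn_const hz hp, hsum]
      using e h.eps
  · simpa only [fn_pullback ht hm _ hp, fn_add, fn_mul, fn_star, fn_half hp, fn_const hz hp, hsum]
      using e h.pi
  · simpa only [fn_pullback ht hm _ hp, fn_add, fn_mul, fn_star, fn_half hp, fn_const hz hp, hsum,
      Core.dl, coreOf_P]
      using e h.beta
  · simpa only [fn_pullback ht hm _ hp, fn_add, fn_mul, fn_star, fn_half hp, fn_const hz hp, hsum]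
      using e h.mu
  · simpa only [fn_pullback ht hm _ hp, fn_sub, fn_mul, fn_star, fn_half hp, fn_const hz hp, hsum,
      Core.dl, coreOf_P]
      using e h.alpha
  · simpa only [fn_pullback ht hm _ hp, fn_mul, fn_star, fn_const hz hp, pow_two]
      using e h.lam
  · simpa only [fn_pullback ht hm _ hp, fn_mul, fn_star, fn_const hz hp, pow_two]
      using e h.tau
  · simpa only [fn_pullback ht hm _ hp, fn_mul, fn_star, fn_const hz hp, pow_two]
      using e h.sigma
  · simpa only [fn_pullback ht hm _ hp, fn_mul, fn_star, fn_const hz hp, pow_two]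
      using e h.rho
  · simpa only [fn_pullback ht hm _ hp, fn_mul, fn_star, fn_const hz hp, pow_two]
      using e h.Psi0
  · simpa only [fn_pullback ht hm _ hp, fn_mul, fn_star, fn_const hz hp, pow_two]
      using e h.Psi1
  · simpa only [fn_pullback ht hm _ hp, fn_mul, fn_star, fn_const hz hp, pow_two]
      using e h.Psi2
  · simpa only [fn_pullback ht hm _ hp, fn_mul, fn_star, fn_const hz hp, pow_two]
      using e h.Psi3
  · simpa only [fn_pullback ht hm _ hp, fn_mul, fn_star, fn_const hz hp, pow_two]
      using e h.Psi4

theorem Induces.eps_eq {U : Set E2} (h : Induces U v₁ u₁ F r) (hg : BoundaryGauge U v₁ u₁ F)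
    {v : ℝ} (hv : v ∈ Ico 0 v₁) {x : E2} (hx : x ∈ U) : F .eps v 0 x = (r.epsSum v x : ℂ) / 2 := by
  have h1 := h.epsSum v hv x hx
  rw [hg.eps_real v hv x hx] at h1
  rw [← h1]
  ring

/-- The data live on half-open intervals and the rings on closed ones; each point is reached by a
closed slab ending at the midpoint. -/
theorem exists_between_zero {b v : ℝ} (hv : v ∈ Ico 0 b) :
    ∃ a : Ioi (0 : ℝ), v ∈ Icc 0 (a : ℝ) ∧ (a : ℝ) < b :=
  ⟨⟨(v + b) / 2, by have := hv.1; have := hv.2; simp only [mem_Ioi]; linarith⟩,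
    ⟨hv.1, by have := hv.2; change v ≤ (v + b) / 2; linarith⟩,
    by have := hv.2; change (v + b) / 2 < b; linarith⟩

/-- Full data sets whose reduced data are related, are related. -/
theorem compatibleOn_of_compatible (ht : ContDiffOn ℝ ∞ t W) (hm : MapsTo t W U')
    (hv : 0 < v₁) (hu : 0 < u₁) (hvmax : v₁ ≤ vmax) (humax : u₁ ≤ umax)
    (hF : IsCharacteristicData W v₁ u₁ F) (hr : Induces W v₁ u₁ F r)
    (hF' : IsCharacteristicData U' v₁ u₁ F') (hr' : Induces U' v₁ u₁ F' r')
    (hc : r.Compatible r' t z W vmax umax) : CompatibleOn F F' t z W v₁ u₁ := by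
  have hz := hc.z_smooth
  have hv0 : (0 : ℝ) ∈ Ico 0 v₁ := ⟨le_rfl, hv⟩
  have hu0 : (0 : ℝ) ∈ Ico 0 u₁ := ⟨le_rfl, hu⟩
  have hvm : ∀ {v}, v ∈ Ico 0 v₁ → v ∈ Ico 0 vmax := fun h => ⟨h.1, h.2.trans_le hvmax⟩
  have hum : ∀ {u}, u ∈ Ico 0 u₁ → u ∈ Ico 0 umax := fun h => ⟨h.1, h.2.trans_le humax⟩
  have heps : ∀ v ∈ Ico 0 v₁, ∀ x ∈ W, F' .eps v 0 (t x) = F .eps v 0 x := fun v hv x hx => by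
    rw [hr'.eps_eq hF'.boundary_gauge hv (hm hx), hr.eps_eq hF.boundary_gauge hv hx,
      hc.epsSum v (hvm hv) x hx]
  have hPsi0 : ∀ v ∈ Ico 0 v₁, ∀ x ∈ W, F' (.Psi 0) v 0 (t x) = z x ^ 2 * F (.Psi 0) v 0 x :=
    fun v hv x hx => by
      rw [hr'.Psi0 v hv _ (hm hx), hr.Psi0 v hv x hx, hc.Psi0 v (hvm hv) x hx]
  have hPsi4 : ∀ u ∈ Ico 0 u₁, ∀ x ∈ W,
      F' (.Psi 4) 0 u (t x) = conj (z x) ^ 2 * F (.Psi 4) 0 u x :=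
    fun u hu x hx => by
      rw [hr'.Psi4 u hu _ (hm hx), hr.Psi4 u hu x hx, hc.Psi4 u (hum hu) x hx]
  have hP : ∀ A, ∀ x ∈ W, F' (.P A) 0 0 (t x) = z x * push t x (fun B => F (.P B) 0 0 x) A :=
    fun A x hx => by
      simp only [hr'.P A _ (hm hx), hr.P _ x hx, hc.P x hx]
  have hrho : ∀ x ∈ W, F' .rho 0 0 (t x) = F .rho 0 0 x := fun x hx => by
    rw [hr'.rho _ (hm hx), hr.rho x hx, hc.rho x hx]
  have hmu : ∀ x ∈ W, F' .mu 0 0 (t x) = F .mu 0 0 x := fun x hx => by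
    rw [hr'.mu _ (hm hx), hr.mu x hx, hc.mu x hx]
  have hsigma : ∀ x ∈ W, F' .sigma 0 0 (t x) = z x ^ 2 * F .sigma 0 0 x := fun x hx => by
    rw [hr'.sigma _ (hm hx), hr.sigma x hx, hc.sigma x hx]
  have hlam : ∀ x ∈ W, F' .lam 0 0 (t x) = conj (z x) ^ 2 * F .lam 0 0 x := fun x hx => by
    rw [hr'.lam _ (hm hx), hr.lam x hx, hc.lam x hx]
  have hpi : ∀ x ∈ W, F' .pi 0 0 (t x) = conj (z x) * F .pi 0 0 x := fun x hx => by
    rw [hr'.pi _ (hm hx), hr.pi x hx, hc.pi x hx]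
  constructor
  · intro v hv' x hx
    obtain ⟨a, hva, ha⟩ := exists_between_zero hv'
    have hsub : Icc 0 (a : ℝ) ⊆ Ico 0 v₁ := fun s hs => ⟨hs.1, hs.2.trans_lt ha⟩
    have h0a : (0 : ℝ) ∈ Icc 0 (a : ℝ) := ⟨le_rfl, le_of_lt a.2⟩
    obtain ⟨L, hL, hE, -, q, hq⟩ := hF.exists_out hu ha
    obtain ⟨L', hL', hE', ⟨e, he⟩, -⟩ := hF'.exists_out hu ha
    have hdata : (pullback a ht hm).DataRelated (const a hz) (coreOf L') (coreOf L) := by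
      constructor
      · refine ext_fn fun p hp => ?_
        have := heps p.1 (hsub hp.1) p.2 hp.2
        rw [fn_pullback ht hm _ hp]
        rwa [hL' _ _ hp.1 _ (hm hp.2), hL _ _ hp.1 _ hp.2] at this
      · refine ext_fn fun p hp => ?_
        have := hPsi0 p.1 (hsub hp.1) p.2 hp.2
        rw [fn_pullback ht hm _ hp, pow_two, fn_mul, fn_mul, fn_const hz hp, ← pow_two]
        rwa [hL' _ _ hp.1 _ (hm hp.2), hL _ _ hp.1 _ hp.2] at this
      · refine fun A => ext_fn fun p hp => ?_
        have := hP A p.2 hp.2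
        have hp0 := zero_mem_slab hp
        rw [fn_ev _ hp, fn_ev _ hp, fn_pullback ht hm _ hp0, fn_mul, fn_const hz hp0,
          fn_push ht hm _ _ hp0]
        simpa only [hL' _ _ h0a _ (hm hp.2), hL _ _ h0a _ hp.2, coreOf_P] using this
      all_goals
        refine ext_fn fun p hp => ?_
        have hp0 := zero_mem_slab hp
        rw [fn_ev _ hp, fn_ev _ hp, fn_pullback ht hm _ hp0]
        try simp only [pow_two, fn_mul, fn_star, fn_const hz hp0]
        try simp only [← pow_two]
        try simp only [coreOf_rho, coreOf_mu, coreOf_sigma, coreOf_lam, coreOf_Psi4]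
      · simpa only [hL' _ _ h0a _ (hm hp.2), hL _ _ h0a _ hp.2] using hrho p.2 hp.2
      · simpa only [hL' _ _ h0a _ (hm hp.2), hL _ _ h0a _ hp.2] using hsigma p.2 hp.2
      · simpa only [hL' _ _ h0a _ (hm hp.2), hL _ _ h0a _ hp.2] using hmu p.2 hp.2
      · simpa only [hL' _ _ h0a _ (hm hp.2), hL _ _ h0a _ hp.2] using hlam p.2 hp.2
      · rw [Core.pi_coreOf hE.pi, Core.pi_coreOf hE'.pi]
        simpa only [hL' _ _ h0a _ (hm hp.2), hL _ _ h0a _ hp.2] using hpi p.2 hp.2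
      · simpa only [hL' _ _ h0a _ (hm hp.2), hL _ _ h0a _ hp.2] using hPsi4 0 hu0 p.2 hp.2
    exact related_of_fieldsRelated ht hm hz
      (hdata.fieldsRelated_out (const_unitary hz hc.z_norm) (D_const hz) hE' hE he hq)
      ⟨hva, hx⟩ (fun c => hL c v hva x hx) fun c => hL' c v hva _ (hm hx)
  · intro v hv' x hx
    obtain ⟨a, hva, ha⟩ := exists_between_zero hv'
    have hsub : Icc 0 (a : ℝ) ⊆ Ico 0 u₁ := fun s hs => ⟨hs.1, hs.2.trans_lt ha⟩
    have h0a : (0 : ℝ) ∈ Icc 0 (a : ℝ) := ⟨le_rfl, le_of_lt a.2⟩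
    obtain ⟨L, hL, hE, -⟩ := hF.exists_in hv ha
    obtain ⟨L', hL', hE', e, he⟩ := hF'.exists_in hv ha
    -- On `𝒩⋆'` the comparison is made for the exchanged unknowns, so each prescribed component
    -- appears with a sign, a conjugate or both.
    have hπ : ((coreOf L).prime 0).pi = -star (L .pi) := by
      rw [hE.pi]; simp [Core.pi, Core.prime]
    have hπ' : ((coreOf L').prime 0).pi = -star (L' .pi) := by
      rw [hE'.pi]; simp [Core.pi, Core.prime]
    have hdata : (pullback a ht hm).DataRelated (star (const a hz)) ((coreOf L').prime 0)
        ((coreOf L).prime 0) := by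
      constructor
      · simp [Core.prime]
      · refine ext_fn fun p hp => ?_
        have := hPsi4 p.1 (hsub hp.1) p.2 hp.2
        rw [fn_pullback ht hm _ hp, pow_two, fn_mul, fn_mul, fn_star, fn_const hz hp, ← pow_two]
        rwa [hL' _ _ hp.1 _ (hm hp.2), hL _ _ hp.1 _ hp.2] at this
      · refine fun A => ext_fn fun p hp => ?_
        have := congrArg conj (hP A p.2 hp.2)
        have hp0 := zero_mem_slab hp
        rw [fn_ev _ hp, fn_ev _ hp, fn_pullback ht hm _ hp0, fn_mul, fn_star, fn_const hz hp0,
          fn_push ht hm _ _ hp0]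
        simp only [hL' _ _ h0a _ (hm hp.2), hL _ _ h0a _ hp.2, push, map_mul, map_sum,
          Complex.conj_ofReal] at this
        simpa only [Core.prime, push, fn_star, coreOf_P] using this
      all_goals
        refine ext_fn fun p hp => ?_
        have hp0 := zero_mem_slab hp
        rw [fn_ev _ hp, fn_ev _ hp, fn_pullback ht hm _ hp0]
        try simp only [hπ, hπ']
        try simp only [pow_two, fn_mul, fn_star, fn_const hz hp0, star_star, fn_neg]
        try simp only [← pow_two, Core.prime, fn_neg, coreOf_rho, coreOf_mu, coreOf_sigma,
          coreOf_lam,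
          coreOf_Psi0]
      · simpa only [hL' _ _ h0a _ (hm hp.2), hL _ _ h0a _ hp.2, neg_inj] using hmu p.2 hp.2
      · have := hlam p.2 hp.2
        simp only [hL' _ _ h0a _ (hm hp.2), hL _ _ h0a _ hp.2] at this
        linear_combination -this
      · simpa only [hL' _ _ h0a _ (hm hp.2), hL _ _ h0a _ hp.2, neg_inj] using hrho p.2 hp.2
      · have := hsigma p.2 hp.2
        simp only [hL' _ _ h0a _ (hm hp.2), hL _ _ h0a _ hp.2] at this
        linear_combination -this
      · have := congrArg conj (hpi p.2 hp.2)
        simp only [hL' _ _ h0a _ (hm hp.2), hL _ _ h0a _ hp.2, map_mul, Complex.conj_conj] at this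
        linear_combination -this
      · simpa only [hL' _ _ h0a _ (hm hp.2), hL _ _ h0a _ hp.2] using hPsi0 0 hv0 p.2 hp.2
    refine related_of_fieldsRelated ht hm hz
      (hdata.fieldsRelated_in (ext_fn fun p hp => ?_) (const_unitary hz hc.z_norm) (D_const hz)
        hE' hE he)
      ⟨hva, hx⟩ (fun c => hL c v hva x hx) fun c => hL' c v hva _ (hm hx)
    have hp0 := zero_mem_slab hp
    rw [fn_ev _ hp, fn_ev _ hp, fn_pullback ht hm _ hp0]
    simpa only [hL' _ _ h0a _ (hm hp.2), hL _ _ h0a _ hp.2] using heps 0 hv0 p.2 hp.2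

/-- The reduced data determine the full data set. -/
theorem agreeOn_of_induces {U : Opens E2} {G : Fields} (hv : 0 < v₁) (hu : 0 < u₁)
    (hF : IsCharacteristicData U v₁ u₁ F) (hr : Induces U v₁ u₁ F r)
    (hG : IsCharacteristicData U v₁ u₁ G) (hr' : Induces U v₁ u₁ G r) : AgreeOn U v₁ u₁ F G := by
  have hpush : ∀ x w A, push id x w A = w A := fun x w A => by
    fin_cases A <;> simp [push]
  -- Uniqueness is compatibility of two data sets under the identity map and the trivial spin.
  have hc : r.Compatible r id 1 U v₁ u₁ := by
    constructor <;> intros <;> try simp [hpush]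
    exact contDiffOn_const
  obtain ⟨h1, h2⟩ := compatibleOn_of_compatible contDiffOn_id (mapsTo_id _) hv hu le_rfl le_rfl
    hF hr hG hr' hc
  have hpd : ∀ A x, pd A (1 : E2 → ℂ) x = 0 := fun A x => by
    rw [pd, show (1 : E2 → ℂ) = fun _ => 1 from rfl]; simp
  have key : ∀ {v u x}, Related F G id 1 v u x → ∀ c, F c v u x = G c v u x := by
    intro v u x h c
    cases c with
    | C A => simpa [hpush] using (h.C A).symm
    | P A => simpa [hpush] using (h.P A).symm
    | Q => simpa using h.Q.symm
    | eps => simpa [hpd] using h.eps.symm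
    | pi => simpa using h.pi.symm
    | beta => simpa [hpd] using h.beta.symm
    | mu => simpa using h.mu.symm
    | alpha => simpa [hpd] using h.alpha.symm
    | lam => simpa using h.lam.symm
    | tau => simpa using h.tau.symm
    | sigma => simpa using h.sigma.symm
    | rho => simpa using h.rho.symm
    | Psi k =>
      fin_cases k
      · simpa using h.Psi0.symm
      · simpa using h.Psi1.symm
      · simpa using h.Psi2.symm
      · simpa using h.Psi3.symm
      · simpa using h.Psi4.symm
  exact fun c => ⟨fun v hv x hx => key (h1 v hv x hx) c, fun u hu x hx => key (h2 u hu x hx) c⟩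

end StewartGauge

namespace StewartGauge
open TransportRing Set TopologicalSpace SmoothFn

/-! ### Existence of full data sets on a coordinate patch -/

section RingExistence

variable {R : Type*} [CommRing R] [StarRing R] [TransportRing R]

/-- The fields with given transported unknowns, and `π = α + β̄`. -/
def fieldsOf (k : Core R) (C : Fin 2 → R) (Q tau : R) : Comp → R
  | .C A => C A
  | .P A => k.P A
  | .Q => Q
  | .eps => k.eps
  | .pi => k.pi
  | .beta => k.beta
  | .mu => k.mu
  | .alpha => k.alpha
  | .lam => k.lam
  | .tau => tau
  | .sigma => k.sigma
  | .rho => k.rho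
  | .Psi 0 => k.Psi0
  | .Psi 1 => k.Psi1
  | .Psi 2 => k.Psi2
  | .Psi 3 => k.Psi3
  | .Psi 4 => k.Psi4

theorem coreOf_fieldsOf (k : Core R) (C : Fin 2 → R) (Q tau : R) :
    coreOf (fieldsOf k C Q tau) = k := rfl

/-- On `𝒮⋆` one has `Q = 1`, so `δQ = 0`; this matches `τ` with its value from `𝒩⋆'`. -/
theorem OutEqs.ev_tau {L : Comp → R} (h : OutEqs L) : ev (L .tau) = ev (star (L .pi)) := by
  have h1 := congrArg ev h.Q_tau
  rw [Core.ev_dl, map_mul, h.Q_atZero, show (coreOf L).atZero.dl 1 = 0 from along_one _, map_sub] at h1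
  linear_combination -h1

/-- The source of `C` is a sum of conjugate terms and `C` starts at zero. -/
theorem InEqs.C_real {L : Comp → R} (h : InEqs L) (A : Fin 2) :
    star (L (.C A)) = L (.C A) := by
  rw [← sub_eq_zero]
  refine eq_zero_of_scalar (c := 0) (d := 0) ?_ ?_
  · rw [map_sub, D_star, h.C]
    simp only [star_sub, star_mul', star_neg, star_ofNat, star_star]
    ring
  · rw [map_sub, ev_star, h.C_atZero, star_zero, sub_zero]

/-- A real invertible solution of `D S = -ε S`. -/
theorem exists_unit {eps : R} (he : star eps = eps) :
    ∃ S T : R, D S = -eps * S ∧ ev S = 1 ∧ star S = S ∧ S * T = 1 := by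
  obtain ⟨S, hS, hS0⟩ := exists_scalar (-eps) 0 0 (1 : R)
  obtain ⟨T, hT, hT0⟩ := exists_scalar eps 0 0 (1 : R)
  simp only [zero_mul, add_zero, map_one] at hS hT hS0 hT0
  refine ⟨S, T, hS, hS0, ?_, ?_⟩
  · rw [← sub_eq_zero]
    refine eq_zero_of_scalar (c := -eps) (d := 0) ?_ ?_
    · rw [map_sub, D_star, hS, star_mul', star_neg, he]
      ring
    · rw [map_sub, ev_star, hS0, star_one, sub_self]
  · rw [eq_ev_of_D_eq_zero (y := S * T), map_mul, hS0, hT0, mul_one]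
    rw [D_mul, hS, hT]
    ring

theorem Core.prime_atZero (f : Core R) (eps : R) : (f.prime eps).atZero = f.atZero.prime (ev eps) :=
  Core.ext (funext fun _ => ev_star _) (map_neg ev _) (map_neg ev _) (map_neg ev _) (map_neg ev _)
    (map_neg ev _) (map_neg ev _) rfl rfl rfl rfl rfl rfl

/-- Writing `Q = S²` with `S` real and invertible makes positivity of `Q` visible in the ring. -/
theorem exists_outEqs (f₀ : Core R) (he : star f₀.eps = f₀.eps) (hre : f₀.atZero.IsReal)
    (hs : f₀.atZero.Sphere) {a b a' b' e : R}
    (h : Core.RiccatiSolution f₀.eps f₀.Psi0 f₀.rho f₀.sigma a b a' b')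
    (hu : (a * star a - b * star b) * e = 1) :
    ∃ L : Comp → R, OutEqs L ∧ L .eps = f₀.eps ∧ L (.Psi 0) = f₀.Psi0 ∧
      (coreOf L).atZero = f₀.atZero ∧
      (coreOf L).frameDet * (a * star a - b * star b) = ev f₀.frameDet ∧
      ∃ S T, L .Q = S * S ∧ star S = S ∧ S * T = 1 := by
  obtain ⟨f, ht, hsph, hreal, hfe, hfΨ, hstart, hdet⟩ := Core.exists_transport f₀ he hre hs h hu
  obtain ⟨S, T, hS, hS0, hSr, hST⟩ := exists_unit hreal.eps
  -- The value of `τ` solves `δQ = (τ - π̄)Q`, since `δQ / Q = 2 δS / S` and `T` is the inverse of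
  -- `S`.
  refine ⟨fieldsOf f (fun _ => 0) (S * S) (star f.pi + 2 * f.dl S * T),
    ⟨ht, hsph, hreal, rfl, fun _ => rfl, ?_, ?_, ?_, ?_⟩, hfe, hfΨ, hstart, hdet, S, T, rfl, hSr,
    hST⟩
  · simp only [fieldsOf, D_mul, hS]
    ring
  · rw [coreOf_fieldsOf]
    simp only [fieldsOf, Core.dl_mul]
    linear_combination -2 * f.dl S * S * hST
  · simp only [fieldsOf, star_mul', hSr]
  · simp only [fieldsOf, map_mul, hS0, mul_one]

/-- The hierarchy is solved for the exchanged unknowns with vanishing `ε` and then exchanged back;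
the true `ε` and `C` are quadratures. -/
theorem exists_inEqs (g₀ : Core R) (eps₀ : R) (he : g₀.eps = 0) (hre : g₀.atZero.IsReal)
    (hs : g₀.atZero.Sphere) {a b a' b' e : R}
    (h : Core.RiccatiSolution g₀.eps g₀.Psi0 g₀.rho g₀.sigma a b a' b')
    (hu : (a * star a - b * star b) * e = 1) :
    ∃ L : Comp → R, InEqs L ∧ L (.Psi 4) = g₀.Psi0 ∧
      (coreOf L).atZero = (g₀.prime eps₀).atZero ∧
      (coreOf L).frameDet * (a * star a - b * star b) = ev (-g₀.frameDet) := by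
  obtain ⟨g, ht, hsph, hreal, hge, hgΨ, hstart, hdet⟩ :=
    Core.exists_transport g₀ (by rw [he, star_zero]) hre hs h hu
  set k := g.prime 0 with hk
  obtain ⟨eps, heps, heps0⟩ := exists_scalar 0 0 (-k.Psi2 - 2 * k.beta * k.pi
    - 2 * k.alpha * star k.pi - k.pi * star k.pi) eps₀
  choose C hC hC0 using fun A => exists_scalar 0 0 (-2 * k.pi * k.P A
    - 2 * star k.pi * star (k.P A)) (0 : R)
  have hgg : (coreOf (fieldsOf (g.prime eps) C 1 (star k.pi))).prime 0 = g := by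
    rw [coreOf_fieldsOf]
    ext <;> simp [Core.prime, hge, he]
  refine ⟨fieldsOf (g.prime eps) C 1 (star k.pi),
    ⟨by rwa [hgg], hsph.prime _, ?_, ?_, rfl, rfl, rfl, fun A => ?_, fun A => ?_, ?_⟩, hgΨ, ?_, ?_⟩
  · simp [fieldsOf, Core.prime, hreal.mu]
  · simp [fieldsOf, Core.prime, hreal.rho]
  · simp only [zero_mul, zero_add] at hC
    exact hC A
  · simp only [map_zero] at hC0
    exact hC0 A
  · simp only [zero_mul, zero_add] at heps
    exact heps
  · rw [coreOf_fieldsOf, Core.prime_atZero, Core.prime_atZero, hstart, heps0]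
  · rw [coreOf_fieldsOf, map_neg, ← hdet]
    simp only [Core.frameDet, Core.prime, star_star]
    ring

end RingExistence

variable {a b : Ioi (0 : ℝ)} {U : Opens E2} {F : Fields}

/-- Fields whose restrictions to `𝒩⋆` and `𝒩⋆'` satisfy the equations form a full data set. -/
theorem isCharacteristicData_of_eqs {L : Comp → SmoothFn a U} {L' : Comp → SmoothFn b U}
    (hL : IsOut F L) (hL' : IsIn F L') (h : OutEqs L) (h' : InEqs L')
    (hd : ∀ p ∈ slab a U, (coreOf L).frameDet.fn p ≠ 0)
    (hd' : ∀ p ∈ slab b U, (coreOf L').frameDet.fn p ≠ 0)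
    (hQ : ∀ p ∈ slab a U, 0 < ((L .Q).fn p).re) : IsCharacteristicData U a b F := by
  have hC : ∀ v ∈ Ico 0 (a : ℝ), ∀ x ∈ U, ∀ A, F (.C A) v 0 x = 0 := fun v hv x hx A => by
    rw [hL _ v (Ico_subset_Icc_self hv) x hx, h.C, fn_zero]
  have hQ1 : ∀ u ∈ Ico 0 (b : ℝ), ∀ x ∈ U, F .Q 0 u x = 1 := fun u hu x hx => by
    rw [hL' _ u (Ico_subset_Icc_self hu) x hx, h'.Q, fn_one (mem_slab_of_Ico hu hx)]
  refine ⟨fun c => ?_, fun c => ?_, ⟨hC, fun v hv x hx => ?_, hQ1⟩, fun v hv x hx => ?_,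
    fun u hu x hx => ?_, fun v hv x hx => ?_, fun u hu x hx => ?_, fun v hv x hx => ?_,
    fun u hu x hx => ?_⟩
  · refine ((L c).contDiffOn_fn.mono (prod_mono Ico_subset_Icc_self subset_rfl)).congr ?_
    exact fun p hp => hL c p.1 (Ico_subset_Icc_self hp.1) p.2 hp.2
  · refine ((L' c).contDiffOn_fn.mono (prod_mono Ico_subset_Icc_self subset_rfl)).congr ?_
    exact fun p hp => hL' c p.1 (Ico_subset_Icc_self hp.1) p.2 hp.2
  · rw [hL _ v (Ico_subset_Icc_self hv) x hx, ← fn_star]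
    exact congrArg (fun f => fn f (v, x)) h.real.eps
  · rw [hL.val hv hx]
    have hs := evalAt_star (mem_slab_of_Ico hv hx)
    refine ⟨fun A => ?_, ?_, hQ _ (mem_slab_of_Ico hv hx), ?_, ?_, ?_, ?_⟩
    · rw [h.C, map_zero, map_zero]
    · rw [← hs, h.Q_real]
    · simp only [← hs, ← map_mul, ← map_sub]
      exact hd _ (mem_slab_of_Ico hv hx)
    · rw [← hs]; exact congrArg _ h.real.rho
    · rw [← hs]; exact congrArg _ h.real.mu
    · simp only [← hs, ← map_add, h.pi]
  · rw [hL'.val hu hx]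
    have hs := evalAt_star (mem_slab_of_Ico hu hx)
    refine ⟨fun A => ?_, ?_, ?_, ?_, ?_, ?_, ?_⟩
    · rw [← hs, h'.C_real]
    · rw [h'.Q, map_one, map_one]
    · rw [h'.Q, map_one]; norm_num
    · simp only [← hs, ← map_mul, ← map_sub]
      exact hd' _ (mem_slab_of_Ico hu hx)
    · rw [← hs, h'.rho_real]
    · rw [← hs, h'.mu_real]
    · simp only [← hs, ← map_add, h'.pi]
  · rw [hL.val hv hx, hL.opD hv hx (hC v hv x hx), hL.opd hv hx, hL.opdb hv hx]
    refine h.outgoingEqs (evalAt_star _) fun h0 => ?_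
    exact ne_of_gt (hQ _ (mem_slab_of_Ico hv hx)) ((congrArg Complex.re h0).trans Complex.zero_re)
  · rw [hL'.val hu hx, hL'.opDelta hu hx (hQ1 u hu x hx), hL'.opd hu hx, hL'.opdb hu hx]
    exact h'.incomingEqs (evalAt_star _)
  · rw [hL.val hv hx, hL.opd hv hx, hL.opdb hv hx]
    exact h.sphereEqs (evalAt_star _)
  · rw [hL'.val hu hx, hL'.opd hu hx, hL'.opdb hu hx]
    exact h'.sphereEqs (evalAt_star _)

/-! #### The reduced data as elements of the ring of smooth functions -/

/-- `d` is the determinant of the solution of the Riccati equation. -/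
def IsRiccatiDet {R : Type*} [CommRing R] [StarRing R] [TransportRing R]
    (eps Psi0 rho sigma d : R) : Prop :=
  ∃ a b a' b', Core.RiccatiSolution eps Psi0 rho sigma a b a' b' ∧
    d = a * star a - b * star b

/-- As the linearised system has no breakdown, the determinant exists on the whole slab before a
smaller slab is chosen to avoid its zeros. -/
theorem exists_isRiccatiDet {R : Type*} [CommRing R] [StarRing R] [TransportRing R]
    (eps Psi0 rho sigma : R) : ∃ d, IsRiccatiDet eps Psi0 rho sigma d := by
  obtain ⟨a, b, a', b', h⟩ := Core.exists_riccatiSolution eps Psi0 rho sigma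
  exact ⟨_, a, b, a', b', h, rfl⟩

theorem IsRiccatiDet.ev_eq {R : Type*} [CommRing R] [StarRing R] [TransportRing R]
    {eps Psi0 rho sigma d : R} (h : IsRiccatiDet eps Psi0 rho sigma d) : ev d = 1 := by
  obtain ⟨a, b, a', b', h, rfl⟩ := h
  simp [h.ev_a, h.ev_b, ev_star]

namespace ReducedData.IsAdmissible

variable {r : ReducedData} {vmax umax : ℝ}

theorem contDiffOn_rho (hr : r.IsAdmissible U vmax umax) :
    ContDiffOn ℝ ∞ (fun x => (r.rho x : ℂ)) U := Complex.ofRealCLM.contDiff.comp_contDiffOn hr.rho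

theorem contDiffOn_mu (hr : r.IsAdmissible U vmax umax) :
    ContDiffOn ℝ ∞ (fun x => (r.mu x : ℂ)) U := Complex.ofRealCLM.contDiff.comp_contDiffOn hr.mu

theorem contDiffOn_Psi4_zero (hr : r.IsAdmissible U vmax umax) (hu : 0 < umax) :
    ContDiffOn ℝ ∞ (r.Psi4 0) U :=
  hr.Psi4.comp (contDiff_const.prodMk contDiff_id).contDiffOn fun _ hx => ⟨⟨le_rfl, hu⟩, hx⟩

theorem slab_subset {v : ℝ} (ha : (a : ℝ) < v) : slab a U ⊆ Ico 0 v ×ˢ (U : Set E2) :=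
  prod_mono (fun _ hs => ⟨hs.1, hs.2.trans_lt ha⟩) subset_rfl

theorem contDiffOn_eps (hr : r.IsAdmissible U vmax umax) (ha : (a : ℝ) < vmax) :
    ContDiffOn ℝ ∞ (fun p : ℝ × E2 => (r.epsSum p.1 p.2 : ℂ) / 2) (slab a U) :=
  (Complex.ofRealCLM.contDiff.comp_contDiffOn (hr.epsSum.mono (slab_subset ha))).div_const 2

/-- The function `ε` on `𝒩⋆`. -/
def outEps (hr : r.IsAdmissible U vmax umax) (ha : (a : ℝ) < vmax) : SmoothFn a U :=
  SmoothFn.mk _ (hr.contDiffOn_eps ha)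

/-- The function `Ψ₀` on `𝒩⋆`. -/
def outPsi0 (hr : r.IsAdmissible U vmax umax) (ha : (a : ℝ) < vmax) : SmoothFn a U :=
  SmoothFn.mk _ (hr.Psi0.mono (slab_subset ha))

/-- The function `Ψ₄` on `𝒩⋆'`. -/
def inPsi4 (hr : r.IsAdmissible U vmax umax) (hb : (b : ℝ) < umax) : SmoothFn b U :=
  SmoothFn.mk _ (hr.Psi4.mono (slab_subset hb))

/-- `d` is the determinant of the solution of the Riccati equation on `𝒩⋆`. -/
def IsOutDet (hr : r.IsAdmissible U vmax umax) (ha : (a : ℝ) < vmax) (d : SmoothFn a U) : Prop :=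
  IsRiccatiDet (hr.outEps ha) (hr.outPsi0 ha) (const a hr.contDiffOn_rho) (const a hr.sigma) d

/-- `d` is the determinant of the solution of the Riccati equation on `𝒩⋆'`. -/
def IsInDet (hr : r.IsAdmissible U vmax umax) (hb : (b : ℝ) < umax) (d : SmoothFn b U) : Prop :=
  IsRiccatiDet 0 (hr.inPsi4 hb) (-const b hr.contDiffOn_mu) (-const b hr.lam) d

end ReducedData.IsAdmissible

theorem initial_const {z : E2 → ℂ} (hz : ContDiffOn ℝ ∞ z U) :
    initial a b U (const a hz) = const b hz := ext_fn fun p hp => by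
  rw [fn_initial _ hp, fn_const hz hp, fn_const hz (mapsTo_initial a b U hp)]

theorem star_const_ofReal {z : E2 → ℝ} (hz : ContDiffOn ℝ ∞ (fun x => (z x : ℂ)) U) :
    star (const a hz) = const a hz := ext_fn fun p hp => by
  rw [fn_star, fn_const hz hp, Complex.conj_ofReal]

theorem initial_ev (f : SmoothFn a U) : initial a b U (ev f) = initial a b U f :=
  ext_fn fun p hp => by
    rw [fn_initial _ hp, fn_initial _ hp, fn_ev _ (mapsTo_initial a b U hp)]

theorem ev_initial (f : SmoothFn a U) : ev (initial a b U f) = initial a b U f :=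
  ext_fn fun p hp => by
    rw [fn_ev _ hp, fn_initial _ hp, fn_initial _ (zero_mem_slab hp)]

theorem initial_star (f : SmoothFn a U) :
    initial a b U (star f) = star (initial a b U f) := comp_star f

theorem initial_par (A : Fin 2) (f : SmoothFn a U) :
    initial a b U (par A f) = par A (initial a b U f) := ext_fn fun p hp => by
  rw [fn_initial _ hp]
  exact (fn_dir_initial f (0, EuclideanSpace.single A 1) hp).symm

/-- Fields on `𝒩⋆` and on `𝒩⋆'` which agree on `𝒮⋆`. -/
theorem exists_fields {L : Comp → SmoothFn a U} {L' : Comp → SmoothFn b U}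
    (h : ∀ c, initial a b U (L c) = ev (L' c)) : ∃ F : Fields, IsOut F L ∧ IsIn F L' := by
  classical
  -- Values off the two hypersurfaces are irrelevant; on `𝒮⋆` both prescriptions agree by
  -- hypothesis.
  refine ⟨fun c v u x => if u = 0 then (L c).fn (v, x) else (L' c).fn (u, x),
    fun c s hs x hx => if_pos rfl, fun c s hs x hx => ?_⟩
  by_cases h0 : s = 0
  · have hp : ((0 : ℝ), x) ∈ slab b U := ⟨⟨le_rfl, le_of_lt b.2⟩, hx⟩
    have := congrArg (fun f => fn f ((0 : ℝ), x)) (h c)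
    simp only [fn_initial _ hp, fn_ev _ hp] at this
    rw [h0]
    exact (if_pos rfl).trans this
  · exact if_neg h0

/-- Beyond the transported unknowns, the values on `𝒮⋆` are forced: `C = 0`, `Q = 1` and `τ = π̄`
from both sides, with `π` given by `α` and `β`. -/
theorem initial_eq_ev {L : Comp → SmoothFn a U} {L' : Comp → SmoothFn b U} (hL : OutEqs L)
    (hL' : InEqs L') (h : (coreOf L).map (initial a b U) = (coreOf L').atZero) (c : Comp) :
    initial a b U (L c) = ev (L' c) := by
  have hα : initial a b U (L .alpha) = ev (L' .alpha) := congrArg Core.alpha h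
  have hβ : initial a b U (L .beta) = ev (L' .beta) := congrArg Core.beta h
  have hπ : initial a b U (L .pi) = ev (L' .pi) := by
    rw [hL.pi, hL'.pi, map_add, map_add, initial_star, ev_star, hα, hβ]
  cases c with
  | C A => rw [hL.C, hL'.C_atZero, map_zero]
  | P A => exact congrFun (congrArg Core.P h) A
  | Q => rw [← initial_ev, hL.Q_atZero, hL'.Q, map_one, map_one]
  | eps => exact congrArg Core.eps h
  | pi => exact hπ
  | beta => exact hβ
  | mu => exact congrArg Core.mu h
  | alpha => exact hα
  | lam => exact congrArg Core.lam h
  | tau => rw [← initial_ev, hL.ev_tau, initial_ev, hL'.tau, initial_star, ev_star, hπ]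
  | sigma => exact congrArg Core.sigma h
  | rho => exact congrArg Core.rho h
  | Psi k =>
    fin_cases k
    exacts [congrArg Core.Psi0 h, congrArg Core.Psi1 h, congrArg Core.Psi2 h, congrArg Core.Psi3 h,
      congrArg Core.Psi4 h]

theorem re_sq_pos {w : ℂ} (hw : conj w = w) (h0 : w ≠ 0) : 0 < (w * w).re := by
  have him : w.im = 0 := Complex.conj_eq_iff_im.1 hw
  have hre : w.re ≠ 0 := fun h => h0 (Complex.ext h him)
  rw [Complex.mul_re, him]
  have := mul_self_pos.2 hre
  linarith

/-- Existence of the full data set, as long as the solutions of the Riccati equations exist. -/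
theorem ReducedData.IsAdmissible.exists_characteristicData {r : ReducedData} {vmax umax : ℝ}
    (hr : r.IsAdmissible U vmax umax) (ha : (a : ℝ) < vmax) (hb : (b : ℝ) < umax)
    {d : SmoothFn a U} {d' : SmoothFn b U} (hd : hr.IsOutDet ha d) (hd' : hr.IsInDet hb d')
    (hne : ∀ p ∈ slab a U, d.fn p ≠ 0) (hne' : ∀ p ∈ slab b U, d'.fn p ≠ 0) :
    ∃ F, IsCharacteristicData U a b F ∧ Induces U a b F r := by
  have hu : 0 < umax := lt_trans b.2 hb
  obtain ⟨e, he⟩ := exists_inverse hne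
  obtain ⟨e', he'⟩ := exists_inverse hne'
  obtain ⟨A, B, A', B', hR, rfl⟩ := hd
  obtain ⟨A₁, B₁, A₁', B₁', hR', rfl⟩ := hd'
  have hfr : ∀ p ∈ slab a U, (const a (hr.P 0) * star (const a (hr.P 1))
      - const a (hr.P 1) * star (const a (hr.P 0))).fn p ≠ 0 := fun p hp => by
    rw [fn_sub, fn_mul, fn_mul, fn_star, fn_star, fn_const _ hp, fn_const _ hp]
    exact hr.P_indep _ hp.2
  obtain ⟨q, hq⟩ := exists_inverse hfr
  -- The values on `𝒮⋆` are extended independently of `v`, except for `ε` and `Ψ₀`, and for `Ψ₁`,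
  -- `Ψ₂`, `Ψ₃`, which the constraints define. The initial value of `Ψ₄` is taken from `𝒩⋆'`.
  obtain ⟨f₀, hs, hP, hπ, hρ, hσ, hμ, hl, hε, hΨ0, hΨ4⟩ := Core.exists_sphere
    (fun A => const a (hr.P A)) (const a hr.pi) (const a hr.contDiffOn_rho) (const a hr.sigma)
    (const a hr.contDiffOn_mu) (const a hr.lam) (hr.outEps ha) (hr.outPsi0 ha)
    (const a (hr.contDiffOn_Psi4_zero hu)) hq
  have hεr : star f₀.eps = f₀.eps := by
    rw [hε]
    refine ext_fn fun p hp => ?_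
    rw [fn_star, outEps, fn_mk _ hp, map_div₀, Complex.conj_ofReal, map_ofNat]
  have hρr : star f₀.rho = f₀.rho := by rw [hρ, star_const_ofReal]
  have hμr : star f₀.mu = f₀.mu := by rw [hμ, star_const_ofReal]
  have hdet0 : ∀ {x}, x ∈ U → f₀.frameDet.fn (0, x) ≠ 0 := fun {x} hx => by
    rw [Core.frameDet, hP]
    exact hfr _ ⟨⟨le_rfl, le_of_lt a.2⟩, hx⟩
  obtain ⟨L, hL, hLε, hLΨ, hLi, hLdet, S, T, hQ, hSr, hST⟩ := exists_outEqs f₀ hεr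
    ⟨by simp only [Core.atZero, Core.map, ← ev_star, hρr],
      by simp only [Core.atZero, Core.map, ← ev_star, hμr],
      by simp only [Core.atZero, Core.map, ← ev_star, hεr]⟩ hs.atZero
    (by rw [hε, hΨ0, hρ, hσ]; exact hR) he
  set k := f₀.map (initial a b U) with hk
  have hks : k.Sphere := hs.map initial_star initial_par
  -- Starting data for `𝒩⋆'`: the values on `𝒮⋆`, exchanged, with the prescribed `Ψ₄` in the role of
  -- `Ψ₀`. The constraints do not contain this component and survive the replacement.
  set g₀ : Core (SmoothFn b U) := { k.prime 0 with Psi0 := hr.inPsi4 hb } with hg₀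
  have hgs : g₀.Sphere := ⟨(hks.prime 0).frame, (hks.prime 0).ricci_one, (hks.prime 0).ricci_two,
    (hks.prime 0).ricci_three⟩
  have hkρ : star k.rho = k.rho := (initial_star _).symm.trans (congrArg _ hρr)
  have hkμ : star k.mu = k.mu := (initial_star _).symm.trans (congrArg _ hμr)
  obtain ⟨L', hL', hLΨ', hLi', hLdet'⟩ := exists_inEqs g₀ k.eps rfl
    ⟨by simp only [Core.atZero, Core.map, hg₀, Core.prime, ← ev_star, star_neg, hkμ],
      by simp only [Core.atZero, Core.map, hg₀, Core.prime, ← ev_star, star_neg, hkρ],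
      by simp only [Core.atZero, Core.map, hg₀, Core.prime, map_zero, star_zero]⟩ hgs.atZero
    (by
      have h1 : g₀.rho = -const b hr.contDiffOn_mu := by
        simp only [hg₀, Core.prime, hk, Core.map, hμ, initial_const]
      have h2 : g₀.sigma = -const b hr.lam := by
        simp only [hg₀, Core.prime, hk, Core.map, hl, initial_const]
      rw [h1, h2]
      exact hR') he'
  have hki : (g₀.prime k.eps).atZero = k := by
    refine Core.ext (funext fun A => ?_) ?_ ?_ ?_ ?_ ?_ ?_ ?_ ?_ ?_ ?_ ?_ ?_
    · simp only [Core.atZero, Core.map, Core.prime, hg₀, star_star, hk, ev_initial]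
    all_goals try simp only [Core.atZero, Core.map, Core.prime, hg₀, neg_neg, hk, ev_initial]
    rw [hΨ4, initial_const]
    refine ext_fn fun p hp => ?_
    rw [fn_ev _ hp, inPsi4, fn_mk _ (zero_mem_slab hp), fn_const _ hp]
  have hcore : (coreOf L).map (initial a b U) = (coreOf L').atZero := by
    have h1 : (coreOf L).map (initial a b U) = (coreOf L).atZero.map (initial a b U) := by
      simp only [Core.atZero, Core.map, initial_ev]
    rw [h1, hLi, hLi', hki]
    simp only [hk, Core.atZero, Core.map, initial_ev]
  obtain ⟨F, hF, hF'⟩ := exists_fields (initial_eq_ev hL hL' hcore)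
  refine ⟨F, isCharacteristicData_of_eqs hF hF' hL hL' ?_ ?_ ?_, ?_⟩
  -- The frame determinant times the Riccati determinant equals the frame determinant on `𝒮⋆`, which
  -- has no zero.
  · intro p hp h0
    have := congrArg (fun f => fn f p) hLdet
    simp only [fn_mul, h0, zero_mul, fn_ev _ hp] at this
    exact hdet0 hp.2 this.symm
  · intro p hp h0
    have := congrArg (fun f => fn f p) hLdet'
    simp only [fn_mul, h0, zero_mul, fn_ev _ hp] at this
    have h2 : -g₀.frameDet = initial a b U f₀.frameDet := by
      simp only [hg₀, Core.frameDet, Core.prime, hk, Core.map, map_sub, map_mul, initial_star,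
        star_star]
      ring
    rw [h2, fn_initial _ (zero_mem_slab hp)] at this
    exact hdet0 hp.2 this.symm
  · intro p hp
    rw [hQ, fn_mul]
    have h1 := congrArg (fun f => fn f p) hSr
    have h2 := congrArg (fun f => fn f p) hST
    simp only [fn_star, fn_mul, fn_one hp] at h1 h2
    exact re_sq_pos h1 fun h0 => by simp [h0] at h2
  · have h0a : (0 : ℝ) ∈ Icc 0 (a : ℝ) := ⟨le_rfl, le_of_lt a.2⟩
    have hi : ∀ {f g : SmoothFn a U}, ev f = ev g → ∀ x ∈ U, f.fn (0, x) = g.fn (0, x) :=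
      fun {f g} h x hx => by
        have hp : ((0 : ℝ), x) ∈ slab a U := ⟨h0a, hx⟩
        have := congrArg (fun f => fn f ((0 : ℝ), x)) h
        simpa only [fn_ev _ hp] using this
    have hm : ∀ {x}, x ∈ U → ((0 : ℝ), x) ∈ slab a U := fun hx => ⟨h0a, hx⟩
    constructor
    · intro v hv x hx
      rw [hF _ v (Ico_subset_Icc_self hv) x hx, hLΨ, hΨ0, outPsi0, fn_mk _ (mem_slab_of_Ico hv hx)]
    · intro v hv x hx
      rw [hF _ v (Ico_subset_Icc_self hv) x hx, hLε, ← fn_star, hεr, hε, outEps,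
        fn_mk _ (mem_slab_of_Ico hv hx)]
      ring
    · intro u hu x hx
      rw [hF' _ u (Ico_subset_Icc_self hu) x hx, hLΨ']
      exact fn_mk _ (mem_slab_of_Ico hu hx)
    · intro x hx
      rw [hF _ 0 h0a x hx, hi (f := L .lam) (congrArg Core.lam hLi) x hx, hl, fn_const _ (hm hx)]
    · intro x hx
      rw [hF _ 0 h0a x hx, hi (f := L .sigma) (congrArg Core.sigma hLi) x hx, hσ,
        fn_const _ (hm hx)]
    · intro x hx
      rw [hF _ 0 h0a x hx, hi (f := L .mu) (congrArg Core.mu hLi) x hx, hμ, fn_const _ (hm hx)]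
    · intro x hx
      rw [hF _ 0 h0a x hx, hi (f := L .rho) (congrArg Core.rho hLi) x hx, hρ, fn_const _ (hm hx)]
    · intro x hx
      have h1 : ∀ g : Core (SmoothFn a U), g.atZero.pi = ev g.pi := fun g => by
        simp only [Core.pi, map_add, ev_star]; rfl
      have h2 := congrArg Core.pi hLi
      rw [h1, h1, Core.pi_coreOf hL.pi] at h2
      rw [hF _ 0 h0a x hx, hi h2 x hx, hπ, fn_const _ (hm hx)]
    · intro A x hx
      rw [hF _ 0 h0a x hx, hi (f := L (.P A)) (congrFun (congrArg Core.P hLi) A) x hx, hP,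
        fn_const _ (hm hx)]

end StewartGauge

namespace StewartGauge
open TransportRing Set TopologicalSpace SmoothFn

/-! ### Uniform existence -/

namespace SmoothFn

variable {a a' : Ioi (0 : ℝ)} {U W : Opens E2}

/-- Restriction to a smaller slab. -/
def restrict (ha : (a' : ℝ) ≤ a) (hW : W ≤ U) : SmoothFn a U →+* SmoothFn a' W :=
  comp id contDiffOn_id (prod_mono (Icc_subset_Icc_right ha) hW)

variable {ha : (a' : ℝ) ≤ a} {hW : W ≤ U}

theorem fn_restrict (f : SmoothFn a U) {p : ℝ × E2} (hp : p ∈ slab a' W) :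
    (restrict ha hW f).fn p = f.fn p := fn_comp f hp

theorem restrict_star (f : SmoothFn a U) : restrict ha hW (star f) = star (restrict ha hW f) :=
  comp_star f

theorem restrict_D (f : SmoothFn a U) : restrict ha hW (D f) = D (restrict ha hW f) :=
  ext_fn fun p hp => by
    rw [fn_restrict _ hp]
    exact (fn_dir_comp f (1, 0) hp (hasFDerivWithinAt_id p _)).symm

theorem restrict_ev (f : SmoothFn a U) : restrict ha hW (ev f) = ev (restrict ha hW f) :=
  ext_fn fun p hp => by
    have hp' : p ∈ slab a U := ⟨Icc_subset_Icc_right ha hp.1, hW hp.2⟩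
    rw [fn_restrict _ hp, fn_ev _ hp, fn_ev _ hp', fn_restrict _ (zero_mem_slab hp)]

theorem restrict_const {z : E2 → ℂ} (hz : ContDiffOn ℝ ∞ z U) (hz' : ContDiffOn ℝ ∞ z W) :
    restrict ha hW (const a hz) = const a' hz' := ext_fn fun p hp => by
  rw [fn_restrict _ hp, fn_const hz' hp, fn_const hz ⟨Icc_subset_Icc_right ha hp.1, hW hp.2⟩]

theorem restrict_mk {f : ℝ × E2 → ℂ} (hf : ContDiffOn ℝ ∞ f (slab a U))
    (hf' : ContDiffOn ℝ ∞ f (slab a' W)) :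
    restrict ha hW (mk f hf) = mk f hf' := ext_fn fun p hp => by
  rw [fn_restrict _ hp, fn_mk hf' hp, fn_mk hf ⟨Icc_subset_Icc_right ha hp.1, hW hp.2⟩]

/-- Restriction commutes with `D`, conjugation and evaluation, hence preserves the linear system
defining the determinant. -/
theorem isRiccatiDet_restrict {eps Psi0 rho sigma d : SmoothFn a U}
    (h : IsRiccatiDet eps Psi0 rho sigma d) :
    IsRiccatiDet (restrict ha hW eps) (restrict ha hW Psi0) (restrict ha hW rho)
      (restrict ha hW sigma) (restrict ha hW d) := by
  obtain ⟨A, B, A', B', h, rfl⟩ := h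
  exact ⟨_, _, _, _, h.map restrict_star restrict_D restrict_ev rfl rfl, by
    simp only [map_sub, map_mul, restrict_star]⟩

end SmoothFn

namespace ReducedData.IsAdmissible

variable {a a' : Ioi (0 : ℝ)} {U U' W : Opens E2} {r r' : ReducedData} {vmax umax : ℝ}

theorem mono (hr : r.IsAdmissible U vmax umax) (hW : W ≤ U) : r.IsAdmissible W vmax umax where
  Psi0 := hr.Psi0.mono (prod_mono subset_rfl hW)
  epsSum := hr.epsSum.mono (prod_mono subset_rfl hW)
  Psi4 := hr.Psi4.mono (prod_mono subset_rfl hW)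
  lam := hr.lam.mono hW
  sigma := hr.sigma.mono hW
  mu := hr.mu.mono hW
  rho := hr.rho.mono hW
  pi := hr.pi.mono hW
  P A := (hr.P A).mono hW
  P_indep x hx := hr.P_indep x (hW hx)

theorem isOutDet_restrict (hr : r.IsAdmissible U vmax umax) (ha : (a : ℝ) < vmax)
    {d : SmoothFn a U} (hd : hr.IsOutDet ha d) (ha' : (a' : ℝ) ≤ a) (hW : W ≤ U) :
    (hr.mono hW).IsOutDet (ha'.trans_lt ha) (restrict ha' hW d) := by
  have := isRiccatiDet_restrict (ha := ha') (hW := hW) hd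
  rwa [restrict_const _ (hr.mono hW).contDiffOn_rho, restrict_const _ (hr.mono hW).sigma, outEps,
    outPsi0, restrict_mk _ ((hr.mono hW).contDiffOn_eps (ha'.trans_lt ha)),
    restrict_mk _ ((hr.mono hW).Psi0.mono (slab_subset (ha'.trans_lt ha)))] at this

theorem isInDet_restrict (hr : r.IsAdmissible U vmax umax) (ha : (a : ℝ) < umax)
    {d : SmoothFn a U} (hd : hr.IsInDet ha d) (ha' : (a' : ℝ) ≤ a) (hW : W ≤ U) :
    (hr.mono hW).IsInDet (ha'.trans_lt ha) (restrict ha' hW d) := by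
  have := isRiccatiDet_restrict (ha := ha') (hW := hW) hd
  rwa [map_zero, map_neg, map_neg, restrict_const _ (hr.mono hW).contDiffOn_mu,
    restrict_const _ (hr.mono hW).lam, inPsi4,
    restrict_mk _ ((hr.mono hW).Psi4.mono (slab_subset (ha'.trans_lt ha)))] at this

variable {t : E2 → E2} {z : E2 → ℂ}

/-- The determinant depends only on `ε`, `Ψ₀` and the initial `ρ`, `σ`, and its spin weight is zero.
So the determinants of the patches define a single function near `𝒮⋆`. -/
theorem outDet_eq (hr : r.IsAdmissible W vmax umax) (hr' : r'.IsAdmissible U' vmax umax)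
    (ha : (a : ℝ) < vmax) {d : SmoothFn a W} {d' : SmoothFn a U'} (hd : hr.IsOutDet ha d)
    (hd' : hr'.IsOutDet ha d') (ht : ContDiffOn ℝ ∞ t W) (hm : MapsTo t W U')
    (hc : r.Compatible r' t z W vmax umax) {p : ℝ × E2} (hp : p ∈ slab a W) :
    d'.fn (p.1, t p.2) = d.fn p := by
  have hz := hc.z_smooth
  obtain ⟨A, B, A', B', h, rfl⟩ := hd
  obtain ⟨A₁, B₁, A₁', B₁', h₁, rfl⟩ := hd'
  rw [← fn_pullback ht hm _ hp]
  refine congrArg (fun f => fn f p) ((pullback a ht hm).riccati_det h₁ h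
    (const_unitary hz hc.z_norm) (D_const hz) ?_ ?_ ?_ ?_)
  · refine ext_fn fun q hq => ?_
    have hs := slab_subset ha hq
    rw [fn_pullback ht hm _ hq, outEps, outEps, fn_mk _ hq, fn_mk _ (mapsTo_lift hm hq)]
    simp only [hc.epsSum q.1 hs.1 q.2 hq.2]
  · refine ext_fn fun q hq => ?_
    have hs := slab_subset ha hq
    rw [fn_pullback ht hm _ hq, outPsi0, outPsi0, pow_two, fn_mul, fn_mul, fn_const _ hq,
      fn_mk _ hq, fn_mk _ (mapsTo_lift hm hq)]
    simp only [hc.Psi0 q.1 hs.1 q.2 hq.2, pow_two]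
  · refine congrArg ev (ext_fn fun q hq => ?_)
    rw [fn_pullback ht hm _ hq, fn_const _ hq, fn_const _ (mapsTo_lift hm hq)]
    simp only [hc.rho q.2 hq.2]
  · refine congrArg ev (ext_fn fun q hq => ?_)
    rw [fn_pullback ht hm _ hq, pow_two, fn_mul, fn_mul, fn_const _ hq, fn_const _ hq,
      fn_const _ (mapsTo_lift hm hq)]
    simp only [hc.sigma q.2 hq.2, pow_two]

/-- The same argument for the exchanged data, with spin `z̄` and `ε = 0`. -/
theorem inDet_eq (hr : r.IsAdmissible W vmax umax) (hr' : r'.IsAdmissible U' vmax umax)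
    (ha : (a : ℝ) < umax) {d : SmoothFn a W} {d' : SmoothFn a U'} (hd : hr.IsInDet ha d)
    (hd' : hr'.IsInDet ha d') (ht : ContDiffOn ℝ ∞ t W) (hm : MapsTo t W U')
    (hc : r.Compatible r' t z W vmax umax) {p : ℝ × E2} (hp : p ∈ slab a W) :
    d'.fn (p.1, t p.2) = d.fn p := by
  have hz := hc.z_smooth
  obtain ⟨A, B, A', B', h, rfl⟩ := hd
  obtain ⟨A₁, B₁, A₁', B₁', h₁, rfl⟩ := hd'
  rw [← fn_pullback ht hm _ hp]
  refine congrArg (fun f => fn f p) ((pullback a ht hm).riccati_det h₁ h (z := star (const a hz))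
    (by rw [star_star, mul_comm, const_unitary hz hc.z_norm])
    (by rw [D_star, D_const hz, star_zero]) (map_zero _) ?_ ?_ ?_)
  · refine ext_fn fun q hq => ?_
    have hs := slab_subset ha hq
    rw [fn_pullback ht hm _ hq, inPsi4, inPsi4, pow_two, fn_mul, fn_mul, fn_star, fn_const _ hq,
      fn_mk _ hq, fn_mk _ (mapsTo_lift hm hq)]
    simp only [hc.Psi4 q.1 hs.1 q.2 hq.2, pow_two]
  · refine congrArg ev (ext_fn fun q hq => ?_)
    rw [fn_pullback ht hm _ hq, fn_neg, fn_neg, fn_const _ hq, fn_const _ (mapsTo_lift hm hq)]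
    simp only [hc.mu q.2 hq.2]
  · refine congrArg ev (ext_fn fun q hq => ?_)
    rw [fn_pullback ht hm _ hq, pow_two, fn_mul, fn_mul, fn_star, fn_neg, fn_neg, fn_const _ hq,
      fn_const _ hq, fn_const _ (mapsTo_lift hm hq)]
    simp only [hc.lam q.2 hq.2]
    ring

end ReducedData.IsAdmissible

/-! ### Charts of the compact surface and a uniform lifetime -/

section Charts

variable {S : Type*} [TopologicalSpace S]

/-- The target of a chart, as an open set. -/
def targetOpens (e : OpenPartialHomeomorph S E2) : Opens E2 := ⟨e.target, e.open_target⟩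

/-- The domain of a change of charts, as an open set. -/
def overlapOpens (e e' : OpenPartialHomeomorph S E2) : Opens E2 :=
  ⟨(e.symm.trans e').source, (e.symm.trans e').open_source⟩

theorem overlapOpens_le (e e' : OpenPartialHomeomorph S E2) : overlapOpens e e' ≤ targetOpens e :=
  fun x hx => by
    have : x ∈ (e.symm.trans e').source := hx
    rw [OpenPartialHomeomorph.trans_source] at this
    exact this.1

theorem mapsTo_overlap (e e' : OpenPartialHomeomorph S E2) :
    MapsTo (fun x => e' (e.symm x)) (overlapOpens e e') (targetOpens e') := fun _ hx =>
  (e.symm.trans e').mapsTo.mono_right (by simp [OpenPartialHomeomorph.trans_target, targetOpens]) hx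

theorem contDiffOn_overlap [ChartedSpace E2 S] {e e' : OpenPartialHomeomorph S E2}
    (he : e ∈ IsManifold.maximalAtlas (𝓡 2) ∞ S) (he' : e' ∈ IsManifold.maximalAtlas (𝓡 2) ∞ S) :
    ContDiffOn ℝ ∞ (fun x => e' (e.symm x)) (overlapOpens e e') := by
  have h := IsManifold.compatible_of_mem_maximalAtlas he he'
  rw [contDiffGroupoid, mem_groupoid_of_pregroupoid] at h
  have h1 := h.1
  simp only [contDiffPregroupoid, mfld_simps] at h1
  exact h1

/-- Functions near `𝒮⋆`, given on the patches of a cover of the compact surface `𝒮⋆`, which are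
equal to one on `𝒮⋆`, have no zeros on a uniform neighbourhood of `𝒮⋆`. -/
theorem exists_uniform_ne_zero [CompactSpace S] {ι : Type*} (φ : ι → OpenPartialHomeomorph S E2)
    (hcover : ∀ p : S, ∃ i, p ∈ (φ i).source) {a : Ioi (0 : ℝ)}
    (d : ∀ i, SmoothFn a (targetOpens (φ i))) (h0 : ∀ i, ev (d i) = 1)
    (hd : ∀ i j, ∀ p ∈ slab a (overlapOpens (φ i) (φ j)),
      (d j).fn (p.1, φ j ((φ i).symm p.2)) = (d i).fn p) :
    ∃ a' : Ioi (0 : ℝ), (a' : ℝ) ≤ a ∧ ∀ i, ∀ p ∈ slab a' (targetOpens (φ i)), (d i).fn p ≠ 0 := by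
  -- Near each point of the surface one chart suffices, and there continuity from the value one
  -- keeps the function away from zero for a short time.
  have hloc : ∀ q : S, ∃ i, ∃ V : Set S, IsOpen V ∧ q ∈ V ∧ V ⊆ (φ i).source ∧ ∃ ε > 0,
      ε ≤ (a : ℝ) ∧ ∀ q' ∈ V, ∀ v ∈ Icc 0 ε, (d i).fn (v, φ i q') ≠ 0 := by
    intro q
    obtain ⟨i, hi⟩ := hcover q
    have hx : φ i q ∈ targetOpens (φ i) := (φ i).map_source hi
    have hp : ((0 : ℝ), φ i q) ∈ slab a (targetOpens (φ i)) := ⟨⟨le_rfl, le_of_lt a.2⟩, hx⟩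
    have h1 : (d i).fn (0, φ i q) = 1 := by
      have := congrArg (fun f => fn f ((0 : ℝ), φ i q)) (h0 i)
      simpa only [fn_ev _ hp, fn_one hp] using this
    have hc := ((d i).contDiffOn_fn.continuousOn _ hp).eventually_ne
      (b₂ := 0) (by rw [h1]; exact one_ne_zero)
    rw [nhdsWithin, Filter.eventually_inf_principal, nhds_prod_eq,
      Filter.eventually_prod_iff] at hc
    obtain ⟨pa, hpa, pb, hpb, hab⟩ := hc
    obtain ⟨ε, hε, hball⟩ := Metric.eventually_nhds_iff.1 hpa
    obtain ⟨V, hV, hVo, hqV⟩ := eventually_nhds_iff.1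
      (((φ i).continuousAt hi).eventually hpb)
    refine ⟨i, V ∩ (φ i).source, hVo.inter (φ i).open_source, ⟨hqV, hi⟩, inter_subset_right,
      min (ε / 2) a, lt_min (half_pos hε) a.2, min_le_right _ _, fun q' hq' v hv => ?_⟩
    refine hab (hball ?_) (hV q' hq'.1)
      ⟨⟨hv.1, hv.2.trans (min_le_right _ _)⟩, (φ i).map_source hq'.2⟩
    rw [Real.dist_eq, sub_zero, abs_of_nonneg hv.1]
    exact lt_of_le_of_lt (hv.2.trans (min_le_left _ _)) (half_lt_self hε)
  choose i V hVo hqV hVs ε hε hεa hne using hloc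
  obtain ⟨s, hs⟩ := isCompact_univ.elim_finite_subcover V hVo
    fun q _ => mem_iUnion.2 ⟨q, hqV q⟩
  have hmin : ∃ m > 0, m ≤ (a : ℝ) ∧ ∀ q ∈ s, m ≤ ε q := by
    classical
    clear hs
    induction s using Finset.induction_on with
    | empty => exact ⟨a, a.2, le_rfl, by simp⟩
    | insert q s _ ih =>
      obtain ⟨m, hm, hma, h⟩ := ih
      refine ⟨min m (ε q), lt_min hm (hε q), (min_le_left _ _).trans hma, fun q' hq' => ?_⟩
      rcases Finset.mem_insert.1 hq' with rfl | hq'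
      · exact min_le_right _ _
      · exact (min_le_left _ _).trans (h q' hq')
  obtain ⟨m, hm, hma, hmε⟩ := hmin
  refine ⟨⟨m, hm⟩, hma, fun j p hp => ?_⟩
  obtain ⟨q, hq⟩ := mem_iUnion.1 (hs (mem_univ ((φ j).symm p.2)))
  obtain ⟨hqs, hq⟩ := mem_iUnion.1 hq
  -- The family of patches may be infinite: a point in any patch is moved to one of the finitely
  -- many selected charts, where the bound is known.
  rw [← hd j (i q) p ⟨⟨hp.1.1, hp.1.2.trans hma⟩, ?_⟩]
  · exact hne q _ hq _ ⟨hp.1.1, hp.1.2.trans (hmε q hqs)⟩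
  · change p.2 ∈ ((φ j).symm.trans (φ (i q))).source
    rw [OpenPartialHomeomorph.trans_source]
    exact ⟨hp.2, hVs q hq⟩

end Charts
end StewartGauge
end

/-! ### The lemma on freely specifiable data -/

theorem mainTheorem5 {S : Type*} [TopologicalSpace S] [CompactSpace S]
    [ChartedSpace E2 S] [IsManifold (𝓡 2) ∞ S]
    -- coordinate patches of `𝒮⋆`, which cover it
    {ι : Type*} (φ : ι → OpenPartialHomeomorph S E2)
    (hφ : ∀ i, φ i ∈ IsManifold.maximalAtlas (𝓡 2) ∞ S)
    (hcover : ∀ p : S, ∃ i, p ∈ (φ i).source)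
    -- a reduced data set, given on each patch, with the spins `z i j` relating the frames
    (vmax umax : ℝ) (hv : 0 < vmax) (hu : 0 < umax)
    (r : ι → ReducedData) (z : ι → ι → E2 → ℂ)
    (hr : ∀ i, (r i).IsAdmissible (φ i).target vmax umax)
    (hz : ∀ i j, (r i).Compatible (r j) (fun x => φ j ((φ i).symm x)) (z i j)
      ((φ i).symm.trans (φ j)).source vmax umax) :
    -- determination: on every patch, the full data set is determined by the reduced one
    (∀ i, ∀ v₁ ∈ Set.Ioc 0 vmax, ∀ u₁ ∈ Set.Ioc 0 umax, ∀ F G : Fields,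
      IsCharacteristicData (φ i).target v₁ u₁ F → Induces (φ i).target v₁ u₁ F (r i) →
      IsCharacteristicData (φ i).target v₁ u₁ G → Induces (φ i).target v₁ u₁ G (r i) →
      AgreeOn (φ i).target v₁ u₁ F G) ∧
    -- existence near `𝒮⋆`
    ∃ v₁ ∈ Set.Ioc 0 vmax, ∃ u₁ ∈ Set.Ioc 0 umax, ∃ F : ι → Fields,
      (∀ i, IsCharacteristicData (φ i).target v₁ u₁ (F i) ∧
        Induces (φ i).target v₁ u₁ (F i) (r i)) ∧
      (∀ i j, CompatibleOn (F i) (F j) (fun x => φ j ((φ i).symm x)) (z i j)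
        ((φ i).symm.trans (φ j)).source v₁ u₁) ∧
      -- a vacuum solution in Stewart's gauge with this reduced data induces this full data set
      ∀ i, ∀ v₂ ∈ Set.Ioc 0 v₁, ∀ u₂ ∈ Set.Ioc 0 u₁, ∀ G : Fields,
        IsVacuumSolution (φ i).target v₂ u₂ G → Induces (φ i).target v₂ u₂ G (r i) →
        AgreeOn (φ i).target v₂ u₂ (F i) G := by
  -- Half the lifetime of the reduced data gives closed slabs on which they are smooth up to the
  -- end.
  have hvI : vmax / 2 < vmax := half_lt_self hv
  have huI : umax / 2 < umax := half_lt_self hu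
  set U : ι → TopologicalSpace.Opens E2 := fun i => targetOpens (φ i) with hU
  have hr' : ∀ i, (r i).IsAdmissible (U i) vmax umax := hr
  have ht := fun i j => contDiffOn_overlap (hφ i) (hφ j)
  have hm := fun i j => mapsTo_overlap (φ i) (φ j)
  have hW := fun i j => overlapOpens_le (φ i) (φ j)
  let a₀ : Set.Ioi (0 : ℝ) := ⟨vmax / 2, half_pos hv⟩
  let b₀ : Set.Ioi (0 : ℝ) := ⟨umax / 2, half_pos hu⟩
  choose d hd using fun i => show ∃ d, (hr' i).IsOutDet (a := a₀) hvI d from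
    exists_isRiccatiDet _ _ _ _
  choose d' hd' using fun i => show ∃ d, (hr' i).IsInDet (b := b₀) huI d from
    exists_isRiccatiDet _ _ _ _
  -- Invariance of the determinant is applied on the overlap, to which the determinant of the first
  -- patch is restricted.
  obtain ⟨a, ha, hne⟩ := exists_uniform_ne_zero φ hcover d (fun i => (hd i).ev_eq)
    fun i j p hp => by
      refine (((hr' i).mono (hW i j)).outDet_eq (hr' j) hvI
        ((hr' i).isOutDet_restrict hvI (hd i) le_rfl (hW i j)) (hd j) (ht i j) (hm i j) (hz i j)
        hp).trans (SmoothFn.fn_restrict _ hp)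
  obtain ⟨b, hb, hne'⟩ := exists_uniform_ne_zero φ hcover d' (fun i => (hd' i).ev_eq)
    fun i j p hp => by
      refine (((hr' i).mono (hW i j)).inDet_eq (hr' j) huI
        ((hr' i).isInDet_restrict huI (hd' i) le_rfl (hW i j)) (hd' j) (ht i j) (hm i j) (hz i j)
        hp).trans (SmoothFn.fn_restrict _ hp)
  have hav : (a : ℝ) ≤ vmax := ha.trans hvI.le
  have hbu : (b : ℝ) ≤ umax := hb.trans huI.le
  choose F hF hFr using fun i => ((hr' i).mono le_rfl).exists_characteristicData
    (ha.trans_lt hvI) (hb.trans_lt huI) ((hr' i).isOutDet_restrict hvI (hd i) ha le_rfl)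
    ((hr' i).isInDet_restrict huI (hd' i) hb le_rfl)
    (fun p hp => by rw [SmoothFn.fn_restrict _ hp]; exact hne i p hp)
    (fun p hp => by rw [SmoothFn.fn_restrict _ hp]; exact hne' i p hp)
  refine ⟨fun i v₁ hv₁ u₁ hu₁ F G hF hFr hG hGr =>
      agreeOn_of_induces (U := U i) hv₁.1 hu₁.1 hF hFr hG hGr,
    a, ⟨a.2, hav⟩, b, ⟨b.2, hbu⟩, F, fun i => ⟨hF i, hFr i⟩, fun i j => ?_,
    fun i v₂ hv₂ u₂ hu₂ G hG hGr => ?_⟩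
  · exact compatibleOn_of_compatible (ht i j) (hm i j) a.2 b.2 hav hbu
      ((hF i).mono (hW i j) le_rfl le_rfl) ((hFr i).mono (hW i j) le_rfl le_rfl) (hF j) (hFr j)
      (hz i j)
  -- A vacuum solution restricts to a full data set on the two hypersurfaces, so this is the
  -- uniqueness statement on the smaller intervals.
  · exact agreeOn_of_induces (U := U i) hv₂.1 hu₂.1 ((hF i).mono subset_rfl hv₂.2 hu₂.2)
      ((hFr i).mono subset_rfl hv₂.2 hu₂.2) (hG.isCharacteristicData hv₂.1 hu₂.1) hGr
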